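/- Let $\mathbb{T}^1=\mathbb{R}/\mathbb{Z}$ with normalized Lebesgue measure $m$. Derivatives of circle maps are real numbers (derivatives of lifts). Let $\mathcal{E}^1_0$ be the set of $C^1$ maps $f:\mathbb{T}^1\to\mathbb{T}^1$ with $f(0)=0$ for which there is $\lambda>1$ with $|(f^n)'(x)|>\lambda^n$ for all $x\in\mathbb{T}^1$ and all $n\ge 1$. Let $\mathcal{E}_0^{\mathrm{lip}}\supset\mathcal{E}^1_0$ be the set of Lipschitz local homeomorphisms $f:\mathbb{T}^1\to\mathbb{T}^1$ with $f(0)=0$ and $\operatorname{ess\,inf}|f'|>1$, with the Lipschitz metric $d_{\mathrm{lip}}(f,g)=\operatorname{ess\,sup}_{x}|f'(x)-g'(x)|$. For $f\in\mathcal{E}_0^{\mathrm{lip}}$, the Markov intervals of order $n\ge 0$ are the connected components of $\mathbb{T}^1\setminus f^{-n}(0)$. For a Markov interval $I$, let $I_f$ be the set of $x\in I$ with $f^n(x)\in I$ for some $n\ge1$, and let $f_I:I_f\to I$ be the first return map. Write $m_I$ for Lebesgue measure on $I$ and $(f_I)_*m_I$ for the measure $B\mapsto m(f_I^{-1}(B))$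 on $I$. The map $f_I$ is called distorted if it is non-singular, that is $(f_I)_*m_I\ll m_I$, and there is a measurable set $A\subset I$ with $m(A)/m(I)>0.4$ and $\dfrac{d\,(f_I)_*m_I}{dm_I}>2$ almost everywhere on $A$. For $\delta>0$, a map $f\in\mathcal{E}_0^{\mathrm{lip}}$ is called $\delta$-good if there is a family $\mathcal{I}$ of Markov intervals of $f$ (possibly of different orders), all of length at most $\delta$, such that $m\big(\bigcup_{I\in\mathcal{I}}I\big)>1-\delta$ and $f_I$ is distorted for every $I\in\mathcal{I}$. **Proposition.** For every $\delta>0$, the set of $\delta$-good maps in $\mathcal{E}^1_0$ is dense in $\mathcal{E}^1_0$ for the Lipschitz metric: for every $f\in\mathcal{E}^1_0$ and every $\varepsilon>0$ there is a $\delta$-good map $h\in\mathcal{E}^1_0$ with $d_{\mathrm{lip}}(h,f)<\varepsilon$. -/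

import Mathlib

open MeasureTheory Set Filter Topology
open scoped ENNReal NNReal

namespace GoodMaps

/-- The circle `ℝ / ℤ`. Its Mathlib measure `volume` is Lebesgue measure of total mass one. -/
abbrev T1 : Type := UnitAddCircle

/-- The representative in `[-1/2, 1/2)` of a point of the circle: the inverse, near `0`, of the
covering map `ℝ → ℝ / ℤ`. -/
noncomputable def centeredRep (x : T1) : ℝ :=
  ((AddCircle.equivIco (1 : ℝ) (-(1 / 2)) x : Ico (-(1 / 2) : ℝ) (-(1 / 2) + 1)) : ℝ)

/-- The (signed, real) derivative at `x` of a circle map `f`, computed in the coordinates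
`t ↦ x + t` at `x` and `t ↦ f x + t` at `f x`. It is the derivative of any continuous lift. -/
noncomputable def circleDeriv (f : T1 → T1) (x : T1) : ℝ :=
  deriv (fun t : ℝ => centeredRep (f (x + (t : T1)) - f x)) 0

/-- `f` is a `C¹` map of the circle: it has a `C¹` lift to the line. -/
def IsC1 (f : T1 → T1) : Prop :=
  ∃ F : ℝ → ℝ, ContDiff ℝ 1 F ∧ ∀ t : ℝ, f (t : T1) = (F t : T1)

/-- The expansion condition with constant `c`: there is `r > 1` with `|(f^n)'(x)| > c r ^ n` for
all `x` and all `n ≥ 1`. -/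
def IsExpandingWith (c : ℝ) (f : T1 → T1) : Prop :=
  ∃ r : ℝ, 1 < r ∧ ∀ x : T1, ∀ n : ℕ, 1 ≤ n → c * r ^ n < |circleDeriv (f^[n]) x|

/-- The `C¹` expanding maps of the circle that fix `0` and are expanding with constant `1`. -/
def E10 : Set (T1 → T1) :=
  {f | IsC1 f ∧ f 0 = 0 ∧ IsExpandingWith 1 f}

/-- The Lipschitz local homeomorphisms of the circle that fix `0` and whose derivative has
absolute value of essential infimum larger than `1`. -/
def E0lip : Set (T1 → T1) :=
  {f | (∃ K : ℝ≥0, LipschitzWith K f) ∧ IsLocalHomeomorph f ∧ f 0 = 0 ∧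
    1 < essInf (fun x => ‖circleDeriv f x‖ₑ) (volume : Measure T1)}

/-- The Lipschitz metric `ess sup |f' - g'|`. -/
noncomputable def dLip (f g : T1 → T1) : ℝ≥0∞ :=
  essSup (fun x => ‖circleDeriv f x - circleDeriv g x‖ₑ) (volume : Measure T1)

/-- A Markov interval of order `n` of `f` (with `f 0 = 0`): a connected component of the complement
of `f⁻ⁿ(0)`. -/
def IsMarkovIntervalOfOrder (f : T1 → T1) (n : ℕ) (I : Set T1) : Prop :=
  ∃ x : T1, f^[n] x ≠ 0 ∧ I = connectedComponentIn {y | f^[n] y ≠ 0} x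

/-- A Markov interval of `f`, of some order. -/
def IsMarkovInterval (f : T1 → T1) (I : Set T1) : Prop :=
  ∃ n : ℕ, IsMarkovIntervalOfOrder f n I

/-- The set of points of `X` that return to `X` by forward iteration of `f`. -/
def returnSet (f : T1 → T1) (X : Set T1) : Set T1 :=
  {x | x ∈ X ∧ ∃ n : ℕ, 1 ≤ n ∧ f^[n] x ∈ X}

/-- The first return time to `X`, meaningful on `returnSet f X`. -/
noncomputable def returnTime (f : T1 → T1) (X : Set T1) (x : T1) : ℕ :=
  sInf {n : ℕ | 1 ≤ n ∧ f^[n] x ∈ X}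

/-- The first return map to `X`; it is used only on its domain `returnSet f X`. -/
noncomputable def firstReturn (f : T1 → T1) (X : Set T1) (x : T1) : T1 :=
  f^[returnTime f X x] x

/-- The push-forward `φ_* m_I` of Lebesgue measure on `I` under a map `φ` with domain `D ⊆ I`:
it gives `B` the mass `m (D ∩ φ⁻¹ B)`. -/
noncomputable def pushLebesgue (D : Set T1) (φ : T1 → T1) : Measure T1 :=
  ((volume : Measure T1).restrict D).map φ

/-- The map `φ : D → I`, with `D ⊆ I`, is non-singular and distorted: on a measurable set `A ⊆ I`
with `m A / m I > 0.4`, the density of `φ_* m_I` with respect to `m_I` is larger than `2`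
almost everywhere. -/
def IsDistorted (I D : Set T1) (φ : T1 → T1) : Prop :=
  D ⊆ I ∧ MapsTo φ D I ∧
  pushLebesgue D φ ≪ (volume : Measure T1).restrict I ∧
  ∃ A : Set T1, A ⊆ I ∧ MeasurableSet A ∧
    (4 / 10 : ℝ) < (volume : Measure T1).real A / (volume : Measure T1).real I ∧
    ∀ᵐ y ∂((volume : Measure T1).restrict A),
      2 < (pushLebesgue D φ).rnDeriv ((volume : Measure T1).restrict I) y

/-- `f` is `δ`-good. -/
def IsGood (δ : ℝ) (f : T1 → T1) : Prop :=
  f ∈ E0lip ∧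
  ∃ 𝓘 : Set (Set T1),
    (∀ I ∈ 𝓘, IsMarkovInterval f I ∧ (volume : Measure T1).real I ≤ δ) ∧
    1 - δ < (volume : Measure T1).real (⋃₀ 𝓘) ∧
    ∀ I ∈ 𝓘, IsDistorted I (returnSet f I) (firstReturn f I)

end GoodMaps

/-! Averaging a `C¹` lift over short intervals gives a `C²` lift `G` with nearly the same derivative
and the same lower bound for it (`exists_expLift_near`), so only `C²` maps have to be perturbed.

For such `G`, bounded distortion and the density theorem show that almost every point visits each
nonempty open periodic set (`ae_exists_iterate_mem`). First hitting times of a small set then yield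
a tower (`exists_tower`). Level `n` consists of the intervals of order `p + n` with index in `V`;
`G` lowers the level by one; levels `0, …, s + M` are disjoint, and levels `0, …, s` already cover
almost everything.

The perturbed map is `H = G ∘ shear`. In the upper `M` levels the shear contracts the middle part of
each interval towards its centre by `1 - κ`, and it is the identity near the ends. A small `κ` keeps
the derivative close to that of `G`, while `(1 - κ)^M = 0.455` is fixed. The intervals of the tower
do not move (`comp_shear_cyl`). Let `I` be an interval of level `n ≤ s`. As the levels are disjoint,
each return branch of `I` has order at least `p + s + M`, so it runs through all `M` perturbed
levels just before descending to `I`. Over the central 42% of `I` the derivative of the branch is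
then at most `0.48` times `|I| / |branch|` (`jac_mul_rad_le_of_return`). Hence each branch gives a
set in the middle of `I` at least `1 / 0.48` times its proportional share. The branches fill `I` up
to a null set, so the density exceeds 2 there (`volume_le_volume_firstReturn`).

The difficulty is the distortion of the long initial part of a branch, which may meet perturbed
levels many times, the second derivative of the shear being inverse to the length of an interval.
Disjointness helps again: at a visit to a perturbed level `n`, with `q` steps left before the top
level, necessarily `n < q`. The piece of branch is then exponentially short compared with the
interval of the tower around it, and the sum over `q` is small when `s` is large
(`abs_deriv_shear_sub_le_exp`, `jac_le_of_return`). This needs a shrinking rate whose constants do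
not depend on `p` (`rad_le_exp_mul`), because the parameters are chosen in the order `M` and `κ`,
then `s`, then `p`. -/

namespace GoodMaps

/-! ### Expanding lifts and their Markov intervals -/

/-- A `C²` lift to the line, fixing `0`, of a circle map of degree `d` whose derivative has absolute
value at least `r > 1`. -/
structure ExpLift (F : ℝ → ℝ) (d : ℤ) (r : ℝ) : Prop where
  contDiff : ContDiff ℝ 2 F
  map_zero : F 0 = 0
  map_add_one : ∀ x, F (x + 1) = F x + d
  one_lt : 1 < r
  le_abs_deriv : ∀ x, r ≤ |deriv F x|

/-- The lifted Markov interval of order `m` that `F^m` maps onto `(k, k + 1)`. -/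
def cyl (F : ℝ → ℝ) (m : ℕ) (k : ℤ) : Set ℝ := {x | (k : ℝ) < F^[m] x ∧ F^[m] x < k + 1}

/-- The preimage of the integer `k` under `F^m`. -/
noncomputable def endpt (F : ℝ → ℝ) (m : ℕ) (k : ℤ) : ℝ := Function.invFun F^[m] (k : ℝ)

/-- The centre of `cyl F m k`. -/
noncomputable def cen (F : ℝ → ℝ) (m : ℕ) (k : ℤ) : ℝ := (endpt F m k + endpt F m (k + 1)) / 2

/-- Half of the length of `cyl F m k`. -/
noncomputable def rad (F : ℝ → ℝ) (m : ℕ) (k : ℤ) : ℝ := |endpt F m (k + 1) - endpt F m k| / 2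

/-- The absolute value of the derivative of `F^n`. -/
noncomputable def jac (F : ℝ → ℝ) (n : ℕ) (x : ℝ) : ℝ :=
  ∏ i ∈ Finset.range n, |deriv F (F^[i] x)|

lemma exists_mem_uIoo_sub_eq {f : ℝ → ℝ} (hf : Differentiable ℝ f) {a b : ℝ} (hab : a ≠ b) :
    ∃ ξ ∈ Ioo (min a b) (max a b), f b - f a = deriv f ξ * (b - a) := by
  rcases lt_or_gt_of_ne hab with h | h
  · obtain ⟨ξ, hξ, e⟩ := exists_deriv_eq_slope f h hf.continuous.continuousOn hf.differentiableOn
    refine ⟨ξ, by rwa [min_eq_left h.le, max_eq_right h.le], ?_⟩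
    rw [e]; field_simp [sub_ne_zero.2 h.ne']
  · obtain ⟨ξ, hξ, e⟩ := exists_deriv_eq_slope f h hf.continuous.continuousOn hf.differentiableOn
    refine ⟨ξ, by rwa [min_eq_right h.le, max_eq_left h.le], ?_⟩
    have : a - b ≠ 0 := sub_ne_zero.2 h.ne'
    rw [e]; field_simp; ring

lemma iterate_mem_cyl_iff {F : ℝ → ℝ} {m i : ℕ} {k : ℤ} {x : ℝ} :
    F^[i] x ∈ cyl F m k ↔ x ∈ cyl F (m + i) k := by
  simp only [cyl, mem_ofPred_eq, Function.iterate_add_apply]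

lemma jac_add (F : ℝ → ℝ) (m n : ℕ) (x : ℝ) : jac F (m + n) x = jac F m x * jac F n (F^[m] x) := by
  simp only [jac, Finset.prod_range_add]
  congr 1
  refine Finset.prod_congr rfl fun i _ => ?_
  rw [← Function.iterate_add_apply, add_comm m i]

lemma jac_succ (F : ℝ → ℝ) (n : ℕ) (x : ℝ) :
    jac F (n + 1) x = |deriv F x| * jac F n (F x) := by
  rw [add_comm, jac_add]; simp [jac]

lemma jac_one (F : ℝ → ℝ) (x : ℝ) : jac F 1 x = |deriv F x| := by simp [jac]

lemma jac_zero (F : ℝ → ℝ) (x : ℝ) : jac F 0 x = 1 := by simp [jac]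

namespace ExpLift

variable {F : ℝ → ℝ} {d : ℤ} {r : ℝ}

lemma differentiable (h : ExpLift F d r) : Differentiable ℝ F :=
  h.contDiff.differentiable (by norm_num)

lemma continuous (h : ExpLift F d r) : Continuous F := h.differentiable.continuous

lemma continuous_iterate (h : ExpLift F d r) (n : ℕ) : Continuous F^[n] := h.continuous.iterate n

lemma differentiable_iterate (h : ExpLift F d r) (n : ℕ) : Differentiable ℝ F^[n] :=
  h.differentiable.iterate n

lemma pos (h : ExpLift F d r) : 0 < r := zero_lt_one.trans h.one_lt

lemma deriv_ne_zero (h : ExpLift F d r) (x : ℝ) : deriv F x ≠ 0 := fun e => by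
  have := h.le_abs_deriv x
  rw [e, abs_zero] at this
  linarith [h.one_lt]

lemma abs_deriv_iterate (h : ExpLift F d r) (n : ℕ) (x : ℝ) : |deriv F^[n] x| = jac F n x := by
  induction n generalizing x with
  | zero => simp [jac]
  | succ n ih =>
    rw [Function.iterate_succ, deriv_comp _ (h.differentiable_iterate n _) (h.differentiable _),
      abs_mul, ih, jac_succ, mul_comm]

lemma pow_le_jac (h : ExpLift F d r) (n : ℕ) (x : ℝ) : r ^ n ≤ jac F n x := by
  have := Finset.prod_le_prod (s := Finset.range n) (f := fun _ => r)
    (g := fun i => |deriv F (F^[i] x)|) (fun _ _ => h.pos.le) (fun i _ => h.le_abs_deriv _)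
  simpa [jac] using this

lemma jac_pos (h : ExpLift F d r) (n : ℕ) (x : ℝ) : 0 < jac F n x :=
  (pow_pos h.pos n).trans_le (h.pow_le_jac n x)

lemma pow_mul_abs_sub_le (h : ExpLift F d r) (n : ℕ) (x y : ℝ) :
    r ^ n * |x - y| ≤ |F^[n] x - F^[n] y| := by
  rcases eq_or_ne y x with rfl | hne
  · simp
  · obtain ⟨ξ, -, e⟩ := exists_mem_uIoo_sub_eq (h.differentiable_iterate n) hne
    rw [e, abs_mul, h.abs_deriv_iterate]
    exact mul_le_mul_of_nonneg_right (h.pow_le_jac n ξ) (abs_nonneg _)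

lemma injective_iterate (h : ExpLift F d r) (n : ℕ) : Function.Injective F^[n] := fun x y e => by
  have := h.pow_mul_abs_sub_le n x y
  rw [e, sub_self, abs_zero] at this
  have h2 := pow_pos h.pos n
  have : |x - y| ≤ 0 := by nlinarith [abs_nonneg (x - y)]
  exact sub_eq_zero.1 (abs_nonpos_iff.1 this)

lemma surjective (h : ExpLift F d r) : Function.Surjective F := by
  have hb : ∀ N : ℝ, ∃ R : ℝ, 0 ≤ R ∧ ∀ x, R ≤ |x| → N ≤ |F x| := fun N => by
    refine ⟨|N|, abs_nonneg _, fun x hx => ?_⟩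
    have := h.pow_mul_abs_sub_le 1 x 0
    simp only [pow_one, sub_zero, Function.iterate_one, h.map_zero] at this
    nlinarith [h.one_lt, le_abs_self N, abs_nonneg x]
  intro y
  obtain ⟨R, hR, hx⟩ := hb (|y| + 1)
  have h1 := hx R (by rw [abs_of_nonneg hR])
  have h2 := hx (-R) (by rw [abs_neg, abs_of_nonneg hR])
  have hy := abs_le.1 (le_refl |y|)
  rcases h.continuous.strictMono_of_inj (h.injective_iterate 1) with hm | hm
  · have m1 : 0 ≤ F R := h.map_zero ▸ hm.monotone hR
    have m2 : F (-R) ≤ 0 := h.map_zero ▸ hm.monotone (neg_nonpos.2 hR)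
    rw [abs_of_nonneg m1] at h1
    rw [abs_of_nonpos m2] at h2
    obtain ⟨x, -, e⟩ := intermediate_value_Icc (show -R ≤ R by linarith) h.continuous.continuousOn
      (show y ∈ Icc (F (-R)) (F R) from ⟨by linarith, by linarith⟩)
    exact ⟨x, e⟩
  · have m1 : F R ≤ 0 := h.map_zero ▸ hm.antitone hR
    have m2 : 0 ≤ F (-R) := h.map_zero ▸ hm.antitone (neg_nonpos.2 hR)
    rw [abs_of_nonpos m1] at h1
    rw [abs_of_nonneg m2] at h2
    obtain ⟨x, -, e⟩ := intermediate_value_Icc' (show -R ≤ R by linarith) h.continuous.continuousOn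
      (show y ∈ Icc (F R) (F (-R)) from ⟨by linarith, by linarith⟩)
    exact ⟨x, e⟩

lemma bijective_iterate (h : ExpLift F d r) (n : ℕ) : Function.Bijective F^[n] :=
  ⟨h.injective_iterate n, h.surjective.iterate n⟩

lemma iterate_endpt (h : ExpLift F d r) (m : ℕ) (k : ℤ) : F^[m] (endpt F m k) = k :=
  Function.invFun_eq (h.surjective.iterate m _)

lemma iterate_eq_iff (h : ExpLift F d r) {m : ℕ} {k : ℤ} {x : ℝ} :
    F^[m] x = k ↔ x = endpt F m k :=
  ⟨fun e => h.injective_iterate m (e.trans (h.iterate_endpt m k).symm),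
    fun e => e ▸ h.iterate_endpt m k⟩

lemma iterate_endpt_add (h : ExpLift F d r) (m i : ℕ) (k : ℤ) :
    F^[i] (endpt F (m + i) k) = endpt F m k := by
  rw [← h.iterate_eq_iff, ← Function.iterate_add_apply, h.iterate_endpt]

lemma endpt_ne (h : ExpLift F d r) (m : ℕ) (k : ℤ) : endpt F m k ≠ endpt F m (k + 1) := fun e => by
  have := congrArg F^[m] e
  rw [h.iterate_endpt, h.iterate_endpt] at this
  push_cast at this
  linarith

lemma rad_pos (h : ExpLift F d r) (m : ℕ) (k : ℤ) : 0 < rad F m k :=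
  div_pos (abs_pos.2 (sub_ne_zero.2 (h.endpt_ne m k).symm)) two_pos

lemma rad_le (h : ExpLift F d r) (m : ℕ) (k : ℤ) : rad F m k ≤ (r ^ m)⁻¹ / 2 := by
  have := h.pow_mul_abs_sub_le m (endpt F m (k + 1)) (endpt F m k)
  rw [h.iterate_endpt, h.iterate_endpt] at this
  push_cast at this
  rw [add_sub_cancel_left, abs_one] at this
  have hp := pow_pos h.pos m
  rw [rad]
  gcongr
  rw [← one_div, le_div_iff₀ hp]
  linarith

lemma rad_zero (h : ExpLift F d r) (k : ℤ) : rad F 0 k = 1 / 2 := by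
  have e : ∀ k, endpt F 0 k = k := fun k => h.iterate_endpt 0 k
  rw [rad, e, e]; push_cast; simp

lemma rad_le_half (h : ExpLift F d r) (m : ℕ) (k : ℤ) : rad F m k ≤ 1 / 2 := by
  have := h.rad_le m k
  have : (r ^ m)⁻¹ ≤ 1 := inv_le_one_of_one_le₀ (one_le_pow₀ h.one_lt.le)
  linarith

lemma cyl_eq_uIoo (h : ExpLift F d r) (m : ℕ) (k : ℤ) :
    cyl F m k = Ioo (min (endpt F m k) (endpt F m (k + 1)))
      (max (endpt F m k) (endpt F m (k + 1))) := by
  have e1 := h.iterate_endpt m k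
  have e2 := h.iterate_endpt m (k + 1)
  push_cast at e2
  ext x
  simp only [cyl, mem_ofPred_eq, mem_Ioo]
  rcases (h.continuous_iterate m).strictMono_of_inj (h.injective_iterate m) with hm | hm
  · have : endpt F m k < endpt F m (k + 1) := by rw [← hm.lt_iff_lt, e1, e2]; linarith
    rw [min_eq_left this.le, max_eq_right this.le, ← hm.lt_iff_lt (b := x),
      ← hm.lt_iff_lt (a := x), e1, e2]
  · have : endpt F m (k + 1) < endpt F m k := by rw [← hm.lt_iff_gt, e1, e2]; linarith
    rw [min_eq_right this.le, max_eq_left this.le, ← hm.lt_iff_gt (b := x),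
      ← hm.lt_iff_gt (a := x), e1, e2, and_comm]

lemma cen_sub_rad (F : ℝ → ℝ) (m : ℕ) (k : ℤ) :
    cen F m k - rad F m k = min (endpt F m k) (endpt F m (k + 1)) := by
  rw [cen, rad]
  rcases le_total (endpt F m k) (endpt F m (k + 1)) with h | h
  · rw [min_eq_left h, abs_of_nonneg (sub_nonneg.2 h)]; ring
  · rw [min_eq_right h, abs_of_nonpos (sub_nonpos.2 h)]; ring

lemma cen_add_rad (F : ℝ → ℝ) (m : ℕ) (k : ℤ) :
    cen F m k + rad F m k = max (endpt F m k) (endpt F m (k + 1)) := by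
  rw [cen, rad]
  rcases le_total (endpt F m k) (endpt F m (k + 1)) with h | h
  · rw [max_eq_right h, abs_of_nonneg (sub_nonneg.2 h)]; ring
  · rw [max_eq_left h, abs_of_nonpos (sub_nonpos.2 h)]; ring

lemma cyl_eq_Ioo (h : ExpLift F d r) (m : ℕ) (k : ℤ) :
    cyl F m k = Ioo (cen F m k - rad F m k) (cen F m k + rad F m k) := by
  rw [h.cyl_eq_uIoo, cen_sub_rad, cen_add_rad]

lemma cyl_eq_ball (h : ExpLift F d r) (m : ℕ) (k : ℤ) :
    cyl F m k = Metric.ball (cen F m k) (rad F m k) := by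
  rw [h.cyl_eq_Ioo, Real.ball_eq_Ioo]

lemma mem_cyl_iff (h : ExpLift F d r) {m : ℕ} {k : ℤ} {x : ℝ} :
    x ∈ cyl F m k ↔ |x - cen F m k| < rad F m k := by
  rw [h.cyl_eq_ball, Metric.mem_ball, Real.dist_eq]

lemma cen_mem_cyl (h : ExpLift F d r) (m : ℕ) (k : ℤ) : cen F m k ∈ cyl F m k := by
  rw [h.mem_cyl_iff, sub_self, abs_zero]; exact h.rad_pos m k

lemma abs_endpt_sub_cen (F : ℝ → ℝ) (m : ℕ) (k : ℤ) : |endpt F m k - cen F m k| = rad F m k := by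
  rw [cen, rad, show endpt F m k - (endpt F m k + endpt F m (k + 1)) / 2 =
    (endpt F m k - endpt F m (k + 1)) / 2 by ring, abs_div, abs_two, abs_sub_comm]

lemma abs_endpt_succ_sub_cen (F : ℝ → ℝ) (m : ℕ) (k : ℤ) :
    |endpt F m (k + 1) - cen F m k| = rad F m k := by
  rw [cen, rad, show endpt F m (k + 1) - (endpt F m k + endpt F m (k + 1)) / 2 =
    (endpt F m (k + 1) - endpt F m k) / 2 by ring, abs_div, abs_two]

lemma isOpen_cyl (h : ExpLift F d r) (m : ℕ) (k : ℤ) : IsOpen (cyl F m k) := by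
  rw [h.cyl_eq_ball]; exact Metric.isOpen_ball

lemma ordConnected_cyl (h : ExpLift F d r) (m : ℕ) (k : ℤ) : (cyl F m k).OrdConnected := by
  rw [h.cyl_eq_Ioo]; exact ordConnected_Ioo

lemma volume_cyl (h : ExpLift F d r) (m : ℕ) (k : ℤ) :
    volume (cyl F m k) = ENNReal.ofReal (2 * rad F m k) := by
  rw [h.cyl_eq_Ioo, Real.volume_Ioo]; congr 1; ring

lemma abs_sub_lt_of_mem_cyl (h : ExpLift F d r) {m : ℕ} {k : ℤ} {x y : ℝ} (hx : x ∈ cyl F m k)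
    (hy : y ∈ cyl F m k) : |x - y| < 2 * rad F m k := by
  rw [h.mem_cyl_iff] at hx hy
  have := abs_sub_le x (cen F m k) y
  rw [abs_sub_comm (cen F m k)] at this
  linarith

/-- Every Markov interval is mapped with a mean derivative. -/
lemma exists_jac_mul_rad (h : ExpLift F d r) (m i : ℕ) (k : ℤ) :
    ∃ ξ ∈ cyl F (m + i) k, jac F i ξ * rad F (m + i) k = rad F m k := by
  obtain ⟨ξ, hξ, e⟩ := exists_mem_uIoo_sub_eq (h.differentiable_iterate i) (h.endpt_ne (m + i) k)
  refine ⟨ξ, by rwa [h.cyl_eq_uIoo], ?_⟩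
  rw [h.iterate_endpt_add, h.iterate_endpt_add] at e
  rw [rad, rad, e, abs_mul, h.abs_deriv_iterate, mul_div_assoc]

lemma jac_mul_rad_le (h : ExpLift F d r) {m i : ℕ} {k : ℤ} {E : ℝ}
    (hE : ∀ x ∈ cyl F (m + i) k, ∀ y ∈ cyl F (m + i) k, jac F i x ≤ E * jac F i y) {x : ℝ}
    (hx : x ∈ cyl F (m + i) k) : jac F i x * rad F (m + i) k ≤ E * rad F m k := by
  obtain ⟨ξ, hξ, e⟩ := h.exists_jac_mul_rad m i k
  rw [← e, ← mul_assoc]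
  exact mul_le_mul_of_nonneg_right (hE x hx ξ hξ) (h.rad_pos _ _).le

lemma rad_le_jac_mul (h : ExpLift F d r) {m i : ℕ} {k : ℤ} {E : ℝ}
    (hE : ∀ x ∈ cyl F (m + i) k, ∀ y ∈ cyl F (m + i) k, jac F i x ≤ E * jac F i y) {x : ℝ}
    (hx : x ∈ cyl F (m + i) k) : rad F m k ≤ E * (jac F i x * rad F (m + i) k) := by
  obtain ⟨ξ, hξ, e⟩ := h.exists_jac_mul_rad m i k
  rw [← e, ← mul_assoc]
  exact mul_le_mul_of_nonneg_right (hE ξ hξ x hx) (h.rad_pos _ _).le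

/-- Under bounded distortion the ratio of nested Markov intervals is almost invariant. -/
lemma rad_mul_rad_le (h : ExpLift F d r) {m m₁ i : ℕ} {k k₁ : ℤ} {E : ℝ}
    (hE : ∀ x ∈ cyl F (m + i) k, ∀ y ∈ cyl F (m + i) k, jac F i x ≤ E * jac F i y)
    (hsub : cyl F (m₁ + i) k₁ ⊆ cyl F (m + i) k) :
    rad F (m₁ + i) k₁ * rad F m k ≤ E * rad F m₁ k₁ * rad F (m + i) k := by
  obtain ⟨ξ, hξ, e⟩ := h.exists_jac_mul_rad m₁ i k₁
  have h1 := h.rad_le_jac_mul hE (hsub hξ)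
  calc rad F (m₁ + i) k₁ * rad F m k
      ≤ rad F (m₁ + i) k₁ * (E * (jac F i ξ * rad F (m + i) k)) :=
        mul_le_mul_of_nonneg_left h1 (h.rad_pos _ _).le
    _ = E * rad F m₁ k₁ * rad F (m + i) k := by rw [← e]; ring

lemma map_add_intCast (h : ExpLift F d r) (x : ℝ) (j : ℤ) : F (x + j) = F x + (d * j : ℤ) := by
  induction j using Int.induction_on with
  | zero => simp
  | succ j ih =>
    have := h.map_add_one (x + (j : ℤ))
    push_cast at this ih ⊢
    rw [← add_assoc, this, ih]; ring
  | pred j ih =>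
    have := h.map_add_one (x + (-(j : ℤ) - 1 : ℤ))
    push_cast at this ih ⊢
    rw [show x + (-(j : ℝ) - 1) + 1 = x + -(j : ℝ) by ring, ih] at this
    linarith

lemma iterate_add_intCast (h : ExpLift F d r) (m : ℕ) (x : ℝ) (j : ℤ) :
    F^[m] (x + j) = F^[m] x + (d ^ m * j : ℤ) := by
  induction m generalizing x j with
  | zero => simp
  | succ m ih =>
    rw [Function.iterate_succ_apply, h.map_add_intCast, ih, ← Function.iterate_succ_apply]
    congr 2; ring

lemma add_intCast_mem_cyl (h : ExpLift F d r) {m : ℕ} {k j : ℤ} {x : ℝ} :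
    x + j ∈ cyl F m (k + d ^ m * j) ↔ x ∈ cyl F m k := by
  simp only [cyl, mem_ofPred_eq, h.iterate_add_intCast]
  push_cast
  constructor <;> rintro ⟨h1, h2⟩ <;> constructor <;> linarith

lemma iterate_intCast (h : ExpLift F d r) (m : ℕ) (j : ℤ) : F^[m] (j : ℝ) = (d ^ m * j : ℤ) := by
  have := h.iterate_add_intCast m 0 j
  rwa [zero_add, Function.iterate_fixed h.map_zero, zero_add] at this

lemma deriv_add_intCast (h : ExpLift F d r) (x : ℝ) (j : ℤ) : deriv F (x + j) = deriv F x := by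
  rw [← deriv_comp_add_const]
  simp only [h.map_add_intCast, deriv_add_const]

lemma intCast_notMem_cyl (h : ExpLift F d r) (m : ℕ) (k j : ℤ) : (j : ℝ) ∉ cyl F m k := by
  simp only [cyl, mem_ofPred_eq, h.iterate_intCast, not_and, not_lt]
  intro h1
  have : k < d ^ m * j := by exact_mod_cast h1
  exact_mod_cast Int.add_one_le_of_lt this

/-- The Markov property: `F^m` maps the finer interval into a single interval of order `m' - m`.
That interval contains no integer, so the image cannot cross `k` or `k + 1`. -/
lemma cyl_subset_cyl (h : ExpLift F d r) {m m' : ℕ} {k k' : ℤ} {x : ℝ} (hm : m ≤ m')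
    (hx : x ∈ cyl F m k) (hx' : x ∈ cyl F m' k') : cyl F m' k' ⊆ cyl F m k := by
  obtain ⟨i, rfl⟩ := Nat.exists_eq_add_of_le' hm
  intro y hy
  have hx2 := iterate_mem_cyl_iff.2 hx'
  rw [add_comm] at hx' hy
  have hx1 : F^[m] x ∈ cyl F i k' := iterate_mem_cyl_iff.2 (by rwa [add_comm])
  have hy1 : F^[m] y ∈ cyl F i k' := iterate_mem_cyl_iff.2 (by rwa [add_comm])
  have hc := h.ordConnected_cyl i k'
  constructor
  · by_contra hlt
    exact h.intCast_notMem_cyl i k' k (hc.out hy1 hx1 ⟨not_lt.1 hlt, hx.1.le⟩)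
  · by_contra hlt
    have := h.intCast_notMem_cyl i k' (k + 1)
    push_cast at this
    exact this (hc.out hx1 hy1 ⟨hx.2.le, not_lt.1 hlt⟩)

lemma mem_cyl_floor {m : ℕ} {x : ℝ} (hx : ∀ j : ℤ, F^[m] x ≠ j) : x ∈ cyl F m ⌊F^[m] x⌋ :=
  ⟨lt_of_le_of_ne (Int.floor_le _) (hx _).symm, Int.lt_floor_add_one _⟩

lemma eq_of_mem_cyl {m : ℕ} {k k' : ℤ} {x : ℝ} (hx : x ∈ cyl F m k) (hx' : x ∈ cyl F m k') :
    k = k' := by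
  have h1 := hx.1.trans hx'.2
  have h2 := hx'.1.trans hx.2
  have h1' : k < k' + 1 := by exact_mod_cast h1
  have h2' : k' < k + 1 := by exact_mod_cast h2
  omega

lemma countable_preimage_int (h : ExpLift F d r) :
    {x : ℝ | ∃ m : ℕ, ∃ j : ℤ, F^[m] x = j}.Countable := by
  have : {x : ℝ | ∃ m : ℕ, ∃ j : ℤ, F^[m] x = j} = ⋃ m : ℕ, ⋃ j : ℤ, {endpt F m j} := by
    ext x; simp [h.iterate_eq_iff, eq_comm]
  rw [this]
  exact countable_iUnion fun m => countable_iUnion fun j => countable_singleton _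

lemma ae_forall_iterate_ne (h : ExpLift F d r) :
    ∀ᵐ x : ℝ, ∀ m : ℕ, ∀ j : ℤ, F^[m] x ≠ j := by
  have := (h.countable_preimage_int.measure_zero volume)
  rw [ae_iff]
  convert this using 2
  ext x; simp

/-- A set is not larger than the preimage times the largest derivative there. -/
lemma volume_le_of_jac_le (h : ExpLift F d r) {m i : ℕ} {k : ℤ} {B : Set ℝ} {C : ℝ}
    (hB : MeasurableSet B) (hBk : B ⊆ cyl F m k)
    (hC : ∀ x ∈ cyl F (m + i) k, F^[i] x ∈ B → jac F i x ≤ C) :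
    volume B ≤ ENNReal.ofReal C * volume (cyl F (m + i) k ∩ F^[i] ⁻¹' B) := by
  set X := cyl F (m + i) k ∩ F^[i] ⁻¹' B with hX
  have hXm : MeasurableSet X :=
    (h.isOpen_cyl _ _).measurableSet.inter ((h.continuous_iterate i).measurable hB)
  have him : F^[i] '' X = B := by
    apply subset_antisymm
    · rintro _ ⟨x, hx, rfl⟩; exact hx.2
    · intro y hy
      obtain ⟨x, rfl⟩ := (h.bijective_iterate i).2 y
      exact ⟨x, ⟨iterate_mem_cyl_iff.1 (hBk hy), hy⟩, rfl⟩
  have := lintegral_image_eq_lintegral_abs_deriv_mul (s := X) (f := F^[i]) (f' := deriv F^[i]) hXm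
    (fun x _ => (h.differentiable_iterate i x).hasDerivAt.hasDerivWithinAt)
    (h.injective_iterate i).injOn (fun _ => 1)
  rw [him] at this
  simp only [lintegral_const, MeasurableSet.univ, Measure.restrict_apply, univ_inter, one_mul,
    mul_one] at this
  rw [this]
  calc ∫⁻ x in X, ENNReal.ofReal |deriv F^[i] x| ≤ ∫⁻ _ in X, ENNReal.ofReal C := by
        refine setLIntegral_mono measurable_const fun x hx => ENNReal.ofReal_le_ofReal ?_
        rw [h.abs_deriv_iterate]; exact hC x hx.1 hx.2
    _ = _ := by simp

end ExpLift

/-! ### Bounded distortion and ergodicity -/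

namespace ExpLift

variable {F : ℝ → ℝ} {d : ℤ} {r : ℝ}

lemma add_one_iff_add_intCast {p : ℝ → Prop} (hp : ∀ x, p (x + 1) ↔ p x) (x : ℝ) (j : ℤ) :
    p (x + j) ↔ p x := by
  induction j using Int.induction_on with
  | zero => simp
  | succ j ih => rw [← ih, ← hp (x + (j : ℤ))]; push_cast; rw [add_assoc]
  | pred j ih =>
    rw [← ih, ← hp]; push_cast; rw [show x + (-(j : ℝ) - 1) + 1 = x + -(j : ℝ) by ring]

lemma contDiff_deriv (h : ExpLift F d r) : ContDiff ℝ 1 (deriv F) := by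
  have := h.contDiff
  rw [show (2 : WithTop ℕ∞) = 1 + 1 by norm_num, contDiff_succ_iff_deriv] at this
  exact this.2.2

/-- The logarithm of the derivative is Lipschitz. -/
lemma exists_abs_log_deriv_sub_le (h : ExpLift F d r) :
    ∃ L : ℝ, 0 ≤ L ∧ ∀ x y, |Real.log (deriv F x) - Real.log (deriv F y)| ≤ L * |x - y| := by
  set ψ : ℝ → ℝ := fun x => Real.log (deriv F x) with hψ
  have hc : ContDiff ℝ 1 ψ := h.contDiff_deriv.log h.deriv_ne_zero
  have hcont : Continuous (deriv ψ) := hc.continuous_deriv le_rfl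
  have hper : ∀ (x : ℝ) (j : ℤ), deriv ψ (x + j) = deriv ψ x := fun x j => by
    rw [← deriv_comp_add_const]
    simp only [hψ, h.deriv_add_intCast]
  obtain ⟨L, hL⟩ := isCompact_Icc (a := (0 : ℝ)) (b := 1) |>.exists_bound_of_continuousOn
    hcont.continuousOn
  have hb : ∀ x, ‖deriv ψ x‖ ≤ L := fun x => by
    have := hL (x - ⌊x⌋) ⟨Int.fract_nonneg x, (Int.fract_lt_one x).le⟩
    rwa [← hper _ ⌊x⌋, sub_add_cancel] at this
  refine ⟨L, (norm_nonneg _).trans (hb 0), fun x y => ?_⟩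
  simpa [Real.norm_eq_abs] using Convex.norm_image_sub_le_of_norm_deriv_le (f := ψ) (x := y) (y := x)
    (s := univ) (fun x _ => (hc.differentiable one_ne_zero) x) (fun x _ => hb x) convex_univ trivial
    trivial

lemma log_jac (h : ExpLift F d r) (n : ℕ) (x : ℝ) :
    Real.log (jac F n x) = ∑ i ∈ Finset.range n, Real.log (deriv F (F^[i] x)) := by
  rw [jac, Real.log_prod fun i _ => abs_ne_zero.2 (h.deriv_ne_zero _)]
  simp only [Real.log_abs]

lemma jac_le_exp_mul (h : ExpLift F d r) {n : ℕ} {x y c : ℝ}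
    (hc : ∑ i ∈ Finset.range n,
      |Real.log (deriv F (F^[i] x)) - Real.log (deriv F (F^[i] y))| ≤ c) :
    jac F n x ≤ Real.exp c * jac F n y := by
  have hx := h.jac_pos n x
  have hy := h.jac_pos n y
  rw [← Real.log_le_log_iff hx (by positivity), Real.log_mul (Real.exp_pos c).ne' hy.ne',
    Real.log_exp, h.log_jac, h.log_jac, ← sub_le_iff_le_add, ← Finset.sum_sub_distrib]
  exact (Finset.sum_le_sum fun i _ => le_abs_self _).trans hc

lemma sum_abs_iterate_sub_le (h : ExpLift F d r) (n : ℕ) (x y : ℝ) :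
    ∑ i ∈ Finset.range n, |F^[i] x - F^[i] y| ≤ |F^[n] x - F^[n] y| / (r - 1) := by
  have hr : 0 < r - 1 := sub_pos.2 h.one_lt
  induction n with
  | zero => simp; positivity
  | succ n ih =>
    rw [Finset.sum_range_succ]
    have h1 := h.pow_mul_abs_sub_le 1 (F^[n] x) (F^[n] y)
    rw [pow_one, Function.iterate_one, ← Function.iterate_succ_apply' F,
      ← Function.iterate_succ_apply' F] at h1
    rw [le_div_iff₀ hr] at ih ⊢
    linarith

/-- Distances along the two orbits grow geometrically, so their sum is controlled by the last one,
which is at most 1. The resulting constant depends neither on `m` nor on `i`. -/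
lemma jac_le_of_lipschitz (h : ExpLift F d r) {L : ℝ} (hL0 : 0 ≤ L)
    (hL : ∀ x y, |Real.log (deriv F x) - Real.log (deriv F y)| ≤ L * |x - y|) {m i : ℕ} {k : ℤ}
    {x y : ℝ} (hx : x ∈ cyl F (m + i) k) (hy : y ∈ cyl F (m + i) k) :
    jac F i x ≤ Real.exp (L / (r - 1)) * jac F i y := by
  have hr : 0 < r - 1 := sub_pos.2 h.one_lt
  refine h.jac_le_exp_mul ?_
  calc _ ≤ ∑ j ∈ Finset.range i, L * |F^[j] x - F^[j] y| := Finset.sum_le_sum fun j _ => hL _ _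
    _ = L * ∑ j ∈ Finset.range i, |F^[j] x - F^[j] y| := by rw [Finset.mul_sum]
    _ ≤ L * (|F^[i] x - F^[i] y| / (r - 1)) :=
        mul_le_mul_of_nonneg_left (h.sum_abs_iterate_sub_le i x y) hL0
    _ ≤ L * (1 / (r - 1)) := by
        have := h.abs_sub_lt_of_mem_cyl (iterate_mem_cyl_iff.2 hx) (iterate_mem_cyl_iff.2 hy)
        have := h.rad_le_half m k
        gcongr
        linarith
    _ = L / (r - 1) := by ring

lemma cyl_zero (F : ℝ → ℝ) (k : ℤ) : cyl F 0 k = Ioo (k : ℝ) (k + 1) := by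
  ext x; simp [cyl]

/-- The complement of an invariant set takes up a definite part of every Markov interval. -/
lemma exists_mul_volume_le (h : ExpLift F d r) {N : Set ℝ} (hN : MeasurableSet N)
    (hper : ∀ x, x + 1 ∈ N ↔ x ∈ N) (hsub : ∀ x ∈ N, F x ∈ N)
    (hpos : volume (Ioo (0 : ℝ) 1 \ N) ≠ 0) :
    ∃ c : ℝ, 0 < c ∧ ∀ m k, ENNReal.ofReal (c * rad F m k) ≤ volume (cyl F m k \ N) := by
  obtain ⟨L, hL0, hL⟩ := h.exists_abs_log_deriv_sub_le
  set D := Real.exp (L / (r - 1)) with hD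
  have hDpos : 0 < D := Real.exp_pos _
  set b : ℝ≥0∞ := volume (Ioo (0 : ℝ) 1 \ N) with hb
  have hbfin : b ≠ ⊤ := ((measure_mono sdiff_subset).trans_lt measure_Ioo_lt_top).ne
  have hbk : ∀ k : ℤ, volume (cyl F 0 k \ N) = b := fun k => by
    rw [hb, ← measure_preimage_add_right volume (k : ℝ) (cyl F 0 k \ N)]
    congr 1
    ext x
    simp only [mem_preimage, Set.mem_sdiff, cyl_zero, mem_Ioo,
      add_one_iff_add_intCast (p := (· ∈ N)) hper]
    constructor <;> rintro ⟨⟨h1, h2⟩, h3⟩ <;> exact ⟨⟨by linarith, by linarith⟩, h3⟩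
  have hNm : ∀ m : ℕ, ∀ x ∈ N, F^[m] x ∈ N := fun m => by
    induction m with
    | zero => exact fun x hx => hx
    | succ m ih => exact fun x hx => by rw [Function.iterate_succ_apply]; exact ih _ (hsub x hx)
  have hb0 : 0 < b.toReal := ENNReal.toReal_pos hpos hbfin
  -- `F^m` stretches the interval, of length `2 * rad`, onto one of length 1 with distortion `D`; a
  -- part of measure `b` in the image comes from at least `b * 2 * rad / D`.
  refine ⟨b.toReal * 2 / D, by positivity, fun m k => ?_⟩
  have hr := h.rad_pos m k
  have key := h.volume_le_of_jac_le (m := 0) (i := m) (k := k) (B := cyl F 0 k \ N)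
    (C := D / (2 * rad F m k)) ((h.isOpen_cyl 0 k).measurableSet.diff hN) sdiff_subset
    (fun x hx _ => by
      have := h.jac_mul_rad_le (m := 0) (i := m) (k := k) (E := D)
        (fun x hx y hy => h.jac_le_of_lipschitz hL0 hL hx hy) hx
      rw [h.rad_zero, zero_add] at this
      rw [le_div_iff₀ (by positivity)]
      linarith)
  rw [hbk, zero_add] at key
  have hsub2 : cyl F m k ∩ F^[m] ⁻¹' (cyl F 0 k \ N) ⊆ cyl F m k \ N := fun x hx =>
    ⟨hx.1, fun hxN => hx.2.2 (hNm m x hxN)⟩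
  have key2 := key.trans (mul_le_mul_right (measure_mono (μ := volume) hsub2)
    (ENNReal.ofReal (D / (2 * rad F m k))))
  have hfin : volume (cyl F m k \ N) ≠ ⊤ := ((measure_mono sdiff_subset).trans_lt
    (by rw [h.volume_cyl]; exact ENNReal.ofReal_lt_top)).ne
  rw [← ENNReal.ofReal_toReal hfin] at key2 ⊢
  rw [← ENNReal.ofReal_mul (by positivity), ← ENNReal.ofReal_toReal hbfin,
    ENNReal.ofReal_le_ofReal_iff (by positivity), div_mul_eq_mul_div, le_div_iff₀ (by positivity)]
    at key2
  refine ENNReal.ofReal_le_ofReal ?_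
  rw [div_mul_eq_mul_div, div_le_iff₀ hDpos]
  linarith

/-- Ergodicity: an invariant set is null if its complement is not. -/
lemma volume_eq_zero_of_invariant (h : ExpLift F d r) {N : Set ℝ} (hN : MeasurableSet N)
    (hper : ∀ x, x + 1 ∈ N ↔ x ∈ N) (hsub : ∀ x ∈ N, F x ∈ N)
    (hpos : volume (Ioo (0 : ℝ) 1 \ N) ≠ 0) : volume N = 0 := by
  obtain ⟨c, hc, hcm⟩ := h.exists_mul_volume_le hN hper hsub hpos
  have hfalse : ∀ᵐ x ∂(volume.restrict N), False := by
    -- The Markov intervals around `x` are not centred at `x`, which calls for the density theorem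
    -- with moving centres; the factor 1 says that `x` lies in each ball.
    filter_upwards [IsUnifLocDoublingMeasure.ae_tendsto_measure_inter_div (volume : Measure ℝ) N 1,
      ae_restrict_of_ae h.ae_forall_iterate_ne] with x hx hne
    have ht := hx (l := atTop) (fun m : ℕ => cen F m ⌊F^[m] x⌋) (fun m : ℕ => rad F m ⌊F^[m] x⌋) (by
      rw [tendsto_nhdsWithin_iff]
      refine ⟨?_, Eventually.of_forall fun m => h.rad_pos _ _⟩
      refine squeeze_zero (fun m => (h.rad_pos _ _).le) (fun m => h.rad_le m _) ?_
      have := (tendsto_inv_atTop_zero.comp (tendsto_pow_atTop_atTop_of_one_lt h.one_lt)).div_const 2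
      simpa using this)
      (Eventually.of_forall fun m => by
        have := (h.mem_cyl_iff).1 (mem_cyl_floor (hne m))
        rw [one_mul, Metric.mem_closedBall, Real.dist_eq]; exact this.le)
    have hle : ∀ m : ℕ, volume (N ∩ Metric.closedBall (cen F m ⌊F^[m] x⌋) (rad F m ⌊F^[m] x⌋)) /
        volume (Metric.closedBall (cen F m ⌊F^[m] x⌋) (rad F m ⌊F^[m] x⌋)) ≤
        ENNReal.ofReal (1 - c / 2) := fun m => by
      set k := ⌊F^[m] x⌋
      have hr := h.rad_pos m k
      have h1 := hcm m k
      have hcb : volume (Metric.closedBall (cen F m k) (rad F m k)) =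
        ENNReal.ofReal (2 * rad F m k) := by rw [Real.volume_closedBall]
      refine ENNReal.div_le_of_le_mul ?_
      rw [hcb, ← ENNReal.ofReal_mul' (by positivity)]
      have hadd := measure_inter_add_sdiff (μ := (volume : Measure ℝ))
        (Metric.closedBall (cen F m k) (rad F m k)) hN
      have h2 : ENNReal.ofReal (c * rad F m k) ≤
          volume (Metric.closedBall (cen F m k) (rad F m k) \ N) := h1.trans (measure_mono (by
            rw [h.cyl_eq_ball]; exact sdiff_subset_sdiff_left Metric.ball_subset_closedBall))
      rw [inter_comm, hcb] at hadd
      have h3 : volume (N ∩ Metric.closedBall (cen F m k) (rad F m k)) +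
          ENNReal.ofReal (c * rad F m k) ≤ ENNReal.ofReal (2 * rad F m k) := by
        rw [← hadd]; gcongr
      have := ENNReal.le_sub_of_add_le_right ENNReal.ofReal_ne_top h3
      rw [← ENNReal.ofReal_sub _ (by positivity)] at this
      refine this.trans (le_of_eq ?_)
      congr 1; ring
    have := le_of_tendsto ht (Eventually.of_forall hle)
    rw [← ENNReal.ofReal_one] at this
    have h4 : (1 : ℝ) ≤ 1 - c / 2 := by
      by_contra hlt
      push Not at hlt
      exact absurd this (not_le.2 ((ENNReal.ofReal_lt_ofReal_iff one_pos).2 hlt))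
    linarith
  rw [eventually_false_iff_eq_bot, ae_eq_bot, Measure.restrict_eq_zero] at hfalse
  exact hfalse

/-- Almost every point visits every nonempty open periodic set at a positive time. -/
lemma ae_exists_iterate_mem (h : ExpLift F d r) {U : Set ℝ} (hU : IsOpen U)
    (hne : U.Nonempty) (hper : ∀ x, x + 1 ∈ U ↔ x ∈ U) :
    ∀ᵐ x : ℝ, ∃ n : ℕ, 1 ≤ n ∧ F^[n] x ∈ U := by
  set N : Set ℝ := {x | ∀ n : ℕ, 1 ≤ n → F^[n] x ∉ U} with hN
  have hNm : MeasurableSet N := by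
    have : N = ⋂ n : ℕ, ⋂ _ : 1 ≤ n, (F^[n] ⁻¹' U)ᶜ := by ext x; simp [hN]
    rw [this]
    exact MeasurableSet.iInter fun n => MeasurableSet.iInter fun _ =>
      ((h.continuous_iterate n).measurable hU.measurableSet).compl
  have hz : volume N = 0 := by
    refine h.volume_eq_zero_of_invariant hNm (fun x => ?_) (fun x hx n hn => ?_) ?_
    · simp only [hN, mem_ofPred_eq]
      refine forall_congr' fun n => forall_congr' fun _ => not_congr ?_
      have := h.iterate_add_intCast n x 1
      rw [Int.cast_one] at this
      rw [this]
      exact add_one_iff_add_intCast (p := (· ∈ U)) hper _ _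
    · rw [← Function.iterate_succ_apply]; exact hx (n + 1) (by omega)
    -- The complement of `N` contains the points that are in `U` at time one, a nonempty open set.
    -- Moving a preimage of `u` to its fractional part may give the boundary point `0`, hence the
    -- closure argument.
    · obtain ⟨u, hu⟩ := hne
      obtain ⟨y, rfl⟩ := h.surjective u
      have hy' : F (Int.fract y) ∈ U := by
        have := h.map_add_intCast (Int.fract y) ⌊y⌋
        rw [Int.fract_add_floor] at this
        rw [this] at hu
        exact (add_one_iff_add_intCast (p := (· ∈ U)) hper _ _).1 hu
      have hopen : IsOpen (F ⁻¹' U) := hU.preimage h.continuous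
      have hcl : Int.fract y ∈ closure (Ioo (0 : ℝ) 1) := by
        rw [closure_Ioo zero_ne_one]; exact ⟨Int.fract_nonneg y, (Int.fract_lt_one y).le⟩
      obtain ⟨z, hz1, hz2⟩ := mem_closure_iff.1 hcl _ hopen hy'
      have hpos : 0 < volume (Ioo (0 : ℝ) 1 ∩ F ⁻¹' U) :=
        (isOpen_Ioo.inter hopen).measure_pos volume ⟨z, hz2, hz1⟩
      have hsub : Ioo (0 : ℝ) 1 ∩ F ⁻¹' U ⊆ Ioo (0 : ℝ) 1 \ N :=
        fun x hx => ⟨hx.1, fun hxN => hxN 1 le_rfl hx.2⟩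
      exact (hpos.trans_le (measure_mono hsub)).ne'
  rw [ae_iff]
  convert hz using 2
  ext x; simp [hN]

end ExpLift

/-! ### Hitting times and the tower -/

/-- The first time at which the orbit of `x` is in `U` is `l`. -/
def HitsAt (F : ℝ → ℝ) (U : Set ℝ) (l : ℕ) (x : ℝ) : Prop :=
  F^[l] x ∈ U ∧ ∀ i < l, F^[i] x ∉ U

/-- The translates of the first Markov interval of order `q`. -/
def baseSet (F : ℝ → ℝ) (d : ℤ) (q : ℕ) : Set ℝ := {x | ∃ j : ℤ, x ∈ cyl F q (d ^ q * j)}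

lemma HitsAt.unique {F : ℝ → ℝ} {U : Set ℝ} {l l' : ℕ} {x : ℝ} (h : HitsAt F U l x)
    (h' : HitsAt F U l' x) : l = l' := by
  rcases lt_trichotomy l l' with hl | hl | hl
  · exact absurd h.1 (h'.2 l hl)
  · exact hl
  · exact absurd h'.1 (h.2 l' hl)

lemma HitsAt.shift {F : ℝ → ℝ} {U : Set ℝ} {l i : ℕ} {x : ℝ} (h : HitsAt F U (l + i) x) :
    HitsAt F U l (F^[i] x) := by
  refine ⟨by rw [← Function.iterate_add_apply]; exact h.1, fun n hn => ?_⟩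
  rw [← Function.iterate_add_apply]
  exact h.2 _ (by omega)

lemma HitsAt.exists_of_iterate_mem {F : ℝ → ℝ} {U : Set ℝ} {n : ℕ} {x : ℝ} (h : F^[n] x ∈ U) :
    ∃ l ≤ n, HitsAt F U l x := by
  classical
  have hex : ∃ n, F^[n] x ∈ U := ⟨n, h⟩
  exact ⟨Nat.find hex, Nat.find_min' hex h, Nat.find_spec hex, fun i hi => Nat.find_min hex hi⟩

namespace ExpLift

variable {F : ℝ → ℝ} {d : ℤ} {r : ℝ}

lemma isOpen_baseSet (h : ExpLift F d r) (q : ℕ) : IsOpen (baseSet F d q) := by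
  have : baseSet F d q = ⋃ j : ℤ, cyl F q (d ^ q * j) := by ext x; simp [baseSet]
  rw [this]
  exact isOpen_iUnion fun j => h.isOpen_cyl _ _

lemma add_one_mem_baseSet (h : ExpLift F d r) (q : ℕ) (x : ℝ) :
    x + 1 ∈ baseSet F d q ↔ x ∈ baseSet F d q := by
  have key : ∀ j : ℤ, x + 1 ∈ cyl F q (d ^ q * (j + 1)) ↔ x ∈ cyl F q (d ^ q * j) := fun j => by
    have := h.add_intCast_mem_cyl (m := q) (k := d ^ q * j) (j := 1) (x := x)
    rw [Int.cast_one] at this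
    rw [← this, mul_add, mul_one]
  constructor
  · rintro ⟨j, hj⟩
    exact ⟨j - 1, (key _).1 (by rwa [sub_add_cancel])⟩
  · rintro ⟨j, hj⟩
    exact ⟨j + 1, (key _).2 hj⟩

lemma exists_abs_sub_le_of_mem_baseSet (h : ExpLift F d r) {q : ℕ} {x : ℝ}
    (hx : x ∈ baseSet F d q) : ∃ j : ℤ, |x - j| ≤ (r ^ q)⁻¹ := by
  obtain ⟨j, hj⟩ := hx
  refine ⟨j, ?_⟩
  have h1 := h.pow_mul_abs_sub_le q x j
  rw [h.iterate_intCast] at h1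
  have h2 : |F^[q] x - (d ^ q * j : ℤ)| ≤ 1 := by
    rw [abs_of_nonneg (sub_nonneg.2 hj.1.le)]; linarith [hj.2]
  rw [← one_div, le_div_iff₀ (pow_pos h.pos q)]
  linarith

/-- The base set is a union of intervals of order `q`, so being in it at time `i` is a property of
the whole interval of any order at least `q + i`. -/
lemma hitsAt_of_mem_cyl (h : ExpLift F d r) {p q l : ℕ} {k : ℤ} {x y : ℝ} (hl : q + l ≤ p)
    (hx : x ∈ cyl F p k) (hy : y ∈ cyl F p k) (hit : HitsAt F (baseSet F d q) l x) :
    HitsAt F (baseSet F d q) l y := by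
  have key : ∀ i ≤ l, ∀ x ∈ cyl F p k, ∀ y ∈ cyl F p k, F^[i] x ∈ baseSet F d q →
      F^[i] y ∈ baseSet F d q := by
    rintro i hi x hx y hy ⟨j, hj⟩
    obtain ⟨p', rfl⟩ := Nat.exists_eq_add_of_le' (show i ≤ p by omega)
    exact ⟨j, h.cyl_subset_cyl (by omega) hj (iterate_mem_cyl_iff.2 hx) (iterate_mem_cyl_iff.2 hy)⟩
  exact ⟨key l le_rfl x hx y hy hit.1,
    fun i hi hmem => hit.2 i hi (key i hi.le y hy x hx hmem)⟩

lemma measurableSet_hitsAt (h : ExpLift F d r) (q l : ℕ) :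
    MeasurableSet {x | HitsAt F (baseSet F d q) l x} := by
  have hU := (h.isOpen_baseSet q).measurableSet
  have : {x | HitsAt F (baseSet F d q) l x} =
      F^[l] ⁻¹' baseSet F d q ∩ ⋂ i : ℕ, ⋂ _ : i < l, (F^[i] ⁻¹' baseSet F d q)ᶜ := by
    ext x; simp [HitsAt]
  rw [this]
  exact ((h.continuous_iterate l).measurable hU).inter (MeasurableSet.iInter fun i =>
    MeasurableSet.iInter fun _ => ((h.continuous_iterate i).measurable hU).compl)

/-- Few points visit a small base set soon. -/
lemma tendsto_volume_visit (h : ExpLift F d r) (N : ℕ) :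
    Tendsto (fun q : ℕ => (volume.restrict (Ioo (0 : ℝ) 1)) {x | ∃ i < N, F^[i] x ∈ baseSet F d q})
      atTop (𝓝 0) := by
  have hm : ∀ q : ℕ, MeasurableSet {x | ∃ i < N, F^[i] x ∈ baseSet F d q} := fun q => by
    have : {x | ∃ i < N, F^[i] x ∈ baseSet F d q} =
        ⋃ i : ℕ, ⋃ _ : i < N, F^[i] ⁻¹' baseSet F d q := by ext x; simp
    rw [this]
    exact MeasurableSet.iUnion fun i => MeasurableSet.iUnion fun _ =>
      (h.continuous_iterate i).measurable (h.isOpen_baseSet q).measurableSet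
  have := tendsto_measure_of_ae_tendsto_indicator_of_isFiniteMeasure (L := atTop)
    (μ := volume.restrict (Ioo (0 : ℝ) 1)) (A := ∅)
    (As := fun q : ℕ => {x | ∃ i < N, F^[i] x ∈ baseSet F d q}) MeasurableSet.empty hm ?_
  · simpa using this
  · filter_upwards [ae_restrict_of_ae h.ae_forall_iterate_ne] with x hx
    -- The base set lies within `r^(-q)` of the integers, and the orbit of a typical `x` avoids
    -- them.
    have hi : ∀ i ∈ Finset.range N, ∀ᶠ q : ℕ in atTop, F^[i] x ∉ baseSet F d q := fun i _ => by
      have hpos : 0 < |F^[i] x - round (F^[i] x)| := abs_pos.2 (sub_ne_zero.2 (hx i _))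
      have ht : Tendsto (fun q : ℕ => (r ^ q)⁻¹) atTop (𝓝 0) :=
        tendsto_inv_atTop_zero.comp (tendsto_pow_atTop_atTop_of_one_lt h.one_lt)
      filter_upwards [ht.eventually_lt_const hpos] with q hq hmem
      obtain ⟨j, hj⟩ := h.exists_abs_sub_le_of_mem_baseSet hmem
      exact absurd (round_le (F^[i] x) j) (by linarith)
    filter_upwards [(Finset.range N).eventually_all.2 hi] with q hq
    simp only [mem_empty_iff_false, iff_false]
    rintro ⟨i, hiN, hmem⟩
    exact hq i (Finset.mem_range.2 hiN) hmem

/-- Most points visit the base set before a late time. -/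
lemma tendsto_volume_not_visit (h : ExpLift F d r) (q : ℕ) :
    Tendsto (fun L : ℕ => (volume.restrict (Ioo (0 : ℝ) 1))
      {x | ∃ l < L, HitsAt F (baseSet F d q) l x}ᶜ) atTop (𝓝 0) := by
  have hm : ∀ L : ℕ, MeasurableSet {x | ∃ l < L, HitsAt F (baseSet F d q) l x} := fun L => by
    have : {x | ∃ l < L, HitsAt F (baseSet F d q) l x} =
        ⋃ l : ℕ, ⋃ _ : l < L, {x | HitsAt F (baseSet F d q) l x} := by ext x; simp
    rw [this]
    exact MeasurableSet.iUnion fun i => MeasurableSet.iUnion fun _ => h.measurableSet_hitsAt q i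
  have := tendsto_measure_of_ae_tendsto_indicator_of_isFiniteMeasure (L := atTop)
    (μ := volume.restrict (Ioo (0 : ℝ) 1)) (A := ∅)
    (As := fun L : ℕ => {x | ∃ l < L, HitsAt F (baseSet F d q) l x}ᶜ) MeasurableSet.empty
    (fun L => (hm L).compl) ?_
  · simpa using this
  · have hne : (baseSet F d q).Nonempty := ⟨cen F q (d ^ q * 0), 0, h.cen_mem_cyl _ _⟩
    filter_upwards [ae_restrict_of_ae (h.ae_exists_iterate_mem (h.isOpen_baseSet q) hne
      (h.add_one_mem_baseSet q))] with x hx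
    obtain ⟨n, -, hn⟩ := hx
    obtain ⟨l, -, hl⟩ := HitsAt.exists_of_iterate_mem hn
    filter_upwards [eventually_gt_atTop l] with L hL
    simp only [mem_compl_iff, mem_ofPred_eq, mem_empty_iff_false, iff_false, not_not]
    exact ⟨l, hL, hl⟩

/-- A tower of Markov intervals (a Rokhlin lemma): there are `s + M + 1` disjoint levels, and the
lowest `s + 1` of them cover almost everything. -/
lemma exists_tower (h : ExpLift F d r) {η : ℝ} (hη : 0 < η) {M : ℕ} (hM : 1 ≤ M) :
    ∃ R₀ : ℕ, ∀ R ≥ R₀, ∀ s : ℕ, s + M + 1 = R * M → ∃ P₀ : ℕ, ∀ p ≥ P₀, ∃ V : Set ℤ,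
      (∀ k ∈ V, ∀ j : ℤ, k + d ^ p * j ∈ V) ∧
      (∀ n n' : ℕ, n < n' → n' ≤ s + M → ∀ k ∈ V, ∀ k' ∈ V,
        Disjoint (cyl F (p + n) k) (cyl F (p + n') k')) ∧
      volume (Ioo (0 : ℝ) 1 \ {x | ∃ n ≤ s, ∃ k ∈ V, x ∈ cyl F (p + n) k}) ≤
        ENNReal.ofReal η := by
  obtain ⟨R₀, hR₀⟩ := exists_nat_gt (3 / η)
  refine ⟨R₀, fun R hR s hs => ?_⟩
  set T := R * M with hT
  set μ : Measure ℝ := volume.restrict (Ioo (0 : ℝ) 1) with hμ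
  have hη3 : (0 : ℝ≥0∞) < ENNReal.ofReal (η / 3) := ENNReal.ofReal_pos.2 (by positivity)
  have hRpos : 0 < R := by
    rcases Nat.eq_zero_or_pos R with rfl | h0
    · simp at hT; omega
    · exact h0
  -- Discarding the hitting times below `2 * T` leaves `l - c ≥ T`, hence `j ≥ 1` in the
  -- decomposition `l = j * T + c + n` below.
  obtain ⟨q, hq⟩ := ((h.tendsto_volume_visit (2 * T)).eventually_lt_const hη3).exists
  set U := baseSet F d q with hU
  obtain ⟨L, hL⟩ := ((h.tendsto_volume_not_visit q).eventually_lt_const hη3).exists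
  -- the residue class
  set Z : ℕ → Set ℝ := fun a => {x | ∃ l, HitsAt F U l x ∧ l % T / M = a} with hZ
  have hZm : ∀ a, MeasurableSet (Z a) := fun a => by
    have : Z a = ⋃ l : ℕ, ⋃ _ : l % T / M = a, {x | HitsAt F U l x} := by
      ext x; simp [hZ, and_comm]
    rw [this]
    exact MeasurableSet.iUnion fun i => MeasurableSet.iUnion fun _ => h.measurableSet_hitsAt q i
  have hsum : ∑ a ∈ Finset.range R, μ (Z a) ≤ 1 := by
    rw [← measure_biUnion_finset (fun a _ b _ hab => ?_) (fun a _ => hZm a)]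
    · calc μ _ ≤ μ univ := measure_mono (subset_univ _)
        _ = 1 := by simp [hμ]
    · rw [Function.onFun, Set.disjoint_left]
      rintro x ⟨l, hl, rfl⟩ ⟨l', hl', rfl⟩
      exact hab (by rw [hl.unique hl'])
  -- Pigeonhole: `R > 3 / η` disjoint classes share total mass at most 1.
  obtain ⟨a, haR, ha⟩ : ∃ a ∈ Finset.range R, μ (Z a) ≤ ENNReal.ofReal (η / 3) := by
    by_contra! hcon
    have h1 := (Finset.card_nsmul_le_sum _ _ _ fun a ha => (hcon a ha).le).trans hsum
    rw [Finset.card_range, nsmul_eq_mul, ← ENNReal.ofReal_natCast,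
      ← ENNReal.ofReal_mul (by positivity), ← ENNReal.ofReal_one,
      ENNReal.ofReal_le_ofReal_iff zero_le_one] at h1
    have : (R₀ : ℝ) ≤ R := by exact_mod_cast hR
    rw [div_lt_iff₀ hη] at hR₀
    nlinarith
  rw [Finset.mem_range] at haR
  -- With this offset the top `M` residues, `T - M ≤ n < T`, are those for which `c + n` modulo `T`
  -- is in the light class `a`. These points are lost when only the levels up to `s = T - M - 1` are
  -- kept.
  set c := (a + 1) * M with hc
  have hcT : c ≤ T := Nat.mul_le_mul_right M haR
  -- Deep enough for an interval of order `p` to determine hitting times up to `L * T + T`.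
  refine ⟨q + L * T + T, fun p hp => ?_⟩
  have hTpos : 0 < T := Nat.mul_pos hRpos hM
  set V : Set ℤ := {k | ∃ j, 1 ≤ j ∧ j ≤ L ∧ ∀ x ∈ cyl F p k, HitsAt F U (j * T + c) x} with hV
  have hit_shift : ∀ (x : ℝ) (j : ℤ) (l : ℕ), HitsAt F U l (x + j) → HitsAt F U l x := by
    intro x j l hx
    have key : ∀ i : ℕ, F^[i] (x + j) ∈ U ↔ F^[i] x ∈ U := fun i => by
      rw [h.iterate_add_intCast]
      exact add_one_iff_add_intCast (p := (· ∈ U)) (h.add_one_mem_baseSet q) _ _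
    exact ⟨(key l).1 hx.1, fun i hi hm => hx.2 i hi ((key i).2 hm)⟩
  refine ⟨V, ?_, ?_, ?_⟩
  · rintro k ⟨j, hj1, hjL, hj⟩ i
    refine ⟨j, hj1, hjL, fun x hx => ?_⟩
    have : x = (x + (-i : ℤ)) + i := by push_cast; ring
    rw [this, h.add_intCast_mem_cyl] at hx
    refine hit_shift x (-i) _ (hj _ hx)
  · rintro n n' hn hn' k ⟨j, hj1, hjL, hj⟩ k' ⟨j', hj1', hjL', hj'⟩
    rw [Set.disjoint_left]
    intro x hx hx'
    have h1 := hj _ (iterate_mem_cyl_iff.2 hx)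
    have h2 := hj' _ (iterate_mem_cyl_iff.2 hx')
    obtain ⟨i, rfl⟩ := Nat.exists_eq_add_of_lt hn
    have hi : i + 1 ≤ j * T := by nlinarith
    -- The hitting time drops by one at each step, so a common point of two levels would make `n' -
    -- n` a multiple of `T`, although `0 < n' - n < T`.
    have h3 : HitsAt F U (j * T - (i + 1) + c) (F^[i + 1] (F^[n] x)) :=
      HitsAt.shift (by rwa [show j * T - (i + 1) + c + (i + 1) = j * T + c by omega])
    rw [← Function.iterate_add_apply, show i + 1 + n = n + i + 1 by ring] at h3
    have h4 := h3.unique h2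
    have h5 : j * T = j' * T + (i + 1) := by omega
    have h6 : (i + 1) % T = 0 := by
      have := congrArg (· % T) h5
      simpa [Nat.mul_add_mod'] using this.symm
    rw [Nat.mod_eq_of_lt (by omega)] at h6
    omega
  · have hsub : Ioo (0 : ℝ) 1 \ {x | ∃ n ≤ s, ∃ k ∈ V, x ∈ cyl F (p + n) k} ⊆
        Ioo (0 : ℝ) 1 ∩ (({x | ∃ i < 2 * T, F^[i] x ∈ U} ∪
          {x | ∃ l < L, HitsAt F U l x}ᶜ ∪ Z a) ∪ {x | ∃ m : ℕ, ∃ j : ℤ, F^[m] x = j}) := by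
      rintro x ⟨hx01, hx⟩
      refine ⟨hx01, ?_⟩
      by_contra hcon
      simp only [mem_union, not_or, mem_compl_iff, not_not] at hcon
      obtain ⟨⟨⟨hx1, l, hlL, hl⟩, hx3⟩, hx4⟩ := hcon
      have hl2 : 2 * T ≤ l := by
        by_contra hlt
        exact hx1 ⟨l, not_le.1 hlt, hl.1⟩
      set n := (l - c) % T with hn
      set j := (l - c) / T with hj
      have hdiv : T * j + n = l - c := Nat.div_add_mod _ _
      have hnT : n < T := Nat.mod_lt _ hTpos
      have hj1 : 1 ≤ j := (Nat.one_le_div_iff hTpos).2 (by omega)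
      have hjL : j ≤ L := (Nat.div_le_self _ _).trans (by omega)
      have hl' : l = j * T + c + n := by rw [mul_comm j]; omega
      clear_value n j
      rcases Nat.lt_or_ge s n with hsn | hns
      · refine hx3 ⟨l, hl, ?_⟩
        obtain ⟨e, rfl⟩ : ∃ e, n = T - M + e := ⟨n - (T - M), by omega⟩
        have he : l = a * M + e + (j + 1) * T := by
          rw [hl', hc]
          have : T - M + M = T := by omega
          linarith
        have hlt : a * M + e < T := by
          have : (a + 1) * M = a * M + M := by ring
          omega
        rw [he, Nat.add_mul_mod_self_right, Nat.mod_eq_of_lt hlt, add_comm,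
          Nat.add_mul_div_right _ _ (by omega), Nat.div_eq_of_lt (by omega), zero_add]
      · have hcyl : x ∈ cyl F (p + n) ⌊F^[p + n] x⌋ :=
          mem_cyl_floor fun i e => hx4 ⟨_, _, e⟩
        refine hx ⟨n, hns, _, ⟨j, hj1, hjL, fun y hy => ?_⟩, hcyl⟩
        have hjT : j * T ≤ L * T := Nat.mul_le_mul_right T hjL
        exact h.hitsAt_of_mem_cyl (by omega) (iterate_mem_cyl_iff.2 hcyl) hy
          (HitsAt.shift (hl' ▸ hl))
    refine (measure_mono hsub).trans ?_
    rw [inter_comm, ← Measure.restrict_apply' measurableSet_Ioo, ← hμ]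
    have hnull : μ {x | ∃ m : ℕ, ∃ j : ℤ, F^[m] x = j} = 0 :=
      h.countable_preimage_int.measure_zero _
    calc μ _ ≤ μ _ + μ _ + μ _ + μ _ := (measure_union_le _ _).trans (by
            gcongr
            exact (measure_union_le _ _).trans (by gcongr; exact measure_union_le _ _))
      _ ≤ ENNReal.ofReal (η / 3) + ENNReal.ofReal (η / 3) + ENNReal.ofReal (η / 3) + 0 := by
          gcongr
          exact hnull.le
      _ = ENNReal.ofReal η := by
          rw [add_zero, ← ENNReal.ofReal_add (by positivity) (by positivity),
            ← ENNReal.ofReal_add (by positivity) (by positivity)]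
          congr 1; ring

end ExpLift

/-! ### The perturbation supported on the upper levels -/

/-- `w` is the identity near the middle of `[-1, 1]`, vanishes near the ends, and points away
from `0`. -/
structure IsProfile (w : ℝ → ℝ) (K : ℝ) : Prop where
  contDiff : ContDiff ℝ 2 w
  eq_zero : ∀ z, 99 / 100 ≤ |z| → w z = 0
  le_abs_sub : ∀ z κ, 0 ≤ κ → κ ≤ 1 → (1 - κ) * |z| ≤ |z - κ * w z|
  abs_sub_le : ∀ z κ, 0 ≤ κ → κ ≤ 1 → |z - κ * w z| ≤ |z|
  deriv_eq_one : ∀ z, |z| < 98 / 100 → deriv w z = 1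
  abs_deriv_le : ∀ z, |deriv w z| ≤ K
  abs_deriv_sub_le : ∀ z z', |deriv w z - deriv w z'| ≤ K * |z - z'|

lemma IsProfile.one_le {w : ℝ → ℝ} {K : ℝ} (h : IsProfile w K) : 1 ≤ K := by
  have := h.abs_deriv_le 0
  rwa [h.deriv_eq_one 0 (by norm_num), abs_one] at this

lemma exists_isProfile : ∃ w K, IsProfile w K := by
  let χ : ContDiffBump (0 : ℝ) := ⟨98 / 100, 99 / 100, by norm_num, by norm_num⟩
  let w : ℝ → ℝ := fun z => z * χ z
  have hw : ContDiff ℝ 2 w := contDiff_id.mul χ.contDiff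
  have hcs : HasCompactSupport w := χ.hasCompactSupport.mul_left
  have hw1 : ContDiff ℝ 1 (deriv w) := by
    have := hw
    rw [show (2 : WithTop ℕ∞) = 1 + 1 by norm_num, contDiff_succ_iff_deriv] at this
    exact this.2.2
  obtain ⟨K₁, hK₁⟩ := hw1.continuous.bounded_above_of_compact_support hcs.deriv
  obtain ⟨K₂, hK₂⟩ := (hw1.continuous_deriv le_rfl).bounded_above_of_compact_support hcs.deriv.deriv
  -- Since `w z = z * χ z`, the perturbation multiplies `z` by a factor between `1 - κ` and 1; this
  -- gives both comparison fields of the profile.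
  have hfac : ∀ z κ : ℝ, 0 ≤ κ → κ ≤ 1 → |z - κ * w z| = |z| * (1 - κ * χ z) := fun z κ h0 h1 => by
    rw [show z - κ * w z = z * (1 - κ * χ z) by simp only [w]; ring, abs_mul,
      abs_of_nonneg (a := 1 - κ * χ z)]
    nlinarith [χ.nonneg (x := z), χ.le_one (x := z)]
  refine ⟨w, max K₁ K₂, hw, fun z hz => ?_, fun z κ h0 h1 => ?_, fun z κ h0 h1 => ?_,
    fun z hz => ?_, fun z => (hK₁ z).trans (le_max_left _ _), fun z z' => ?_⟩
  · simp only [w]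
    rw [χ.zero_of_le_dist (by simpa using hz), mul_zero]
  · rw [hfac z κ h0 h1, mul_comm]
    refine mul_le_mul_of_nonneg_left ?_ (abs_nonneg z)
    nlinarith [χ.le_one (x := z)]
  · rw [hfac z κ h0 h1]
    refine mul_le_of_le_one_right (abs_nonneg z) ?_
    nlinarith [χ.nonneg (x := z)]
  · have : w =ᶠ[𝓝 z] id := by
      have hz' : z ∈ Metric.ball (0 : ℝ) (98 / 100) := by simpa using hz
      filter_upwards [Metric.isOpen_ball.mem_nhds hz'] with y hy
      simp only [w, id]
      rw [χ.one_of_mem_closedBall (Metric.ball_subset_closedBall hy), mul_one]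
    rw [this.deriv_eq, deriv_id]
  · have := Convex.norm_image_sub_le_of_norm_deriv_le (f := deriv w) (x := z') (y := z)
      (s := univ) (fun x _ => (hw1.differentiable one_ne_zero) x)
      (fun x _ => (hK₂ x).trans (le_max_right K₁ K₂)) convex_univ trivial trivial
    simpa [Real.norm_eq_abs] using this

open Classical in
/-- The bumps in the Markov intervals of order `m` whose index is in `V`. -/
noncomputable def levelBump (G w : ℝ → ℝ) (V : Set ℤ) (m : ℕ) (x : ℝ) : ℝ :=
  if ⌊G^[m] x⌋ ∈ V then
    rad G m ⌊G^[m] x⌋ * w ((x - cen G m ⌊G^[m] x⌋) / rad G m ⌊G^[m] x⌋) else 0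

/-- The perturbation of the identity in the upper `M` levels of the tower. -/
noncomputable def shear (G w : ℝ → ℝ) (V : Set ℤ) (p s M : ℕ) (κ : ℝ) (x : ℝ) : ℝ :=
  x - κ * ∑ n ∈ Finset.Ioc s (s + M), levelBump G w V (p + n) x

/-- The union of the upper `M` levels of the tower. -/
def zone (G : ℝ → ℝ) (V : Set ℤ) (p s M : ℕ) : Set ℝ :=
  {x | ∃ n, s < n ∧ n ≤ s + M ∧ ∃ k ∈ V, x ∈ cyl G (p + n) k}

/-- The data of the perturbation: a tower and a profile of strength `κ`. -/
structure Pert (G : ℝ → ℝ) (d : ℤ) (r : ℝ) (p s M : ℕ) (V : Set ℤ) (w : ℝ → ℝ) (K κ : ℝ) :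
    Prop where
  lift : ExpLift G d r
  per : ∀ k ∈ V, ∀ j : ℤ, k + d ^ p * j ∈ V
  disj : ∀ n n' : ℕ, n < n' → n' ≤ s + M → ∀ k ∈ V, ∀ k' ∈ V,
    Disjoint (cyl G (p + n) k) (cyl G (p + n') k')
  prof : IsProfile w K
  nonneg : 0 ≤ κ
  mul_le : κ * K ≤ 1 / 2

lemma floor_eq_of_mem_cyl {G : ℝ → ℝ} {m : ℕ} {k : ℤ} {x : ℝ} (hx : x ∈ cyl G m k) :
    ⌊G^[m] x⌋ = k := Int.floor_eq_iff.2 ⟨hx.1.le, hx.2⟩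

namespace ExpLift

variable {F : ℝ → ℝ} {d : ℤ} {r : ℝ}

lemma endpt_add (h : ExpLift F d r) (m : ℕ) (k j : ℤ) :
    endpt F m (k + d ^ m * j) = endpt F m k + j := by
  rw [eq_comm, ← h.iterate_eq_iff, h.iterate_add_intCast, h.iterate_endpt]; push_cast; rfl

lemma cen_add (h : ExpLift F d r) (m : ℕ) (k j : ℤ) : cen F m (k + d ^ m * j) = cen F m k + j := by
  rw [cen, cen, add_right_comm, h.endpt_add, h.endpt_add]; ring

lemma rad_add (h : ExpLift F d r) (m : ℕ) (k j : ℤ) : rad F m (k + d ^ m * j) = rad F m k := by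
  rw [rad, rad, add_right_comm, h.endpt_add, h.endpt_add]; congr 2; ring

lemma cen_rad_eq {G : ℝ → ℝ} {d' : ℤ} {r' : ℝ} {m m' : ℕ} {k k' : ℤ} (h : ExpLift F d r)
    (h' : ExpLift G d' r') (e : cyl F m k = cyl G m' k') :
    cen F m k = cen G m' k' ∧ rad F m k = rad G m' k' := by
  have h1 := h.rad_pos m k
  have h2 := h'.rad_pos m' k'
  rw [h.cyl_eq_Ioo, h'.cyl_eq_Ioo] at e
  have e1 := congrArg sInf e
  have e2 := congrArg sSup e
  rw [csInf_Ioo (by linarith), csInf_Ioo (by linarith)] at e1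
  rw [csSup_Ioo (by linarith), csSup_Ioo (by linarith)] at e2
  constructor <;> linarith

end ExpLift

lemma abs_log_sub_log_le {a b : ℝ} (ha : 1 / 2 ≤ a) (hb : 1 / 2 ≤ b) :
    |Real.log a - Real.log b| ≤ 2 * |a - b| := by
  have key : ∀ a b : ℝ, 1 / 2 ≤ a → 1 / 2 ≤ b → Real.log a - Real.log b ≤ 2 * |a - b| := by
    intro a b ha hb
    have hb0 : 0 < b := by linarith
    rw [← Real.log_div (by linarith) hb0.ne']
    have h1 := Real.log_le_sub_one_of_pos (div_pos (show 0 < a by linarith) hb0)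
    have h2 : a / b - 1 ≤ 2 * |a - b| := by
      rw [← div_self hb0.ne', ← sub_div, div_le_iff₀ hb0]
      nlinarith [le_abs_self (a - b), abs_nonneg (a - b)]
    linarith
  rw [abs_le]
  have h1 := key a b ha hb
  have h2 := key b a hb ha
  rw [abs_sub_comm] at h2
  constructor <;> linarith

namespace Pert

variable {G : ℝ → ℝ} {d : ℤ} {r : ℝ} {p s M : ℕ} {V : Set ℤ} {w : ℝ → ℝ} {K κ : ℝ}

lemma le_half (h : Pert G d r p s M V w K κ) : κ ≤ 1 / 2 := by
  nlinarith [h.prof.one_le, h.mul_le, h.nonneg]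

lemma per' (h : Pert G d r p s M V w K κ) {n : ℕ} {k j : ℤ} :
    k + d ^ (p + n) * j ∈ V ↔ k ∈ V := by
  constructor
  · intro hk
    have := h.per _ hk (-(d ^ n * j))
    rwa [show k + d ^ (p + n) * j + d ^ p * -(d ^ n * j) = k by rw [pow_add]; ring] at this
  · intro hk
    have := h.per _ hk (d ^ n * j)
    rwa [← mul_assoc, ← pow_add] at this

lemma levelBump_eq {m : ℕ} {k : ℤ} {x : ℝ} (hk : k ∈ V) (hx : x ∈ cyl G m k) :
    levelBump G w V m x = rad G m k * w ((x - cen G m k) / rad G m k) := by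
  rw [levelBump, floor_eq_of_mem_cyl hx, if_pos hk]

lemma levelBump_eventually (h : Pert G d r p s M V w K κ) {m : ℕ} {k : ℤ} {x : ℝ} (hk : k ∈ V)
    (hx : x ∈ cyl G m k) :
    levelBump G w V m =ᶠ[𝓝 x] fun x => rad G m k * w ((x - cen G m k) / rad G m k) := by
  filter_upwards [(h.lift.isOpen_cyl m k).mem_nhds hx] with y hy using levelBump_eq hk hy

/-- The delicate case is an endpoint, where two intervals meet and the floor jumps. The profile
vanishes for `|z| ≥ 0.99`, so the formulas on both sides are zero nearby, whichever indices are in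
`V`. -/
lemma levelBump_eventually_zero (h : Pert G d r p s M V w K κ) {m : ℕ} {x : ℝ}
    (hx : ∀ k ∈ V, x ∉ cyl G m k) : levelBump G w V m =ᶠ[𝓝 x] fun _ => 0 := by
  by_cases hj : ∃ j : ℤ, G^[m] x = j
  · obtain ⟨j, hj⟩ := hj
    have e : x = endpt G m j := h.lift.iterate_eq_iff.1 hj
    have hev : ∀ k : ℤ, |x - cen G m k| = rad G m k →
        ∀ᶠ y in 𝓝 x, w ((y - cen G m k) / rad G m k) = 0 := fun k hk => by
      have hr := h.lift.rad_pos m k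
      have hcont : Continuous fun y => |(y - cen G m k) / rad G m k| := by fun_prop
      have h1 : |(x - cen G m k) / rad G m k| = 1 := by
        rw [abs_div, hk, abs_of_pos hr, div_self hr.ne']
      have := hcont.continuousAt (x := x) |>.eventually (lt_mem_nhds (a := 99 / 100)
        (by beta_reduce; rw [h1]; norm_num))
      filter_upwards [this] with y hy using h.prof.eq_zero _ hy.le
    have h1 := hev j (by rw [e]; exact ExpLift.abs_endpt_sub_cen G m j)
    have h2 := hev (j - 1) (by
      have := ExpLift.abs_endpt_succ_sub_cen G m (j - 1)
      rw [sub_add_cancel] at this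
      rw [e]; exact this)
    have h3 : ∀ᶠ y in 𝓝 x, G^[m] y ∈ Ioo ((j : ℝ) - 1) (j + 1) :=
      (h.lift.continuous_iterate m).continuousAt.eventually_mem
        (Ioo_mem_nhds (by rw [hj]; linarith) (by rw [hj]; linarith))
    filter_upwards [h1, h2, h3] with y hy1 hy2 hy3
    rw [levelBump]
    rcases lt_or_ge (G^[m] y) j with hlt | hge
    · have : ⌊G^[m] y⌋ = j - 1 := Int.floor_eq_iff.2 ⟨by push_cast; exact hy3.1.le, by simpa⟩
      rw [this, hy2, mul_zero, ite_self]
    · have : ⌊G^[m] y⌋ = j := Int.floor_eq_iff.2 ⟨hge, hy3.2⟩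
      rw [this, hy1, mul_zero, ite_self]
  · push Not at hj
    have hc := ExpLift.mem_cyl_floor hj
    filter_upwards [(h.lift.isOpen_cyl m _).mem_nhds hc] with y hy
    rw [levelBump, floor_eq_of_mem_cyl hy, if_neg fun hk => hx _ hk hc]

lemma contDiff_levelBump (h : Pert G d r p s M V w K κ) (m : ℕ) :
    ContDiff ℝ 2 (levelBump G w V m) := by
  rw [contDiff_iff_contDiffAt]
  intro x
  by_cases hx : ∃ k ∈ V, x ∈ cyl G m k
  · obtain ⟨k, hk, hxk⟩ := hx
    refine ContDiffAt.congr_of_eventuallyEq ?_ (h.levelBump_eventually hk hxk)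
    have := h.prof.contDiff
    exact (contDiff_const.mul (this.comp
      ((contDiff_id.sub contDiff_const).div_const _))).contDiffAt
  · push Not at hx
    exact contDiffAt_const.congr_of_eventuallyEq (h.levelBump_eventually_zero hx)

lemma contDiff_shear (h : Pert G d r p s M V w K κ) : ContDiff ℝ 2 (shear G w V p s M κ) :=
  contDiff_id.sub (contDiff_const.mul (ContDiff.sum fun n _ => h.contDiff_levelBump (p + n)))

lemma levelBump_add_one (h : Pert G d r p s M V w K κ) (n : ℕ) (x : ℝ) :
    levelBump G w V (p + n) (x + 1) = levelBump G w V (p + n) x := by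
  have e : ⌊G^[p + n] (x + 1)⌋ = ⌊G^[p + n] x⌋ + d ^ (p + n) * 1 := by
    have := h.lift.iterate_add_intCast (p + n) x 1
    rw [Int.cast_one] at this
    rw [this, Int.floor_add_intCast]
  rw [levelBump, levelBump, e, h.lift.rad_add, h.lift.cen_add]
  have hp := h.per' (n := n) (k := ⌊G^[p + n] x⌋) (j := 1)
  by_cases hk : ⌊G^[p + n] x⌋ ∈ V
  · rw [if_pos hk, if_pos (hp.2 hk), Int.cast_one, add_sub_add_right_eq_sub]
  · rw [if_neg hk, if_neg (mt hp.1 hk)]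

lemma shear_add_one (h : Pert G d r p s M V w K κ) (x : ℝ) :
    shear G w V p s M κ (x + 1) = shear G w V p s M κ x + 1 := by
  rw [shear, shear, Finset.sum_congr rfl fun n _ => h.levelBump_add_one n x]
  ring

/-- Disjointness of the levels leaves a single nonzero summand near `x`. -/
lemma shear_eventually (h : Pert G d r p s M V w K κ) {n : ℕ} {k : ℤ} {x : ℝ} (hn : s < n)
    (hn' : n ≤ s + M) (hk : k ∈ V) (hx : x ∈ cyl G (p + n) k) :
    shear G w V p s M κ =ᶠ[𝓝 x] fun x =>
      x - κ * (rad G (p + n) k * w ((x - cen G (p + n) k) / rad G (p + n) k)) := by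
  have hother : ∀ n' ∈ Finset.Ioc s (s + M), ∀ᶠ y in 𝓝 x, n' ≠ n →
      levelBump G w V (p + n') y = 0 := fun n' hn2 => by
    rw [Finset.mem_Ioc] at hn2
    rcases eq_or_ne n' n with rfl | hne
    · exact Eventually.of_forall fun y hy => absurd rfl hy
    · have : ∀ k' ∈ V, x ∉ cyl G (p + n') k' := fun k' hk' hx' => by
        rcases lt_or_gt_of_ne hne with hlt | hlt
        · exact Set.disjoint_left.1 (h.disj n' n hlt hn' k' hk' k hk) hx' hx
        · exact Set.disjoint_left.1 (h.disj n n' hlt hn2.2 k hk k' hk') hx hx'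
      filter_upwards [h.levelBump_eventually_zero this] with y hy _ using hy
  filter_upwards [(Finset.Ioc s (s + M)).eventually_all.2 hother,
    h.levelBump_eventually hk hx] with y hy1 hy2
  rw [shear, Finset.sum_eq_single n (fun n' h1 h2 => hy1 n' h1 h2)
    (fun hcon => absurd (Finset.mem_Ioc.2 ⟨hn, hn'⟩) hcon), hy2]

lemma shear_eventually_id (h : Pert G d r p s M V w K κ) {x : ℝ} (hx : x ∉ zone G V p s M) :
    shear G w V p s M κ =ᶠ[𝓝 x] id := by
  have hother : ∀ n ∈ Finset.Ioc s (s + M), ∀ᶠ y in 𝓝 x, levelBump G w V (p + n) y = 0 :=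
    fun n hn => by
      rw [Finset.mem_Ioc] at hn
      exact h.levelBump_eventually_zero fun k hk hxk => hx ⟨n, hn.1, hn.2, k, hk, hxk⟩
  filter_upwards [(Finset.Ioc s (s + M)).eventually_all.2 hother] with y hy
  rw [shear, Finset.sum_eq_zero hy, mul_zero, sub_zero, id]

lemma deriv_shear (h : Pert G d r p s M V w K κ) {n : ℕ} {k : ℤ} {x : ℝ} (hn : s < n)
    (hn' : n ≤ s + M) (hk : k ∈ V) (hx : x ∈ cyl G (p + n) k) :
    deriv (shear G w V p s M κ) x =
      1 - κ * deriv w ((x - cen G (p + n) k) / rad G (p + n) k) := by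
  have hr := h.lift.rad_pos (p + n) k
  rw [(h.shear_eventually hn hn' hk hx).deriv_eq]
  have hw := (h.prof.contDiff.differentiable (by norm_num)
    ((x - cen G (p + n) k) / rad G (p + n) k)).hasDerivAt
  have h1 : HasDerivAt (fun x => (x - cen G (p + n) k) / rad G (p + n) k)
      (1 / rad G (p + n) k) x := ((hasDerivAt_id x).sub_const _).div_const _
  have h2 := ((hasDerivAt_id x).sub (((hw.comp x h1).const_mul (rad G (p + n) k)).const_mul κ))
  refine (HasDerivAt.deriv h2).trans ?_
  field_simp

lemma deriv_shear_eq_one (h : Pert G d r p s M V w K κ) {x : ℝ} (hx : x ∉ zone G V p s M) :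
    deriv (shear G w V p s M κ) x = 1 := by
  rw [(h.shear_eventually_id hx).deriv_eq, deriv_id]

lemma shear_eq_self (h : Pert G d r p s M V w K κ) {x : ℝ} (hx : x ∉ zone G V p s M) :
    shear G w V p s M κ x = x := (h.shear_eventually_id hx).self_of_nhds

lemma abs_deriv_shear_sub_one_le (h : Pert G d r p s M V w K κ) (x : ℝ) :
    |deriv (shear G w V p s M κ) x - 1| ≤ κ * K := by
  by_cases hx : x ∈ zone G V p s M
  · obtain ⟨n, hn, hn', k, hk, hxk⟩ := hx
    rw [h.deriv_shear hn hn' hk hxk, sub_sub_cancel_left, abs_neg, abs_mul, abs_of_nonneg h.nonneg]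
    exact mul_le_mul_of_nonneg_left (h.prof.abs_deriv_le _) h.nonneg
  · rw [h.deriv_shear_eq_one hx, sub_self, abs_zero]
    exact mul_nonneg h.nonneg (zero_le_one.trans h.prof.one_le)

lemma half_le_deriv_shear (h : Pert G d r p s M V w K κ) (x : ℝ) :
    1 / 2 ≤ deriv (shear G w V p s M κ) x := by
  have := abs_le.1 (h.abs_deriv_shear_sub_one_le x)
  linarith [h.mul_le]

lemma abs_shear_sub_le (h : Pert G d r p s M V w K κ) (x y : ℝ) :
    |shear G w V p s M κ x - shear G w V p s M κ y| ≤ 2 * |x - y| := by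
  have := Convex.norm_image_sub_le_of_norm_deriv_le (f := shear G w V p s M κ) (x := y) (y := x)
    (s := univ) (C := 2) (fun x _ => (h.contDiff_shear.differentiable (by norm_num)) x)
    (fun x _ => by
      have := abs_le.1 (h.abs_deriv_shear_sub_one_le x)
      rw [Real.norm_eq_abs, abs_le]
      constructor <;> linarith [h.mul_le]) convex_univ trivial trivial
  simpa [Real.norm_eq_abs] using this

/-- In units of the radius, the perturbation contracts at most by `1 - κ` towards the centre. -/
lemma le_abs_shear_sub_cen (h : Pert G d r p s M V w K κ) {n : ℕ} {k : ℤ} {x : ℝ} (hn : s < n)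
    (hn' : n ≤ s + M) (hk : k ∈ V) (hx : x ∈ cyl G (p + n) k) :
    (1 - κ) * |x - cen G (p + n) k| ≤ |shear G w V p s M κ x - cen G (p + n) k| ∧
    |shear G w V p s M κ x - cen G (p + n) k| ≤ |x - cen G (p + n) k| := by
  have hr := h.lift.rad_pos (p + n) k
  set c := cen G (p + n) k
  set ρ := rad G (p + n) k
  rw [(h.shear_eventually hn hn' hk hx).self_of_nhds]
  have hκ : κ ≤ 1 := by linarith [h.le_half]
  have e : x - κ * (ρ * w ((x - c) / ρ)) - c = ρ * ((x - c) / ρ - κ * w ((x - c) / ρ)) := by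
    field_simp
    ring
  have e2 : |x - c| = ρ * |(x - c) / ρ| := by
    rw [abs_div, abs_of_pos hr, mul_div_cancel₀ _ hr.ne']
  rw [e, abs_mul, abs_of_pos hr, e2]
  constructor
  · rw [mul_left_comm]
    exact mul_le_mul_of_nonneg_left (h.prof.le_abs_sub _ _ h.nonneg hκ) hr.le
  · exact mul_le_mul_of_nonneg_left (h.prof.abs_sub_le _ _ h.nonneg hκ) hr.le

lemma shear_mem_cyl (h : Pert G d r p s M V w K κ) {n : ℕ} {k : ℤ} {x : ℝ} (hn : s < n)
    (hn' : n ≤ s + M) (hk : k ∈ V) (hx : x ∈ cyl G (p + n) k) :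
    shear G w V p s M κ x ∈ cyl G (p + n) k := by
  have := (h.le_abs_shear_sub_cen hn hn' hk hx).2
  rw [h.lift.mem_cyl_iff] at hx ⊢
  exact this.trans_lt hx

/-- A point only moves inside its own perturbed interval, of order greater than `p + s`. An interval
of order at most `p + s` contains that interval or is disjoint from it. An interval with index in
`V` and order between `p + s + 1` and `p + s + M` is itself a perturbed one, and those of other
levels are disjoint from it. -/
lemma shear_mem_cyl_iff (h : Pert G d r p s M V w K κ) {m : ℕ} {k : ℤ} {x : ℝ}
    (hm : m ≤ p + s ∨ k ∈ V ∧ m ≤ p + (s + M)) :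
    shear G w V p s M κ x ∈ cyl G m k ↔ x ∈ cyl G m k := by
  by_cases hx : x ∈ zone G V p s M
  · obtain ⟨n, hn, hn', k', hk', hxk⟩ := hx
    have hy := h.shear_mem_cyl hn hn' hk' hxk
    have key : ∀ a b, a ∈ cyl G (p + n) k' → b ∈ cyl G (p + n) k' → a ∈ cyl G m k →
        b ∈ cyl G m k := by
      intro a b ha hb hak
      by_cases hms : m ≤ p + s
      · exact h.lift.cyl_subset_cyl (by omega) hak ha hb
      · obtain ⟨hk, hmM⟩ := hm.resolve_left hms
        obtain ⟨n', rfl⟩ := Nat.exists_eq_add_of_le (show p ≤ m by omega)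
        rcases lt_trichotomy n' n with hlt | rfl | hlt
        · exact absurd ha (Set.disjoint_left.1 (h.disj n' n hlt hn' k hk k' hk') hak)
        · rwa [ExpLift.eq_of_mem_cyl hak ha]
        · exact absurd hak (Set.disjoint_left.1 (h.disj n n' hlt (by omega) k' hk' k hk) ha)
    exact ⟨key _ _ hy hxk, key _ _ hxk hy⟩
  · rw [h.shear_eq_self hx]

lemma abs_shear_sub_self_le (h : Pert G d r p s M V w K κ) (x : ℝ) :
    |shear G w V p s M κ x - x| ≤ (r ^ p)⁻¹ := by
  by_cases hx : x ∈ zone G V p s M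
  · obtain ⟨n, hn, hn', k, hk, hxk⟩ := hx
    have h1 := h.lift.abs_sub_lt_of_mem_cyl (h.shear_mem_cyl hn hn' hk hxk) hxk
    have h2 := h.lift.rad_le (p + n) k
    have h3 : (r ^ (p + n))⁻¹ ≤ (r ^ p)⁻¹ := inv_anti₀ (pow_pos h.lift.pos _)
      (pow_le_pow_right₀ h.lift.one_lt.le (by omega))
    linarith
  · rw [h.shear_eq_self hx, sub_self, abs_zero]
    exact inv_nonneg.2 (pow_pos h.lift.pos _).le

lemma deriv_comp_shear (h : Pert G d r p s M V w K κ) (x : ℝ) :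
    deriv (G ∘ shear G w V p s M κ) x =
      deriv G (shear G w V p s M κ x) * deriv (shear G w V p s M κ) x :=
  deriv_comp _ (h.lift.differentiable _) (h.contDiff_shear.differentiable (by norm_num) _)

lemma expLift (h : Pert G d r p s M V w K κ) {r₁ : ℝ} (h1 : 1 < r₁) (hr : r₁ ≤ r * (1 - κ * K)) :
    ExpLift (G ∘ shear G w V p s M κ) d r₁ where
  contDiff := h.lift.contDiff.comp h.contDiff_shear
  map_zero := by
    have : (0 : ℝ) ∉ zone G V p s M := by
      rintro ⟨n, -, -, k, -, hk⟩
      have := h.lift.intCast_notMem_cyl (p + n) k 0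
      rw [Int.cast_zero] at this
      exact this hk
    rw [Function.comp, h.shear_eq_self this, h.lift.map_zero]
  map_add_one x := by
    rw [Function.comp, h.shear_add_one, h.lift.map_add_one]; rfl
  one_lt := h1
  le_abs_deriv x := by
    rw [h.deriv_comp_shear, abs_mul]
    have h2 := h.half_le_deriv_shear x
    have h3 := abs_le.1 (h.abs_deriv_shear_sub_one_le x)
    refine hr.trans (mul_le_mul (h.lift.le_abs_deriv _) ?_ (by linarith [h.mul_le]) (abs_nonneg _))
    rw [abs_of_pos (by linarith)]
    linarith

/-- This keeps the tower of `G` a tower of the perturbed map, with the same centres, radii and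
disjointness. -/
lemma comp_shear_cyl (h : Pert G d r p s M V w K κ) {m : ℕ} {k : ℤ}
    (hm : m ≤ p + s ∨ k ∈ V ∧ m ≤ p + (s + M)) :
    cyl (G ∘ shear G w V p s M κ) m k = cyl G m k := by
  induction m with
  | zero => rfl
  | succ m ih =>
    ext x
    rw [← iterate_mem_cyl_iff, ih (hm.imp (by omega) fun h => ⟨h.1, by omega⟩),
      Function.iterate_one, Function.comp,
      ← h.shear_mem_cyl_iff hm, ← iterate_mem_cyl_iff, Function.iterate_one]

section

variable {L : ℝ}

lemma log_deriv_comp_shear (h : Pert G d r p s M V w K κ) (x : ℝ) :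
    Real.log (deriv (G ∘ shear G w V p s M κ) x) =
      Real.log (deriv G (shear G w V p s M κ x)) + Real.log (deriv (shear G w V p s M κ) x) := by
  rw [h.deriv_comp_shear, Real.log_mul (h.lift.deriv_ne_zero _)]
  linarith [h.half_le_deriv_shear x]

lemma abs_log_deriv_sub_le (h : Pert G d r p s M V w K κ) (hL0 : 0 ≤ L)
    (hL : ∀ x y, |Real.log (deriv G x) - Real.log (deriv G y)| ≤ L * |x - y|) (x y : ℝ) :
    |Real.log (deriv (G ∘ shear G w V p s M κ) x) - Real.log (deriv (G ∘ shear G w V p s M κ) y)| ≤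
      2 * L * |x - y| +
      2 * |deriv (shear G w V p s M κ) x - deriv (shear G w V p s M κ) y| := by
  rw [h.log_deriv_comp_shear, h.log_deriv_comp_shear, add_sub_add_comm]
  refine (abs_add_le _ _).trans (add_le_add ((hL _ _).trans ?_)
    (abs_log_sub_log_le (h.half_le_deriv_shear x) (h.half_le_deriv_shear y)))
  nlinarith [h.abs_shear_sub_le x y]

lemma abs_deriv_shear_sub_le (h : Pert G d r p s M V w K κ) (x y : ℝ) :
    |deriv (shear G w V p s M κ) x - deriv (shear G w V p s M κ) y| ≤ 2 * (κ * K) := by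
  have h1 := abs_le.1 (h.abs_deriv_shear_sub_one_le x)
  have h2 := abs_le.1 (h.abs_deriv_shear_sub_one_le y)
  rw [abs_le]; constructor <;> linarith

/-- The Lipschitz constant of the derivative is inverse to the length of the interval, so the bound
is useful only for points much closer than that length. -/
lemma abs_deriv_shear_sub_le_of_mem (h : Pert G d r p s M V w K κ) {n : ℕ} {k : ℤ} {x y : ℝ}
    (hn : s < n) (hn' : n ≤ s + M) (hk : k ∈ V) (hx : x ∈ cyl G (p + n) k)
    (hy : y ∈ cyl G (p + n) k) :
    |deriv (shear G w V p s M κ) x - deriv (shear G w V p s M κ) y| ≤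
      |x - y| / (2 * rad G (p + n) k) := by
  have hr := h.lift.rad_pos (p + n) k
  rw [h.deriv_shear hn hn' hk hx, h.deriv_shear hn hn' hk hy, sub_sub_sub_cancel_left, ← mul_sub,
    abs_mul, abs_of_nonneg h.nonneg]
  have h1 := h.prof.abs_deriv_sub_le ((y - cen G (p + n) k) / rad G (p + n) k)
    ((x - cen G (p + n) k) / rad G (p + n) k)
  rw [← sub_div, sub_sub_sub_cancel_right, abs_div, abs_of_pos hr, abs_sub_comm y x] at h1
  calc κ * _ ≤ κ * (K * (|x - y| / rad G (p + n) k)) := mul_le_mul_of_nonneg_left h1 h.nonneg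
    _ = (κ * K) * (|x - y| / rad G (p + n) k) := by ring
    _ ≤ 1 / 2 * (|x - y| / rad G (p + n) k) :=
        mul_le_mul_of_nonneg_right h.mul_le (by positivity)
    _ = _ := by field_simp

end

end Pert

/-! ### Distortion of the perturbed map -/

/-- The perturbation data together with the smallness conditions on the parameters: `L` is a
Lipschitz constant of `log |G'|` and `exp (4 b)` is an expansion rate of the perturbed map. -/
structure FinePert (G : ℝ → ℝ) (d : ℤ) (r : ℝ) (p s M : ℕ) (V : Set ℤ) (w : ℝ → ℝ)
    (K κ L b : ℝ) : Prop extends Pert G d r p s M V w K κ where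
  lip_nonneg : 0 ≤ L
  lip : ∀ x y, |Real.log (deriv G x) - Real.log (deriv G y)| ≤ L * |x - y|
  b_pos : 0 < b
  exp_le : Real.exp (4 * b) ≤ r * (1 - κ * K)
  crude : 2 * L * (Real.exp (4 * b) ^ p)⁻¹ + 4 * (κ * K) ≤ b / 2
  s_pos : 1 ≤ s
  dist_le : L / (r - 1) ≤ b * s

namespace ExpLift

variable {F : ℝ → ℝ} {d : ℤ} {r : ℝ}

lemma exists_mem_cyl_of_le (h : ExpLift F d r) {m m' : ℕ} {k : ℤ} {x : ℝ} (hm : m ≤ m')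
    (hx : x ∈ cyl F m' k) : ∃ k', x ∈ cyl F m k' := by
  obtain ⟨i, rfl⟩ := Nat.exists_eq_add_of_le' hm
  refine ⟨_, mem_cyl_floor fun j hj => ?_⟩
  have := (iterate_mem_cyl_iff (F := F) (m := i) (i := m) (k := k) (x := x)).2 hx
  rw [hj] at this
  exact h.intCast_notMem_cyl i k j this

end ExpLift

lemma sum_exp_neg_le {b : ℝ} (hb : 0 < b) (t : ℕ) :
    ∑ i ∈ Finset.range t, Real.exp (-b * (t - i : ℕ)) ≤ 1 / b := by
  induction t with
  | zero => simp; positivity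
  | succ t ih =>
    rw [Finset.sum_range_succ]
    have e : ∀ i ∈ Finset.range t, Real.exp (-b * (t + 1 - i : ℕ)) =
        Real.exp (-b) * Real.exp (-b * (t - i : ℕ)) := fun i hi => by
      rw [Finset.mem_range] at hi
      rw [← Real.exp_add, Nat.succ_sub hi.le]
      congr 1; push_cast; ring
    rw [Finset.sum_congr rfl e, ← Finset.mul_sum, Nat.add_sub_cancel_left, Nat.cast_one, mul_one,
      Real.exp_neg]
    have h1 := Real.add_one_le_exp b
    have h2 : (Real.exp b)⁻¹ * (1 / b + 1) ≤ 1 / b := by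
      rw [inv_mul_le_iff₀ (Real.exp_pos b), show 1 / b + 1 = (b + 1) / b by field_simp; ring,
        mul_one_div]
      gcongr
    have h3 := mul_le_mul_of_nonneg_left ih (inv_pos.2 (Real.exp_pos b)).le
    simp only [← Real.exp_neg] at h2 h3 ⊢
    linarith

namespace FinePert

variable {G : ℝ → ℝ} {d : ℤ} {r : ℝ} {p s M : ℕ} {V : Set ℤ} {w : ℝ → ℝ} {K κ L b : ℝ}

lemma one_lt_exp (h : FinePert G d r p s M V w K κ L b) : 1 < Real.exp (4 * b) :=
  Real.one_lt_exp_iff.2 (by linarith [h.b_pos])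

lemma expLift' (h : FinePert G d r p s M V w K κ L b) :
    ExpLift (G ∘ shear G w V p s M κ) d (Real.exp (4 * b)) := h.expLift h.one_lt_exp h.exp_le

lemma exp_le_r (h : FinePert G d r p s M V w K κ L b) : Real.exp (4 * b) ≤ r := by
  have h1 := mul_nonneg h.nonneg (zero_le_one.trans h.prof.one_le)
  nlinarith [h.exp_le, h.lift.pos]

lemma inv_pow_le (h : FinePert G d r p s M V w K κ L b) {m : ℕ} (hm : p ≤ m) :
    (Real.exp (4 * b) ^ m)⁻¹ ≤ (Real.exp (4 * b) ^ p)⁻¹ :=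
  inv_anti₀ (pow_pos (Real.exp_pos _) _) (pow_le_pow_right₀ h.one_lt_exp.le hm)

/-- A rough distortion bound above the scale of the tower. -/
lemma jac_le_crude (h : FinePert G d r p s M V w K κ L b) {m i : ℕ} {k : ℤ} (hm : p ≤ m)
    {x y : ℝ} (hx : x ∈ cyl (G ∘ shear G w V p s M κ) (m + i) k)
    (hy : y ∈ cyl (G ∘ shear G w V p s M κ) (m + i) k) :
    jac (G ∘ shear G w V p s M κ) i x ≤
      Real.exp (b / 2 * i) * jac (G ∘ shear G w V p s M κ) i y := by
  have hH := h.expLift'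
  refine hH.jac_le_exp_mul ?_
  calc _ ≤ ∑ _j ∈ Finset.range i, b / 2 := Finset.sum_le_sum fun j hj => ?_
    _ = b / 2 * i := by rw [Finset.sum_const, Finset.card_range, nsmul_eq_mul, mul_comm]
  rw [Finset.mem_range] at hj
  obtain ⟨e, rfl⟩ := Nat.exists_eq_add_of_le' hj.le
  rw [← add_assoc] at hx hy
  have hx' := iterate_mem_cyl_iff.2 hx
  have hy' := iterate_mem_cyl_iff.2 hy
  have h1 := hH.abs_sub_lt_of_mem_cyl hx' hy'
  have h2 := hH.rad_le (m + e) k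
  have h3 := h.inv_pow_le (show p ≤ m + e by omega)
  have h4 := h.abs_log_deriv_sub_le h.lip_nonneg h.lip
    ((G ∘ shear G w V p s M κ)^[j] x) ((G ∘ shear G w V p s M κ)^[j] y)
  have h5 := h.abs_deriv_shear_sub_le
    ((G ∘ shear G w V p s M κ)^[j] x) ((G ∘ shear G w V p s M κ)^[j] y)
  have h6 := mul_le_mul_of_nonneg_left ((h1.le.trans (by linarith)).trans h3)
    (mul_nonneg zero_le_two h.lip_nonneg)
  linarith [h.crude]

/-- Down to order `p + s` the intervals are those of `G`, whose distortion constant `exp (L / (r -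
1))` involves neither `p`, `s` nor `κ`. -/
lemma rad_le_of_le (h : FinePert G d r p s M V w K κ L b) {m : ℕ} {k k₁ : ℤ} (hm : m ≤ s)
    (hsub : cyl (G ∘ shear G w V p s M κ) (p + m) k₁ ⊆ cyl (G ∘ shear G w V p s M κ) p k) :
    rad (G ∘ shear G w V p s M κ) (p + m) k₁ ≤
      Real.exp (L / (r - 1)) * Real.exp (-(4 * b * m)) *
        rad (G ∘ shear G w V p s M κ) p k := by
  have hH := h.expLift'
  have e1 := h.comp_shear_cyl (m := p + m) (k := k₁) (Or.inl (by omega))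
  have e2 := h.comp_shear_cyl (m := p) (k := k) (Or.inl (by omega))
  rw [e1, e2] at hsub
  rw [(hH.cen_rad_eq h.lift e1).2, (hH.cen_rad_eq h.lift e2).2]
  have key := h.lift.rad_mul_rad_le (m := 0) (m₁ := m) (i := p) (k := k) (k₁ := k₁)
    (E := Real.exp (L / (r - 1)))
    (fun x hx y hy => h.lift.jac_le_of_lipschitz h.lip_nonneg h.lip hx hy)
    (by rwa [zero_add, add_comm])
  rw [h.lift.rad_zero, zero_add, add_comm m p] at key
  have h1 := h.lift.rad_le m k₁
  have h2 : (r ^ m)⁻¹ ≤ Real.exp (-(4 * b * m)) := by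
    rw [Real.exp_neg, mul_comm (4 * b), Real.exp_nat_mul]
    exact inv_anti₀ (pow_pos (Real.exp_pos _) _)
      (pow_le_pow_left₀ (Real.exp_pos _).le h.exp_le_r m)
  have hD := Real.exp_pos (L / (r - 1))
  have hr := h.lift.rad_pos p k
  have h3 : Real.exp (L / (r - 1)) * rad G m k₁ * rad G p k ≤
      Real.exp (L / (r - 1)) * (Real.exp (-(4 * b * m)) / 2) * rad G p k := by
    gcongr; linarith
  linarith

/-- Nested Markov intervals of the perturbed map shrink at a uniform exponential rate. -/
lemma rad_le_exp_mul (h : FinePert G d r p s M V w K κ L b) {m : ℕ} {k k₁ : ℤ}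
    (hsub : cyl (G ∘ shear G w V p s M κ) (p + m) k₁ ⊆ cyl (G ∘ shear G w V p s M κ) p k) :
    rad (G ∘ shear G w V p s M κ) (p + m) k₁ ≤
      Real.exp (L / (r - 1)) * Real.exp (-(2 * b * m)) *
        rad (G ∘ shear G w V p s M κ) p k := by
  have hH := h.expLift'
  induction m using Nat.strong_induction_on generalizing k k₁ with
  | _ m ih =>
  set H := G ∘ shear G w V p s M κ with hHdef
  have hr := hH.rad_pos p k
  rcases le_or_gt m s with hm | hm
  · refine (h.rad_le_of_le hm hsub).trans ?_
    gcongr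
    · exact h.b_pos.le
    · norm_num
  -- Induction by blocks of `s` steps. `H^s` carries orders `p + e + s` and `p + s` to `p + e` and
  -- `p` at the cost `exp (b * s / 2)`. The block gains `exp (-4 * b * s)` up to the factor `exp (L
  -- / (r - 1)) ≤ exp (b * s)`, which leaves more than `exp (-2 * b * s)` requires and no
  -- accumulated constant.
  · obtain ⟨e, rfl⟩ := Nat.exists_eq_add_of_le' hm.le
    have hx := hH.cen_mem_cyl (p + (e + s)) k₁
    set x := cen H (p + (e + s)) k₁
    obtain ⟨k₂, hx₂⟩ := hH.exists_mem_cyl_of_le (m := p + s) (by omega) hx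
    have hsub2 : cyl H (p + s) k₂ ⊆ cyl H p k := hH.cyl_subset_cyl (by omega) (hsub hx) hx₂
    have hx' : x ∈ cyl H (p + e + s) k₁ := by rwa [add_assoc]
    have hsub3 : cyl H (p + e) k₁ ⊆ cyl H p k₂ :=
      hH.cyl_subset_cyl (by omega) (iterate_mem_cyl_iff.2 hx₂) (iterate_mem_cyl_iff.2 hx')
    have hsub4 : cyl H (p + e + s) k₁ ⊆ cyl H (p + s) k₂ :=
      hH.cyl_subset_cyl (by omega) hx₂ hx'
    have h1 := ih e (by have := h.s_pos; omega) hsub3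
    have h2 := h.rad_le_of_le le_rfl hsub2
    have h3 := hH.rad_mul_rad_le (m := p) (m₁ := p + e) (i := s) (k := k₂) (k₁ := k₁)
      (E := Real.exp (b / 2 * s)) (fun x hx y hy => h.jac_le_crude le_rfl hx hy) hsub4
    have hr2 := hH.rad_pos p k₂
    rw [← add_assoc]
    have h4 : rad H (p + e + s) k₁ * rad H p k₂ ≤ Real.exp (b / 2 * s) *
        (Real.exp (L / (r - 1)) * Real.exp (-(2 * b * e)) * rad H p k₂) *
        (Real.exp (L / (r - 1)) * Real.exp (-(4 * b * s)) * rad H p k) :=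
      h3.trans (mul_le_mul (mul_le_mul_of_nonneg_left h1 (Real.exp_pos _).le) h2
        (hH.rad_pos _ _).le (by positivity))
    have h5 : Real.exp (b / 2 * s) * Real.exp (L / (r - 1)) * Real.exp (-(2 * b * e)) *
        Real.exp (-(4 * b * s)) ≤ Real.exp (-(2 * b * (e + s : ℕ))) := by
      rw [← Real.exp_add, ← Real.exp_add, ← Real.exp_add, Real.exp_le_exp]
      push_cast
      have := h.dist_le
      have := mul_nonneg h.b_pos.le (Nat.cast_nonneg (α := ℝ) s)
      linarith
    refine le_of_mul_le_mul_right (h4.trans ?_) hr2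
    calc _ = (Real.exp (b / 2 * s) * Real.exp (L / (r - 1)) * Real.exp (-(2 * b * e)) *
          Real.exp (-(4 * b * s))) * (Real.exp (L / (r - 1)) * rad H p k * rad H p k₂) := by ring
      _ ≤ Real.exp (-(2 * b * (e + s : ℕ))) * (Real.exp (L / (r - 1)) * rad H p k * rad H p k₂) :=
          mul_le_mul_of_nonneg_right h5 (by positivity)
      _ = _ := by ring

/-- The derivative of the perturbation is almost constant on intervals that come back to the top
of the tower. -/
lemma abs_deriv_shear_sub_le_exp (h : FinePert G d r p s M V w K κ L b) {q : ℕ} {k : ℤ}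
    (hk : k ∈ V) (hq : 1 ≤ q) {x y : ℝ}
    (hx : x ∈ cyl (G ∘ shear G w V p s M κ) (p + (s + M) + q) k)
    (hy : y ∈ cyl (G ∘ shear G w V p s M κ) (p + (s + M) + q) k) :
    |deriv (shear G w V p s M κ) x - deriv (shear G w V p s M κ) y| ≤
      Real.exp (L / (r - 1)) * Real.exp (-(b / 2 * (s + M : ℕ))) * Real.exp (-b * q) := by
  have hH := h.expLift'
  set H := G ∘ shear G w V p s M κ with hHdef
  have hcyl : ∀ n ≤ s + M, ∀ k ∈ V, cyl H (p + n) k = cyl G (p + n) k := fun n hn k hk =>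
    h.comp_shear_cyl (Or.inr ⟨hk, by omega⟩)
  by_cases hxz : x ∈ zone G V p s M
  · obtain ⟨n, hn, hn', k', hk', hxk⟩ := hxz
    have hxH : x ∈ cyl H (p + n) k' := by rwa [hcyl n hn' k' hk']
    have hsub := hH.cyl_subset_cyl (by omega) hxH hx
    have hyk : y ∈ cyl G (p + n) k' := by rw [← hcyl n hn' k' hk']; exact hsub hy
    -- Otherwise, `q` steps later, the orbit is both in level `n - q` and in the top level.
    have hnq : n < q := by
      by_contra hlt
      obtain ⟨e, rfl⟩ := Nat.exists_eq_add_of_le' (not_lt.1 hlt)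
      have h1 := iterate_mem_cyl_iff.2 hx
      have h2 : H^[q] x ∈ cyl H (p + e) k' := iterate_mem_cyl_iff.2 (by rwa [add_assoc])
      rw [hcyl _ le_rfl k hk] at h1
      rw [hcyl e (by omega) k' hk'] at h2
      exact Set.disjoint_left.1 (h.disj e (s + M) (by omega) le_rfl k' hk' k hk) h2 h1
    obtain ⟨e, he⟩ := Nat.exists_eq_add_of_le' (show n ≤ s + M + q by omega)
    rw [add_assoc, he, ← add_assoc] at hx hy hsub
    have h1 := h.abs_deriv_shear_sub_le_of_mem hn hn' hk' hxk hyk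
    have h2 := (hH.abs_sub_lt_of_mem_cyl hx hy).le
    have h3 := hH.rad_mul_rad_le (m := p) (m₁ := p + e) (i := n) (k := k') (k₁ := k)
      (E := Real.exp (b / 2 * n)) (fun x hx y hy => h.jac_le_crude le_rfl hx hy) hsub
    have h4 := h.rad_le_exp_mul (m := e) (k := k') (k₁ := k)
      (hH.cyl_subset_cyl (by omega) (iterate_mem_cyl_iff.2 hxH) (iterate_mem_cyl_iff.2 hx))
    rw [← (hH.cen_rad_eq h.lift (hcyl n hn' k' hk')).2] at h1
    have hr1 := hH.rad_pos p k'
    have hr2 := hH.rad_pos (p + n) k'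
    -- With `e = s + M + q - n`, the exponent is `(5/2) b n - 2 b (s + M) - 2 b q`; bound `(3/2) b
    -- n` by `(3/2) b (s + M)` and the remaining `b n` by `b q`.
    have h5 : Real.exp (b / 2 * n) * Real.exp (-(2 * b * e)) ≤
        Real.exp (-(b / 2 * (s + M : ℕ))) * Real.exp (-b * q) := by
      rw [← Real.exp_add, ← Real.exp_add, Real.exp_le_exp]
      have c1 : (e : ℝ) = (s + M : ℕ) + q - n := by
        have : ((s + M + q : ℕ) : ℝ) = (e + n : ℕ) := by rw [he]
        push_cast at this ⊢; linarith
      have c2 : (n : ℝ) ≤ (s + M : ℕ) := by exact_mod_cast hn'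
      have c3 : (n : ℝ) ≤ q := by exact_mod_cast hnq.le
      rw [c1]
      nlinarith [h.b_pos, mul_le_mul_of_nonneg_left c2 h.b_pos.le,
        mul_le_mul_of_nonneg_left c3 h.b_pos.le]
    refine h1.trans ?_
    rw [div_le_iff₀ (by positivity)]
    have h6 : rad H (p + e + n) k ≤ Real.exp (b / 2 * n) *
        (Real.exp (L / (r - 1)) * Real.exp (-(2 * b * e))) * rad H (p + n) k' := by
      refine le_of_mul_le_mul_right (h3.trans ?_) hr1
      calc _ ≤ Real.exp (b / 2 * n) * (Real.exp (L / (r - 1)) * Real.exp (-(2 * b * e)) *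
            rad H p k') * rad H (p + n) k' := by gcongr
        _ = _ := by ring
    have h7 : Real.exp (b / 2 * n) * (Real.exp (L / (r - 1)) * Real.exp (-(2 * b * e))) ≤
        Real.exp (L / (r - 1)) * Real.exp (-(b / 2 * (s + M : ℕ))) * Real.exp (-b * q) := by
      rw [mul_left_comm, mul_assoc (Real.exp (L / (r - 1)))]
      exact mul_le_mul_of_nonneg_left h5 (Real.exp_pos _).le
    have h8 := h6.trans (mul_le_mul_of_nonneg_right h7 hr2.le)
    linarith
  · have hyz : y ∉ zone G V p s M := by
      rintro ⟨n, hn, hn', k', hk', hyk⟩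
      refine hxz ⟨n, hn, hn', k', hk', ?_⟩
      rw [← hcyl n hn' k' hk'] at hyk ⊢
      exact hH.cyl_subset_cyl (by omega) hyk hy hx
    rw [h.deriv_shear_eq_one hxz, h.deriv_shear_eq_one hyz, sub_self, abs_zero]
    positivity

/-- Branches that come back to the top of the tower are almost affine. -/
lemma jac_le_of_return (h : FinePert G d r p s M V w K κ L b) {c : ℝ}
    (hc : 2 * L * ((Real.exp (4 * b) ^ p)⁻¹ / (Real.exp (4 * b) - 1)) +
      2 * (Real.exp (L / (r - 1)) * Real.exp (-(b / 2 * (s + M : ℕ))) * (1 / b)) ≤ c)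
    {t : ℕ} {k : ℤ} (hk : k ∈ V) {x y : ℝ}
    (hx : x ∈ cyl (G ∘ shear G w V p s M κ) (p + (s + M) + t) k)
    (hy : y ∈ cyl (G ∘ shear G w V p s M κ) (p + (s + M) + t) k) :
    jac (G ∘ shear G w V p s M κ) t x ≤
      Real.exp c * jac (G ∘ shear G w V p s M κ) t y := by
  have hH := h.expLift'
  set H := G ∘ shear G w V p s M κ with hHdef
  refine hH.jac_le_exp_mul (le_trans ?_ hc)
  calc _ ≤ ∑ i ∈ Finset.range t, (2 * L * |H^[i] x - H^[i] y| +
        2 * (Real.exp (L / (r - 1)) * Real.exp (-(b / 2 * (s + M : ℕ))) *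
          Real.exp (-b * (t - i : ℕ)))) := by
        refine Finset.sum_le_sum fun i hi => ?_
        rw [Finset.mem_range] at hi
        have e : p + (s + M) + t = p + (s + M) + (t - i) + i := by omega
        rw [e] at hx hy
        have h1 := h.abs_deriv_shear_sub_le_exp hk (by omega) (iterate_mem_cyl_iff.2 hx)
          (iterate_mem_cyl_iff.2 hy)
        exact (h.abs_log_deriv_sub_le h.lip_nonneg h.lip _ _).trans (by linarith)
    _ = 2 * L * ∑ i ∈ Finset.range t, |H^[i] x - H^[i] y| +
        2 * (Real.exp (L / (r - 1)) * Real.exp (-(b / 2 * (s + M : ℕ))) *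
          ∑ i ∈ Finset.range t, Real.exp (-b * (t - i : ℕ))) := by
        rw [Finset.sum_add_distrib, Finset.mul_sum, Finset.mul_sum, Finset.mul_sum]
    _ ≤ _ := by
        have h1 := hH.sum_abs_iterate_sub_le t x y
        have h2 := (hH.abs_sub_lt_of_mem_cyl (iterate_mem_cyl_iff.2 hx)
          (iterate_mem_cyl_iff.2 hy)).le
        have h3 := hH.rad_le (p + (s + M)) k
        have h4 := h.inv_pow_le (show p ≤ p + (s + M) by omega)
        have h5 := h.one_lt_exp
        have h6 : |H^[t] x - H^[t] y| / (Real.exp (4 * b) - 1) ≤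
            (Real.exp (4 * b) ^ p)⁻¹ / (Real.exp (4 * b) - 1) :=
          div_le_div_of_nonneg_right (by linarith) (by linarith)
        have h7 := mul_le_mul_of_nonneg_left (h1.trans h6) (mul_nonneg zero_le_two h.lip_nonneg)
        have h8 := mul_le_mul_of_nonneg_left (sum_exp_neg_le h.b_pos t)
          (show 0 ≤ Real.exp (L / (r - 1)) * Real.exp (-(b / 2 * (s + M : ℕ))) by positivity)
        linarith

end FinePert

/-! ### Derivatives of branches running down the tower -/

namespace ExpLift

variable {F : ℝ → ℝ} {d : ℤ} {r : ℝ}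

/-- An almost affine branch almost preserves the relative distance to the ends. -/
lemma abs_sub_cen_le (h : ExpLift F d r) {m : ℕ} {k : ℤ} {a t u : ℝ} (ha : 0 ≤ a)
    (hE : ∀ x ∈ cyl F (m + 1) k, ∀ y ∈ cyl F (m + 1) k, jac F 1 x ≤ Real.exp a * jac F 1 y)
    (hu : u ∈ cyl F (m + 1) k) (ht0 : 0 ≤ t) (ht1 : t ≤ 1)
    (ht : |F u - cen F m k| ≤ t * rad F m k) :
    |u - cen F (m + 1) k| ≤ (t + a) * rad F (m + 1) k := by
  have hρ := h.rad_pos (m + 1) k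
  have hρ' := h.rad_pos m k
  have hu' := h.mem_cyl_iff.1 hu
  set c := cen F (m + 1) k with hc
  set ρ := rad F (m + 1) k with hρdef
  -- `e` is the endpoint nearest to `u`. Its image is an endpoint, at distance at least `(1 - t) *
  -- rad` from `F u`; an almost affine map turns this into a lower bound for the gap between `u` and
  -- `e`.
  obtain ⟨e, he, heu⟩ : ∃ e, |F e - cen F m k| = rad F m k ∧ |e - u| = ρ - |u - c| ∧
      e ∉ cyl F (m + 1) k ∧ ∀ ξ ∈ Ioo (min u e) (max u e), ξ ∈ cyl F (m + 1) k := by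
    have hend : ∀ e, e = c - ρ ∨ e = c + ρ → |F e - cen F m k| = rad F m k := by
      have h1 : |F (endpt F (m + 1) k) - cen F m k| = rad F m k := by
        have := h.iterate_endpt_add m 1 k
        rw [Function.iterate_one] at this
        rw [this, abs_endpt_sub_cen]
      have h2 : |F (endpt F (m + 1) (k + 1)) - cen F m k| = rad F m k := by
        have := h.iterate_endpt_add m 1 (k + 1)
        rw [Function.iterate_one] at this
        rw [this, abs_endpt_succ_sub_cen]
      rintro e (rfl | rfl)
      · rw [hc, hρdef, cen_sub_rad]
        rcases min_choice (endpt F (m + 1) k) (endpt F (m + 1) (k + 1)) with e | e <;> rw [e] <;>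
          assumption
      · rw [hc, hρdef, cen_add_rad]
        rcases max_choice (endpt F (m + 1) k) (endpt F (m + 1) (k + 1)) with e | e <;> rw [e] <;>
          assumption
    have hu2 := abs_lt.1 hu'
    rw [h.cyl_eq_Ioo, ← hc, ← hρdef]
    rcases le_total u c with huc | huc
    · have h3 : c - ρ < u := by linarith [hu2.1]
      refine ⟨c - ρ, hend _ (Or.inl rfl), ?_, fun hm => lt_irrefl _ hm.1, fun ξ hξ => ?_⟩
      · rw [abs_of_neg (by linarith), abs_of_nonpos (by linarith)]; ring
      · rw [min_eq_right h3.le, max_eq_left h3.le] at hξ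
        exact ⟨hξ.1, by linarith [hξ.2]⟩
    · have h3 : u < c + ρ := by linarith [hu2.2]
      refine ⟨c + ρ, hend _ (Or.inr rfl), ?_, fun hm => lt_irrefl _ hm.2, fun ξ hξ => ?_⟩
      · rw [abs_of_pos (by linarith), abs_of_nonneg (by linarith)]; ring
      · rw [min_eq_left h3.le, max_eq_right h3.le] at hξ
        exact ⟨by linarith [hξ.1], hξ.2⟩
  obtain ⟨heu, hne, hbetw⟩ := heu
  obtain ⟨ξ, hξ, hmv⟩ := exists_mem_uIoo_sub_eq h.differentiable
    (show u ≠ e from fun e' => hne (e' ▸ hu))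
  have h1 := h.jac_mul_rad_le (i := 1) hE (hbetw ξ hξ)
  rw [jac_one, ← hρdef] at h1
  have h2 : |F e - F u| = |deriv F ξ| * (ρ - |u - c|) := by rw [hmv, abs_mul, heu]
  have h3 : rad F m k ≤ |F e - F u| + t * rad F m k := by
    rw [← he]
    rw [← he] at ht
    exact (abs_sub_le _ (F u) _).trans (by linarith)
  have hgap : 0 < ρ - |u - c| := by linarith
  have h4 : (1 - t) * rad F m k * ρ ≤ Real.exp a * rad F m k * (ρ - |u - c|) := by
    calc (1 - t) * rad F m k * ρ ≤ |F e - F u| * ρ :=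
          mul_le_mul_of_nonneg_right (by linarith) hρ.le
      _ = (|deriv F ξ| * ρ) * (ρ - |u - c|) := by rw [h2]; ring
      _ ≤ _ := mul_le_mul_of_nonneg_right h1 hgap.le
  have h5 : (1 - t) * ρ ≤ Real.exp a * (ρ - |u - c|) := by
    refine le_of_mul_le_mul_right (a := rad F m k) ?_ hρ'
    linarith
  have h6 : Real.exp (-a) * ((1 - t) * ρ) ≤ ρ - |u - c| := by
    rw [Real.exp_neg, inv_mul_le_iff₀ (Real.exp_pos a)]; exact h5
  have h7 : (1 - a) * ((1 - t) * ρ) ≤ Real.exp (-a) * ((1 - t) * ρ) :=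
    mul_le_mul_of_nonneg_right (by linarith [Real.add_one_le_exp (-a)])
      (mul_nonneg (by linarith) hρ.le)
  have h8 : 0 ≤ a * t * ρ := by positivity
  linarith

end ExpLift

namespace FinePert

variable {G : ℝ → ℝ} {d : ℤ} {r : ℝ} {p s M : ℕ} {V : Set ℤ} {w : ℝ → ℝ} {K κ L b a : ℝ}

/-- One step of `G` at order at least `p` is affine up to `exp a`. The error `a` becomes small as
`p` grows, with the height `s + M` of the tower already fixed. -/
lemma jac_one_le (h : FinePert G d r p s M V w K κ L b) (ha : L * (r ^ p)⁻¹ ≤ a) {m : ℕ} {k : ℤ}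
    (hm : p ≤ m) : ∀ x ∈ cyl G m k, ∀ y ∈ cyl G m k, jac G 1 x ≤ Real.exp a * jac G 1 y := by
  intro x hx y hy
  refine h.lift.jac_le_exp_mul ?_
  rw [Finset.sum_range_one]
  refine (h.lip _ _).trans (le_trans ?_ ha)
  refine mul_le_mul_of_nonneg_left ?_ h.lip_nonneg
  have h1 := h.lift.abs_sub_lt_of_mem_cyl hx hy
  have h2 := h.lift.rad_le m k
  have h3 : (r ^ m)⁻¹ ≤ (r ^ p)⁻¹ := inv_anti₀ (pow_pos h.lift.pos _)
    (pow_le_pow_right₀ h.lift.one_lt.le hm)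
  simp only [Function.iterate_zero, id]
  linarith

lemma comp_shear_mem_cyl (h : FinePert G d r p s M V w K κ L b) {n : ℕ} {k : ℤ} (hk : k ∈ V)
    (hn : n + 1 ≤ s + M) {x : ℝ} (hx : x ∈ cyl G (p + n + 1) k) :
    (G ∘ shear G w V p s M κ) x ∈ cyl G (p + n) k := by
  rw [← h.comp_shear_cyl (Or.inr ⟨hk, by omega⟩)] at hx
  have := iterate_mem_cyl_iff.2 hx
  rwa [Function.iterate_one, h.comp_shear_cyl (Or.inr ⟨hk, by omega⟩)] at this

/-- Below the zone the tower is almost affine. -/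
lemma chain_lower (h : FinePert G d r p s M V w K κ L b) (ha0 : 0 ≤ a) (ha : L * (r ^ p)⁻¹ ≤ a)
    {n i : ℕ} {k : ℤ} (hk : k ∈ V) (hn : n + i ≤ s) {t x : ℝ} (ht0 : 0 ≤ t) (ht : t + i * a ≤ 1)
    (hx : x ∈ cyl G (p + n + i) k)
    (hxt : |(G ∘ shear G w V p s M κ)^[i] x - cen G (p + n) k| ≤ t * rad G (p + n) k) :
    |x - cen G (p + n + i) k| ≤ (t + i * a) * rad G (p + n + i) k ∧
    jac (G ∘ shear G w V p s M κ) i x * rad G (p + n + i) k ≤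
      Real.exp a ^ i * rad G (p + n) k := by
  induction i generalizing x with
  | zero => simpa [jac_zero] using hxt
  | succ i ih =>
    have hxz : x ∉ zone G V p s M := by
      rintro ⟨n', h1, h2, k', hk', hx'⟩
      exact Set.disjoint_left.1 (h.disj (n + (i + 1)) n' (by omega) h2 k hk k' hk')
        (by rwa [← add_assoc]) hx'
    have hHx : (G ∘ shear G w V p s M κ) x = G x := by
      rw [Function.comp, h.shear_eq_self hxz]
    have hmem := h.comp_shear_mem_cyl (n := n + i) hk (by omega)
      (by rwa [show p + (n + i) + 1 = p + n + (i + 1) by ring])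
    rw [← add_assoc] at hmem
    rw [Function.iterate_succ_apply] at hxt
    push_cast at ht
    obtain ⟨h1, h2⟩ := ih (by omega) (by linarith) hmem hxt
    have hE := h.jac_one_le (k := k) ha (show p ≤ p + n + i + 1 by omega)
    rw [hHx] at h1
    have h3 := h.lift.abs_sub_cen_le ha0 hE hx (by positivity) (by linarith) h1
    constructor
    · push_cast
      rw [← add_assoc]
      linarith
    · have h4 := h.lift.jac_mul_rad_le (i := 1) hE hx
      rw [jac_one] at h4
      rw [jac_succ, h.deriv_comp_shear, h.deriv_shear_eq_one hxz, h.shear_eq_self hxz, mul_one,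
        ← add_assoc, pow_succ']
      have h5 := mul_le_mul_of_nonneg_right h4
        (h.expLift'.jac_pos i ((G ∘ shear G w V p s M κ) x)).le
      have h6 := mul_le_mul_of_nonneg_left h2 (Real.exp_pos a).le
      linarith

/-- In the zone the middle of the intervals is contracted by `1 - κ` at each step. -/
lemma chain_upper (h : FinePert G d r p s M V w K κ L b) (ha0 : 0 ≤ a) (ha : L * (r ^ p)⁻¹ ≤ a)
    {i : ℕ} {k : ℤ} (hk : k ∈ V) (hi : i ≤ M) {t x : ℝ} (ht0 : 0 ≤ t)
    (ht : t + M * a ≤ 97 / 100 * (1 - κ) ^ M)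
    (hx : x ∈ cyl G (p + s + i) k)
    (hxt : |(G ∘ shear G w V p s M κ)^[i] x - cen G (p + s) k| ≤ t * rad G (p + s) k) :
    |x - cen G (p + s + i) k| ≤ (t + i * a) / (1 - κ) ^ i * rad G (p + s + i) k ∧
    jac (G ∘ shear G w V p s M κ) i x * rad G (p + s + i) k ≤
      (Real.exp a * (1 - κ)) ^ i * rad G (p + s) k := by
  have hκ : 1 / 2 ≤ 1 - κ := by linarith [h.le_half]
  have hκ1 : 1 - κ ≤ 1 := by linarith [h.nonneg]
  -- Undoing the contractions spreads the middle of the interval outwards, but it stays in the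
  -- region `|z| < 0.98` where the profile has slope 1 and each step gains the full factor `1 - κ`.
  have htb : ∀ j ≤ M, (t + j * a) / (1 - κ) ^ j ≤ 97 / 100 := fun j hj => by
    rw [div_le_iff₀ (by positivity)]
    have h1 : (1 - κ) ^ M ≤ (1 - κ) ^ j := pow_le_pow_of_le_one (by linarith) hκ1 hj
    have h2 : (j : ℝ) * a ≤ M * a := mul_le_mul_of_nonneg_right (by exact_mod_cast hj) ha0
    linarith
  induction i generalizing x with
  | zero => simpa [jac_zero] using hxt
  | succ i ih =>
    have hρ := h.lift.rad_pos (p + s + (i + 1)) k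
    have hmem := h.comp_shear_mem_cyl (n := s + i) hk (by omega)
      (by rwa [show p + (s + i) + 1 = p + s + (i + 1) by ring])
    rw [← add_assoc] at hmem
    rw [Function.iterate_succ_apply] at hxt
    obtain ⟨h1, h2⟩ := ih (by omega) hmem hxt
    have hE := h.jac_one_le (k := k) ha (show p ≤ p + s + i + 1 by omega)
    have hu := h.shear_mem_cyl (n := s + (i + 1)) (x := x) (by omega) (by omega) hk
      (by rwa [← add_assoc])
    rw [← add_assoc] at hu
    have hti := htb i (by omega)
    have h3 := h.lift.abs_sub_cen_le ha0 hE hu (by positivity) (by linarith) h1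
    have h4 := (h.le_abs_shear_sub_cen (n := s + (i + 1)) (x := x) (by omega) (by omega) hk
      (by rwa [← add_assoc])).1
    rw [← add_assoc] at h4
    have h5 : ((t + i * a) / (1 - κ) ^ i + a) / (1 - κ) ≤
        (t + (i + 1 : ℕ) * a) / (1 - κ) ^ (i + 1) := by
      rw [pow_succ, ← div_div]
      refine div_le_div_of_nonneg_right ?_ (by linarith)
      rw [le_div_iff₀ (by positivity), add_mul, div_mul_cancel₀ _ (by positivity)]
      have := mul_le_of_le_one_right ha0 (pow_le_one₀ (n := i) (by linarith) hκ1)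
      push_cast
      linarith
    have h6 : |x - cen G (p + s + (i + 1)) k| ≤
        ((t + i * a) / (1 - κ) ^ i + a) / (1 - κ) * rad G (p + s + (i + 1)) k := by
      rw [div_mul_eq_mul_div, le_div_iff₀ (by linarith), mul_comm]
      exact h4.trans h3
    have h7 := h6.trans (mul_le_mul_of_nonneg_right h5 hρ.le)
    refine ⟨h7, ?_⟩
    have h8 : |(x - cen G (p + s + (i + 1)) k) / rad G (p + s + (i + 1)) k| < 98 / 100 := by
      rw [abs_div, abs_of_pos hρ, div_lt_iff₀ hρ]
      have := mul_le_mul_of_nonneg_right (htb (i + 1) hi) hρ.le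
      linarith
    have h9 := h.lift.jac_mul_rad_le (i := 1) hE hu
    rw [jac_one] at h9
    have hd := h.deriv_shear (n := s + (i + 1)) (x := x) (by omega) (by omega) hk
      (by rwa [← add_assoc])
    rw [← add_assoc p s (i + 1), h.prof.deriv_eq_one _ h8, mul_one] at hd
    rw [jac_succ, h.deriv_comp_shear, hd, abs_mul, abs_of_pos (show 0 < 1 - κ by linarith),
      pow_succ']
    have hJ := (h.expLift'.jac_pos i ((G ∘ shear G w V p s M κ) x)).le
    have h10 := mul_le_mul_of_nonneg_right h9 (mul_nonneg (show 0 ≤ 1 - κ by linarith) hJ)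
    have h11 := mul_le_mul_of_nonneg_left h2
      (mul_nonneg (Real.exp_pos a).le (show 0 ≤ 1 - κ by linarith))
    rw [← add_assoc]
    linarith

/-- On the part of a return branch that lands in the middle of the interval, the derivative is
small. -/
lemma jac_mul_rad_le_of_return (h : FinePert G d r p s M V w K κ L b) {c : ℝ}
    (hc : 2 * L * ((Real.exp (4 * b) ^ p)⁻¹ / (Real.exp (4 * b) - 1)) +
      2 * (Real.exp (L / (r - 1)) * Real.exp (-(b / 2 * (s + M : ℕ))) * (1 / b)) ≤ c)
    (ha0 : 0 ≤ a) (ha : L * (r ^ p)⁻¹ ≤ a)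
    (ht : 42 / 100 + (s + M : ℕ) * a ≤ 97 / 100 * (1 - κ) ^ M)
    (hfin : Real.exp c * (Real.exp a ^ (s + M) * (1 - κ) ^ M) ≤ 48 / 100)
    {n t : ℕ} (hn : n ≤ s) (hnt : s + M ≤ n + t) {k : ℤ} (hk : k ∈ V) {x : ℝ}
    (hx : x ∈ cyl (G ∘ shear G w V p s M κ) (p + n + t) k)
    (hxt : |(G ∘ shear G w V p s M κ)^[t] x - cen G (p + n) k| ≤ 42 / 100 * rad G (p + n) k) :
    jac (G ∘ shear G w V p s M κ) t x * rad (G ∘ shear G w V p s M κ) (p + n + t) k ≤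
      48 / 100 * rad G (p + n) k := by
  have hH := h.expLift'
  set H := G ∘ shear G w V p s M κ with hHdef
  obtain ⟨i, rfl⟩ := Nat.exists_eq_add_of_le hn
  -- The branch splits into `t'` steps to the top level, with distortion `exp c`, then `M` steps
  -- through the perturbed levels, with the gain `(1 - κ) ^ M`, then `i = s - n` unperturbed steps
  -- to level `n`. The relative position is tracked backwards from the landing point.
  obtain ⟨t', rfl⟩ : ∃ t', t = t' + (M + i) := ⟨t - (M + i), by omega⟩
  have e1 : p + n + (t' + (M + i)) = p + (n + i + M) + t' := by ring
  rw [e1] at hx ⊢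
  have hκ : 1 / 2 ≤ 1 - κ := by linarith [h.le_half]
  have hκ1 : (1 - κ) ^ M ≤ 1 := pow_le_one₀ (by linarith) (by linarith [h.nonneg])
  set y := H^[t'] x with hy
  have hyW : y ∈ cyl H (p + (n + i + M)) k := iterate_mem_cyl_iff.2 hx
  have hyG : y ∈ cyl G (p + (n + i) + M) k := by
    rw [h.comp_shear_cyl (Or.inr ⟨hk, by omega⟩)] at hyW
    rwa [add_assoc]
  set z := H^[M] y with hz
  have hzG : z ∈ cyl G (p + n + i) k := by
    have : z ∈ cyl H (p + (n + i)) k := iterate_mem_cyl_iff.2 (by rwa [add_assoc])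
    rw [h.comp_shear_cyl (Or.inl le_rfl)] at this
    rwa [add_assoc]
  have hzt : |H^[i] z - cen G (p + n) k| ≤ 42 / 100 * rad G (p + n) k := by
    rw [hz, hy, ← Function.iterate_add_apply, ← Function.iterate_add_apply,
      show i + M + t' = t' + (M + i) by ring]
    exact hxt
  push_cast at ht
  have hMa : 0 ≤ (M : ℝ) * a := by positivity
  have hna : 0 ≤ (n : ℝ) * a := by positivity
  have hia : 0 ≤ (i : ℝ) * a := by positivity
  obtain ⟨hz1, hz2⟩ := h.chain_lower ha0 ha hk le_rfl (by norm_num) (by linarith) hzG hzt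
  rw [add_assoc p n i] at hz1 hz2
  obtain ⟨-, hy2⟩ := h.chain_upper ha0 ha hk le_rfl (by positivity) (by linarith) hyG hz1
  have hx2 := hH.jac_mul_rad_le (fun x hx y hy => h.jac_le_of_return hc hk hx hy) hx
  have hWr : rad H (p + (n + i + M)) k = rad G (p + (n + i) + M) k := by
    rw [(hH.cen_rad_eq h.lift (h.comp_shear_cyl (Or.inr ⟨hk, le_rfl⟩))).2, add_assoc p (n + i)]
  rw [hWr] at hx2
  rw [jac_add, jac_add, ← hy, ← hz]
  have j1 := (hH.jac_pos M y).le
  have j2 := (hH.jac_pos i z).le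
  have hr := (h.lift.rad_pos (p + n) k).le
  have hea : 1 ≤ Real.exp a := Real.one_le_exp ha0
  calc jac H t' x * (jac H M y * jac H i z) * rad H (p + (n + i + M) + t') k
      = (jac H t' x * rad H (p + (n + i + M) + t') k) * (jac H M y * jac H i z) := by ring
    _ ≤ (Real.exp c * rad G (p + (n + i) + M) k) * (jac H M y * jac H i z) := by gcongr
    _ = Real.exp c * (jac H M y * rad G (p + (n + i) + M) k) * jac H i z := by ring
    _ ≤ Real.exp c * ((Real.exp a * (1 - κ)) ^ M * rad G (p + (n + i)) k) * jac H i z := by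
        gcongr
    _ = Real.exp c * (Real.exp a * (1 - κ)) ^ M * (jac H i z * rad G (p + (n + i)) k) := by ring
    _ ≤ Real.exp c * (Real.exp a * (1 - κ)) ^ M * (Real.exp a ^ i * rad G (p + n) k) := by
        have : 0 ≤ 1 - κ := by linarith
        gcongr
    _ = Real.exp c * (Real.exp a ^ (i + M) * (1 - κ) ^ M) * rad G (p + n) k := by
        rw [mul_pow, pow_add]; ring
    _ ≤ Real.exp c * (Real.exp a ^ (n + i + M) * (1 - κ) ^ M) * rad G (p + n) k := by
        have : 0 ≤ 1 - κ := by linarith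
        gcongr
        omega
    _ ≤ 48 / 100 * rad G (p + n) k := mul_le_mul_of_nonneg_right hfin hr

end FinePert

/-! ### Measurability of first return maps -/

section FirstReturn

variable {h : T1 → T1} {X : Set T1}

lemma measurable_returnTime (hh : Measurable h) (hX : MeasurableSet X) :
    Measurable (returnTime h X) := by
  have hS : ∀ n, MeasurableSet {x | h^[n] x ∈ X} := fun n => (hh.iterate n) hX
  refine measurable_to_countable' fun n => ?_
  -- Points that never return get time `sInf ∅ = 0`, whence the second piece.
  have key : returnTime h X ⁻¹' {n} =
      ({x | 1 ≤ n ∧ h^[n] x ∈ X} ∩ ⋂ i : ℕ, ⋂ _ : 1 ≤ i ∧ i < n, {x | h^[i] x ∈ X}ᶜ) ∪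
      ({_x | n = 0} ∩ ⋂ i : ℕ, ⋂ _ : 1 ≤ i, {x | h^[i] x ∈ X}ᶜ) := by
    ext x
    simp only [mem_preimage, mem_singleton_iff, mem_union, mem_inter_iff, mem_ofPred_eq, mem_iInter,
      mem_compl_iff, returnTime]
    by_cases hne : {n : ℕ | 1 ≤ n ∧ h^[n] x ∈ X}.Nonempty
    · have hmem := Nat.sInf_mem hne
      constructor
      · rintro rfl
        exact Or.inl ⟨hmem, fun i hi hi2 => Nat.notMem_of_lt_sInf hi.2 ⟨hi.1, hi2⟩⟩
      · rintro (⟨h1, h2⟩ | ⟨-, h2⟩)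
        · refine le_antisymm (Nat.sInf_le h1) (not_lt.1 fun hlt => ?_)
          exact h2 _ ⟨hmem.1, hlt⟩ hmem.2
        · exact absurd hmem.2 (h2 _ hmem.1)
    · rw [not_nonempty_iff_eq_empty] at hne
      have h0 : ∀ i, 1 ≤ i → h^[i] x ∉ X := fun i hi hi2 => by
        have : i ∈ {n : ℕ | 1 ≤ n ∧ h^[n] x ∈ X} := ⟨hi, hi2⟩
        rw [hne] at this
        exact this
      rw [hne, Nat.sInf_empty]
      constructor
      · rintro rfl
        exact Or.inr ⟨rfl, h0⟩
      · rintro (⟨h1, -⟩ | ⟨h1, -⟩)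
        · exact absurd h1.2 (h0 _ h1.1)
        · exact h1.symm
  rw [key]
  refine MeasurableSet.union ?_ ?_
  · refine MeasurableSet.inter ?_ (MeasurableSet.iInter fun i => MeasurableSet.iInter fun _ =>
      (hS i).compl)
    by_cases hn : 1 ≤ n <;> simp [hn, hS n]
  · exact (MeasurableSet.const _).inter (MeasurableSet.iInter fun i => MeasurableSet.iInter fun _ =>
      (hS i).compl)

lemma measurable_firstReturn (hh : Measurable h) (hX : MeasurableSet X) :
    Measurable (firstReturn h X) := by
  intro B hB
  have : firstReturn h X ⁻¹' B = ⋃ n : ℕ, returnTime h X ⁻¹' {n} ∩ h^[n] ⁻¹' B := by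
    ext x; simp [firstReturn]
  rw [this]
  exact MeasurableSet.iUnion fun n =>
    (measurable_returnTime hh hX (measurableSet_singleton n)).inter ((hh.iterate n) hB)

lemma measurableSet_returnSet (hh : Measurable h) (hX : MeasurableSet X) :
    MeasurableSet (returnSet h X) := by
  have : returnSet h X = X ∩ ⋃ n : ℕ, ⋃ _ : 1 ≤ n, h^[n] ⁻¹' X := by
    ext x; simp [returnSet]
  rw [this]
  exact hX.inter (MeasurableSet.iUnion fun n => MeasurableSet.iUnion fun _ => (hh.iterate n) hX)

lemma firstReturn_mem {x : T1} (hx : x ∈ returnSet h X) : firstReturn h X x ∈ X :=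
  (Nat.sInf_mem (s := {n : ℕ | 1 ≤ n ∧ h^[n] x ∈ X}) hx.2).2

lemma returnTime_eq {x : T1} {t : ℕ} (ht : 1 ≤ t) (hx : h^[t] x ∈ X)
    (hmin : ∀ i, 1 ≤ i → i < t → h^[i] x ∉ X) : returnTime h X x = t := by
  refine le_antisymm (Nat.sInf_le ⟨ht, hx⟩) (not_lt.1 fun hlt => ?_)
  have := Nat.sInf_mem (s := {n : ℕ | 1 ≤ n ∧ h^[n] x ∈ X}) ⟨t, ht, hx⟩
  exact hmin _ this.1 hlt this.2

end FirstReturn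

/-! ### From the line to the circle: return branches and push-forward -/

lemma coe_eq_coe_iff {x y : ℝ} : (x : T1) = (y : T1) ↔ ∃ j : ℤ, x = y + j := by
  rw [← sub_eq_zero, ← AddCircle.coe_sub, AddCircle.coe_eq_zero_iff]
  refine exists_congr fun n => ?_
  rw [zsmul_eq_mul, mul_one]
  constructor <;> intro e <;> linarith

lemma iterate_coe {h : T1 → T1} {F : ℝ → ℝ} (hs : ∀ x : ℝ, h (x : T1) = (F x : T1)) (n : ℕ)
    (x : ℝ) : h^[n] (x : T1) = (F^[n] x : T1) := by
  induction n generalizing x with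
  | zero => rfl
  | succ n ih => rw [Function.iterate_succ_apply, hs, ih, Function.iterate_succ_apply]

lemma volume_eq_volume_preimage_inter {a c : ℝ} (hc : c ≤ a + 1) {S : Set T1}
    (hS : MeasurableSet S) (hsub : S ⊆ (fun x : ℝ => (x : T1)) '' Ioo a c) :
    volume S = volume ((fun x : ℝ => (x : T1)) ⁻¹' S ∩ Ioo a c) := by
  have hmp := AddCircle.measurePreserving_mk 1 a
  rw [← hmp.measure_preimage hS.nullMeasurableSet,
    Measure.restrict_apply' measurableSet_Ioc]
  congr 1
  ext y
  constructor
  · rintro ⟨hy, hy2⟩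
    refine ⟨hy, ?_⟩
    obtain ⟨x, hx, hxy⟩ := hsub hy
    obtain ⟨j, hj⟩ := coe_eq_coe_iff.1 hxy
    have h1 : (j : ℝ) < 1 := by linarith [hx.2, hy2.1]
    have h2 : (-1 : ℝ) < j := by linarith [hx.1, hy2.2]
    have h1' : j < 1 := by exact_mod_cast h1
    have h2' : -1 < j := by exact_mod_cast h2
    obtain rfl : j = 0 := by omega
    rw [Int.cast_zero, add_zero] at hj
    rwa [← hj]
  · rintro ⟨hy, hy2⟩
    exact ⟨hy, hy2.1, by linarith [hy2.2]⟩

namespace ExpLift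

variable {F : ℝ → ℝ} {d : ℤ} {r : ℝ} {h : T1 → T1}

lemma coe_mem_image_cyl_iff (hF : ExpLift F d r) {m : ℕ} {k : ℤ} {y : ℝ} :
    (y : T1) ∈ (fun x : ℝ => (x : T1)) '' cyl F m k ↔ ∃ j : ℤ, y ∈ cyl F m (k + d ^ m * j) := by
  constructor
  · rintro ⟨x, hx, e⟩
    obtain ⟨j, hj⟩ := coe_eq_coe_iff.1 e.symm
    exact ⟨j, hj ▸ hF.add_intCast_mem_cyl.2 hx⟩
  · rintro ⟨j, hj⟩
    refine ⟨y - j, ?_, coe_eq_coe_iff.2 ⟨-j, by push_cast; ring⟩⟩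
    rw [← hF.add_intCast_mem_cyl (j := j), sub_add_cancel]
    exact hj

lemma isOpen_image_cyl (hF : ExpLift F d r) (m : ℕ) (k : ℤ) :
    IsOpen ((fun x : ℝ => (x : T1)) '' cyl F m k) :=
  QuotientAddGroup.isOpenMap_coe _ (hF.isOpen_cyl m k)

lemma volume_eq_of_subset_image_cyl (hF : ExpLift F d r) {m : ℕ} {k : ℤ} {S : Set T1}
    (hS : MeasurableSet S) (hsub : S ⊆ (fun x : ℝ => (x : T1)) '' cyl F m k) :
    volume S = volume ((fun x : ℝ => (x : T1)) ⁻¹' S ∩ cyl F m k) := by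
  rw [hF.cyl_eq_Ioo] at hsub ⊢
  exact volume_eq_volume_preimage_inter (by linarith [hF.rad_le_half m k]) hS hsub

/-- The points of a Markov interval whose first return branch has time `t` and index `k'`. -/
def branch (F : ℝ → ℝ) (d : ℤ) (m : ℕ) (k : ℤ) (t : ℕ) (k' : ℤ) : Set ℝ :=
  {x | x ∈ cyl F m k ∧ 1 ≤ t ∧ (∀ i, 1 ≤ i → i < t → ∀ j : ℤ, F^[i] x ∉ cyl F m (k + d ^ m * j)) ∧
    (∃ j : ℤ, k' = k + d ^ m * j) ∧ F^[t] x ∈ cyl F m k'}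

lemma branch_eq_cyl (hF : ExpLift F d r) {m t : ℕ} {k k' : ℤ}
    (hne : (branch F d m k t k').Nonempty) : branch F d m k t k' = cyl F (m + t) k' := by
  obtain ⟨x, hx1, ht, hx3, hj, hx5⟩ := hne
  apply subset_antisymm
  · rintro y ⟨-, -, -, -, hy⟩
    exact iterate_mem_cyl_iff.1 hy
  · intro y hy
    have hx := iterate_mem_cyl_iff.1 hx5
    refine ⟨hF.cyl_subset_cyl (by omega) hx1 hx hy, ht, fun i hi hit j hyi => ?_, hj,
      iterate_mem_cyl_iff.2 hy⟩
    obtain ⟨e, rfl⟩ := Nat.exists_eq_add_of_le' hit.le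
    rw [← add_assoc] at hx hy
    exact hx3 i hi hit j (hF.cyl_subset_cyl (by omega) hyi (iterate_mem_cyl_iff.2 hy)
      (iterate_mem_cyl_iff.2 hx))

lemma measurableSet_branch (hF : ExpLift F d r) (m t : ℕ) (k k' : ℤ) :
    MeasurableSet (branch F d m k t k') := by
  rcases (branch F d m k t k').eq_empty_or_nonempty with e | hne
  · rw [e]; exact MeasurableSet.empty
  · rw [hF.branch_eq_cyl hne]; exact (hF.isOpen_cyl _ _).measurableSet

lemma pairwise_disjoint_branch (F : ℝ → ℝ) (d : ℤ) (m : ℕ) (k : ℤ) :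
    Pairwise (Function.onFun Disjoint fun q : ℕ × ℤ => branch F d m k q.1 q.2) := by
  rintro ⟨t, a⟩ ⟨t', a'⟩ hne
  rw [Function.onFun, Set.disjoint_left]
  rintro x ⟨-, h1, h2, ⟨j, rfl⟩, h4⟩ ⟨-, h1', h2', ⟨j', rfl⟩, h4'⟩
  rcases lt_trichotomy t t' with hlt | rfl | hlt
  · exact h2' t h1 hlt j h4
  · have e : k + d ^ m * j = k + d ^ m * j' := eq_of_mem_cyl h4 h4'
    exact hne (by rw [e])
  · exact h2 t' h1' hlt j' h4'

/-- By ergodicity almost every point visits the translates of the interval, and its first visit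
selects a branch. -/
lemma volume_cyl_diff_iUnion_branch (hF : ExpLift F d r) (m : ℕ) (k : ℤ) :
    volume (⋃ q : ℕ × ℤ, branch F d m k q.1 q.2) = volume (cyl F m k) := by
  refine measure_congr ((LE.le.eventuallyLE (iUnion_subset fun q x hx => hx.1)) |>.antisymm ?_)
  have hU : {y : ℝ | ∃ j : ℤ, y ∈ cyl F m (k + d ^ m * j)} = ⋃ j : ℤ, cyl F m (k + d ^ m * j) := by
    ext; simp
  have hopen : IsOpen {y : ℝ | ∃ j : ℤ, y ∈ cyl F m (k + d ^ m * j)} := by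
    rw [hU]; exact isOpen_iUnion fun j => hF.isOpen_cyl _ _
  have hper : ∀ y, y + 1 ∈ {y : ℝ | ∃ j : ℤ, y ∈ cyl F m (k + d ^ m * j)} ↔
      y ∈ {y : ℝ | ∃ j : ℤ, y ∈ cyl F m (k + d ^ m * j)} := fun y => by
    simp only [mem_ofPred_eq, ← hF.coe_mem_image_cyl_iff]
    rw [show ((y + 1 : ℝ) : T1) = (y : T1) from coe_eq_coe_iff.2 ⟨1, by push_cast; rfl⟩]
  filter_upwards [hF.ae_exists_iterate_mem hopen ⟨cen F m (k + d ^ m * 0), 0, hF.cen_mem_cyl _ _⟩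
    hper] with x hx hxI
  classical
  have hspec := Nat.find_spec hx
  obtain ⟨j, hj⟩ := hspec.2
  refine mem_iUnion.2 ⟨(Nat.find hx, k + d ^ m * j), hxI, hspec.1, fun i hi hit j' hmem => ?_,
    ⟨j, rfl⟩, hj⟩
  exact Nat.find_min hx hit ⟨hi, j', hmem⟩

lemma firstReturn_of_mem_branch (hF : ExpLift F d r) (hs : ∀ x : ℝ, h (x : T1) = (F x : T1))
    {m t : ℕ} {k k' : ℤ} {x : ℝ} (hx : x ∈ branch F d m k t k') :
    (x : T1) ∈ returnSet h ((fun x : ℝ => (x : T1)) '' cyl F m k) ∧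
    firstReturn h ((fun x : ℝ => (x : T1)) '' cyl F m k) (x : T1) = (F^[t] x : T1) := by
  obtain ⟨h1, h2, h3, ⟨j, rfl⟩, h5⟩ := hx
  have hret : h^[t] (x : T1) ∈ (fun x : ℝ => (x : T1)) '' cyl F m k := by
    rw [iterate_coe hs, hF.coe_mem_image_cyl_iff]; exact ⟨j, h5⟩
  refine ⟨⟨⟨x, h1, rfl⟩, t, h2, hret⟩, ?_⟩
  rw [firstReturn, returnTime_eq h2 hret fun i hi hit => ?_, iterate_coe hs]
  rw [iterate_coe hs, hF.coe_mem_image_cyl_iff]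
  rintro ⟨j', hj'⟩
  exact h3 i hi hit j' hj'

/-- If the return branches have a small derivative over the middle of a Markov interval, then the
push-forward of Lebesgue measure is large there. -/
lemma volume_le_volume_firstReturn (hF : ExpLift F d r) (hs : ∀ x : ℝ, h (x : T1) = (F x : T1))
    (hh : Measurable h) {m : ℕ} {k : ℤ} {θ C : ℝ} (hθ : θ < 1) (hC : 0 ≤ C)
    (hbr : ∀ t, 1 ≤ t → ∀ j : ℤ, (cyl F m k ∩ cyl F (m + t) (k + d ^ m * j)).Nonempty →
      ∀ y ∈ cyl F (m + t) (k + d ^ m * j),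
      |F^[t] y - cen F m (k + d ^ m * j)| ≤ θ * rad F m k →
      jac F t y * rad F (m + t) (k + d ^ m * j) ≤ C * rad F m k)
    {B : Set T1} (hB : MeasurableSet B)
    (hBA : B ⊆ (fun x : ℝ => (x : T1)) '' Metric.closedBall (cen F m k) (θ * rad F m k)) :
    volume B ≤ ENNReal.ofReal C * volume
      (returnSet h ((fun x : ℝ => (x : T1)) '' cyl F m k) ∩
        firstReturn h ((fun x : ℝ => (x : T1)) '' cyl F m k) ⁻¹' B) := by
  set I := (fun x : ℝ => (x : T1)) '' cyl F m k with hI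
  have hρ := hF.rad_pos m k
  have hIm : MeasurableSet I := (hF.isOpen_image_cyl m k).measurableSet
  have hBI : B ⊆ I := hBA.trans (image_mono (by
    rw [hF.cyl_eq_ball]
    exact Metric.closedBall_subset_ball (by nlinarith)))
  have hBr : MeasurableSet ((fun x : ℝ => (x : T1)) ⁻¹' B) :=
    (AddCircle.measurable_mk' (a := 1)) hB
  have hDB : MeasurableSet (returnSet h I ∩ firstReturn h I ⁻¹' B) :=
    (measurableSet_returnSet hh hIm).inter (measurable_firstReturn hh hIm hB)
  -- The fraction of a branch that lands in `B` is at least `1 / C` times the fraction of the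
  -- interval occupied by `B`. Since the branches fill the interval, summing and cancelling its
  -- measure gives the claim.
  have hbranch : ∀ q : ℕ × ℤ, volume B * volume (branch F d m k q.1 q.2) ≤
      ENNReal.ofReal C * volume (cyl F m k) *
        volume (branch F d m k q.1 q.2 ∩ F^[q.1] ⁻¹' ((fun x : ℝ => (x : T1)) ⁻¹' B)) := by
    rintro ⟨t, k'⟩
    rcases (branch F d m k t k').eq_empty_or_nonempty with e | hne
    · simp [e]
    · have hcyl := hF.branch_eq_cyl hne
      obtain ⟨x, hx⟩ := hne
      have hx' := hx
      rw [hcyl] at hx'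
      obtain ⟨h1, h2, h3, ⟨j, rfl⟩, h5⟩ := hx
      set k' := k + d ^ m * j with hk'
      have hρJ := hF.rad_pos (m + t) k'
      have hIk : I = (fun x : ℝ => (x : T1)) '' cyl F m k' := by
        ext z
        obtain ⟨z, rfl⟩ := QuotientAddGroup.mk_surjective z
        rw [hI]
        rw [hF.coe_mem_image_cyl_iff, hF.coe_mem_image_cyl_iff]
        constructor
        · rintro ⟨i, hi⟩
          exact ⟨i - j, by rwa [hk', show k + d ^ m * j + d ^ m * (i - j) = k + d ^ m * i by ring]⟩
        · rintro ⟨i, hi⟩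
          exact ⟨i + j, by rwa [show k + d ^ m * (i + j) = k' + d ^ m * i by rw [hk']; ring]⟩
      have hvB := hF.volume_eq_of_subset_image_cyl hB (hIk ▸ hBI)
      have key := hF.volume_le_of_jac_le (m := m) (i := t) (k := k')
        (B := (fun x : ℝ => (x : T1)) ⁻¹' B ∩ cyl F m k') (C := C * rad F m k / rad F (m + t) k')
        (hBr.inter (hF.isOpen_cyl _ _).measurableSet) inter_subset_right
        (fun y hy hyB => by
          rw [le_div_iff₀ hρJ]
          refine hbr t h2 j ⟨x, h1, hx'⟩ y hy ?_
          obtain ⟨z, hz, hzy⟩ := hBA hyB.1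
          obtain ⟨i, hi⟩ := coe_eq_coe_iff.1 hzy.symm
          have hzI : z ∈ cyl F m k := by
            rw [hF.cyl_eq_ball]
            exact Metric.closedBall_subset_ball (by nlinarith) hz
          have hyi : F^[t] y ∈ cyl F m (k + d ^ m * i) := by
            rw [hi]; exact hF.add_intCast_mem_cyl.2 hzI
          have hki := eq_of_mem_cyl hyB.2 hyi
          rw [← hk', hki, hF.cen_add, hi, add_sub_add_right_eq_sub]
          simpa [Real.dist_eq] using hz)
      rw [← hvB] at key
      have hset : cyl F (m + t) k' ∩ F^[t] ⁻¹' ((fun x : ℝ => (x : T1)) ⁻¹' B ∩ cyl F m k') ⊆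
          branch F d m k t k' ∩ F^[t] ⁻¹' ((fun x : ℝ => (x : T1)) ⁻¹' B) := fun y hy =>
        ⟨hcyl ▸ hy.1, hy.2.1⟩
      calc volume B * volume (branch F d m k t k')
          ≤ (ENNReal.ofReal (C * rad F m k / rad F (m + t) k') *
            volume (branch F d m k t k' ∩ F^[t] ⁻¹' ((fun x : ℝ => (x : T1)) ⁻¹' B))) *
              ENNReal.ofReal (2 * rad F (m + t) k') := by
            rw [hcyl, hF.volume_cyl, ← hcyl]
            gcongr
            exact key.trans (by gcongr)
        _ = (ENNReal.ofReal (C * rad F m k / rad F (m + t) k') *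
            ENNReal.ofReal (2 * rad F (m + t) k')) *
            volume (branch F d m k t k' ∩ F^[t] ⁻¹' ((fun x : ℝ => (x : T1)) ⁻¹' B)) := by ring
        _ = _ := by
            rw [hF.volume_cyl, ← ENNReal.ofReal_mul (by positivity), ← ENNReal.ofReal_mul hC]
            congr 2
            field_simp
  have hsum : volume B * volume (cyl F m k) ≤
      ENNReal.ofReal C * volume (cyl F m k) *
        volume (returnSet h I ∩ firstReturn h I ⁻¹' B) := by
    rw [hF.volume_eq_of_subset_image_cyl hDB (inter_subset_left.trans fun x hx => hx.1)]
    nth_rewrite 1 [← hF.volume_cyl_diff_iUnion_branch]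
    rw [measure_iUnion (pairwise_disjoint_branch F d m k) fun q => hF.measurableSet_branch _ _ _ _,
      ← ENNReal.tsum_mul_left]
    refine (ENNReal.tsum_le_tsum hbranch).trans ?_
    rw [ENNReal.tsum_mul_left]
    gcongr
    rw [← measure_iUnion (fun q q' hqq => ((pairwise_disjoint_branch F d m k) hqq).mono
      inter_subset_left inter_subset_left) fun q => (hF.measurableSet_branch _ _ _ _).inter
        ((hF.continuous_iterate _).measurable hBr)]
    refine measure_mono (iUnion_subset ?_)
    rintro ⟨t, k'⟩ x ⟨hx, hxB⟩
    obtain ⟨h1, h2⟩ := hF.firstReturn_of_mem_branch hs hx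
    exact ⟨⟨h1, by rw [mem_preimage, h2]; exact hxB⟩, hx.1⟩
  have hI0 : volume (cyl F m k) ≠ 0 := by
    rw [hF.volume_cyl]; simpa using hρ
  have hIt : volume (cyl F m k) ≠ ⊤ := by rw [hF.volume_cyl]; exact ENNReal.ofReal_ne_top
  rw [mul_right_comm] at hsum
  exact (ENNReal.mul_le_mul_iff_left hI0 hIt).1 hsum

end ExpLift

/-! ### Circle derivatives, Markov intervals and distorted return maps -/

lemma centeredRep_coe {a : ℝ} (ha : |a| < 1 / 2) : centeredRep (a : T1) = a := by
  have h := abs_lt.1 ha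
  rw [centeredRep, AddCircle.equivIco_coe_eq (p := (1 : ℝ)) (a := -(1 / 2)) (x := a)
    ⟨h.1.le, by linarith [h.2]⟩]

/-- The derivative of a circle map is the derivative of a lift. -/
lemma circleDeriv_coe {f : T1 → T1} {F : ℝ → ℝ} (hF : Continuous F)
    (hs : ∀ x : ℝ, f (x : T1) = (F x : T1)) (y : ℝ) : circleDeriv f (y : T1) = deriv F y := by
  have hev : (fun t : ℝ => centeredRep (f ((y : T1) + (t : T1)) - f (y : T1))) =ᶠ[𝓝 0]
      fun t => F (y + t) - F y := by
    have hc : Continuous fun t => |F (y + t) - F y| := by fun_prop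
    have h0 : |F (y + 0) - F y| < 1 / 2 := by simp
    filter_upwards [hc.continuousAt.eventually (gt_mem_nhds h0)] with t ht
    rw [← AddCircle.coe_add, hs, hs, ← AddCircle.coe_sub, centeredRep_coe ht]
  rw [circleDeriv, hev.deriv_eq, deriv_sub_const, deriv_comp_const_add, add_zero]

lemma volume_coe_preimage_eq_zero {Z : Set T1} (hZ : MeasurableSet Z) (h0 : volume Z = 0) :
    volume ((fun x : ℝ => (x : T1)) ⁻¹' Z) = 0 := by
  have hcov : (fun x : ℝ => (x : T1)) ⁻¹' Z =
      ⋃ j : ℤ, (fun x : ℝ => (x : T1)) ⁻¹' Z ∩ Ioc (j : ℝ) (j + 1) := by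
    rw [← inter_iUnion, iUnion_Ioc_intCast, inter_univ]
  rw [hcov, measure_iUnion_null_iff]
  intro j
  have hmp := AddCircle.measurePreserving_mk 1 (j : ℝ)
  rw [← Measure.restrict_apply' measurableSet_Ioc]
  exact (hmp.measure_preimage hZ.nullMeasurableSet).trans h0

lemma volume_eq_zero_of_coe_preimage {Z : Set T1} (hZ : MeasurableSet Z)
    (h0 : volume ((fun x : ℝ => (x : T1)) ⁻¹' Z) = 0) : volume Z = 0 := by
  have hmp := AddCircle.measurePreserving_mk 1 (0 : ℝ)
  rw [← hmp.measure_preimage hZ.nullMeasurableSet, Measure.restrict_apply' measurableSet_Ioc]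
  exact measure_mono_null inter_subset_left h0

/-- A lower bound for a measure gives a lower bound for its density. -/
lemma two_lt_rnDeriv {ν : Measure T1} [IsFiniteMeasure ν] {X A : Set T1}
    (hA : MeasurableSet A) (hAX : A ⊆ X) (hac : ν ≪ (volume : Measure T1).restrict X) {C : ℝ}
    (hC0 : 0 < C) (hC : C < 1 / 2)
    (hB : ∀ B ⊆ A, MeasurableSet B → volume B ≤ ENNReal.ofReal C * ν B) :
    ∀ᵐ y ∂((volume : Measure T1).restrict A),
      2 < ν.rnDeriv ((volume : Measure T1).restrict X) y := by
  have hC0' : ENNReal.ofReal C ≠ 0 := by simpa using hC0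
  have hle : (fun _ => (ENNReal.ofReal C)⁻¹) ≤ᵐ[(volume : Measure T1).restrict A]
      ν.rnDeriv ((volume : Measure T1).restrict X) := by
    refine ae_le_of_forall_setLIntegral_le_of_sigmaFinite measurable_const fun t ht _ => ?_
    rw [setLIntegral_const, Measure.restrict_apply ht, Measure.restrict_restrict ht]
    have e : (volume : Measure T1).restrict (t ∩ A) =
        ((volume : Measure T1).restrict X).restrict (t ∩ A) := by
      rw [Measure.restrict_restrict (ht.inter hA), inter_eq_left.2 (inter_subset_right.trans hAX)]
    rw [e, Measure.setLIntegral_rnDeriv hac]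
    have := hB (t ∩ A) inter_subset_right (ht.inter hA)
    rw [ENNReal.inv_mul_le_iff hC0' ENNReal.ofReal_ne_top]
    exact this
  have h2 : (2 : ℝ≥0∞) < (ENNReal.ofReal C)⁻¹ := by
    rw [← ENNReal.ofReal_inv_of_pos hC0, ← ENNReal.ofReal_ofNat]
    refine (ENNReal.ofReal_lt_ofReal_iff (by positivity)).2 ?_
    rw [lt_inv_comm₀ two_pos hC0]
    linarith
  filter_upwards [hle] with y hy using h2.trans_le hy

namespace ExpLift

variable {F : ℝ → ℝ} {d : ℤ} {r : ℝ} {h : T1 → T1}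

lemma exists_abs_deriv_le (hF : ExpLift F d r) : ∃ K : ℝ≥0, ∀ x, |deriv F x| ≤ K := by
  obtain ⟨K, hK⟩ := isCompact_Icc (a := (0 : ℝ)) (b := 1) |>.exists_bound_of_continuousOn
    hF.contDiff_deriv.continuous.continuousOn
  refine ⟨⟨K, (norm_nonneg _).trans (hK 0 (by simp))⟩, fun x => ?_⟩
  have := hK (x - ⌊x⌋) ⟨Int.fract_nonneg x, (Int.fract_lt_one x).le⟩
  rwa [← hF.deriv_add_intCast _ ⌊x⌋, sub_add_cancel] at this

lemma lipschitzWith (hF : ExpLift F d r) {K : ℝ≥0} (hK : ∀ x, |deriv F x| ≤ K) :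
    LipschitzWith K F :=
  lipschitzWith_of_nnnorm_deriv_le hF.differentiable fun x => hK x

lemma antilipschitzWith (hF : ExpLift F d r) : AntilipschitzWith 1 F :=
  AntilipschitzWith.of_le_mul_dist fun x y => by
    have := hF.pow_mul_abs_sub_le 1 x y
    rw [pow_one, Function.iterate_one] at this
    rw [NNReal.coe_one, one_mul, Real.dist_eq, Real.dist_eq]
    nlinarith [abs_nonneg (x - y), hF.one_lt]

lemma lipschitzWith_circle (hF : ExpLift F d r) (hs : ∀ x : ℝ, h (x : T1) = (F x : T1)) :
    ∃ K : ℝ≥0, LipschitzWith K h := by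
  obtain ⟨K, hK⟩ := hF.exists_abs_deriv_le
  refine ⟨K, LipschitzWith.of_dist_le_mul fun x y => ?_⟩
  obtain ⟨a, ha⟩ := QuotientAddGroup.mk_surjective (x - y)
  obtain ⟨v, rfl⟩ := QuotientAddGroup.mk_surjective y
  set t : ℝ := a - round a with ht
  have hta : (t : T1) = (a : T1) := coe_eq_coe_iff.2 ⟨-round a, by push_cast; ring⟩
  have hx : x = ((v + t : ℝ) : T1) := by
    rw [AddCircle.coe_add, hta]
    change x = (QuotientAddGroup.mk v : T1) + QuotientAddGroup.mk a
    rw [ha, add_sub_cancel]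
  have hnorm : dist x (v : T1) = |t| := by
    rw [dist_eq_norm, ← UnitAddCircle.norm_eq]
    exact congrArg norm ha.symm
  have h1 : dist (h x) (h (v : T1)) ≤ |F (v + t) - F v| := by
    rw [hx, hs, hs, dist_eq_norm, ← AddCircle.coe_sub, UnitAddCircle.norm_eq]
    simpa using round_le (F (v + t) - F v) 0
  have h2 := (hF.lipschitzWith hK).dist_le_mul (v + t) v
  rw [Real.dist_eq, Real.dist_eq, add_sub_cancel_left] at h2
  change dist (h x) (h (v : T1)) ≤ K * dist x (v : T1)
  rw [hnorm]
  exact h1.trans h2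

lemma continuous_circle (hF : ExpLift F d r) (hs : ∀ x : ℝ, h (x : T1) = (F x : T1)) :
    Continuous h := by
  obtain ⟨K, hK⟩ := hF.lipschitzWith_circle hs
  exact hK.continuous

/-- The lift is a homeomorphism of the line, and the property descends along the covering, a
surjective local homeomorphism. -/
lemma isLocalHomeomorph_circle (hF : ExpLift F d r) (hs : ∀ x : ℝ, h (x : T1) = (F x : T1)) :
    IsLocalHomeomorph h := by
  have hemb := hF.antilipschitzWith.isEmbedding hF.continuous
  have hlF : IsLocalHomeomorph F :=
    (hemb.toHomeomorphOfSurjective hF.surjective).isLocalHomeomorph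
  have hπ : IsLocalHomeomorph (fun x : ℝ => (x : T1)) := AddCircle.isLocalHomeomorph_coe 1
  have hcomp : IsLocalHomeomorph (h ∘ fun x : ℝ => (x : T1)) := by
    have e : (h ∘ fun x : ℝ => (x : T1)) = (fun x : ℝ => (x : T1)) ∘ F := funext hs
    rw [e]
    exact hπ.comp hlF
  rw [isLocalHomeomorph_iff_isLocalHomeomorphOn_univ]
  have := (hcomp.isLocalHomeomorphOn (s := univ)).of_comp_right (hπ.isLocalHomeomorphOn (s := univ))
  rwa [image_univ, (QuotientAddGroup.mk_surjective : Function.Surjective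
    fun x : ℝ => (x : T1)).range_eq] at this

lemma mem_E10 (hF : ExpLift F d r) (hs : ∀ x : ℝ, h (x : T1) = (F x : T1)) : h ∈ E10 := by
  -- A rate strictly between 1 and `r` makes the required inequality strict.
  refine ⟨⟨F, hF.contDiff.of_le (by norm_num), hs⟩, ?_, (1 + r) / 2, by linarith [hF.one_lt],
    fun x n hn => ?_⟩
  · have := hs 0
    rwa [hF.map_zero, AddCircle.coe_zero] at this
  · obtain ⟨y, rfl⟩ := QuotientAddGroup.mk_surjective x
    have e := circleDeriv_coe (hF.continuous_iterate n) (iterate_coe hs n) y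
    change 1 * ((1 + r) / 2) ^ n < |circleDeriv h^[n] (y : T1)|
    rw [e, hF.abs_deriv_iterate, one_mul]
    refine lt_of_lt_of_le ?_ (hF.pow_le_jac n y)
    exact pow_lt_pow_left₀ (by linarith [hF.one_lt]) (by linarith [hF.one_lt]) (by omega)

lemma mem_E0lip (hF : ExpLift F d r) (hs : ∀ x : ℝ, h (x : T1) = (F x : T1)) : h ∈ E0lip := by
  refine ⟨hF.lipschitzWith_circle hs, hF.isLocalHomeomorph_circle hs, (hF.mem_E10 hs).2.1, ?_⟩
  have h1 : (1 : ℝ≥0∞) < ENNReal.ofReal r := by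
    rw [← ENNReal.ofReal_one]
    exact (ENNReal.ofReal_lt_ofReal_iff hF.pos).2 hF.one_lt
  refine h1.trans_le (le_essInf_of_ae_le _ (Eventually.of_forall fun x => ?_))
  obtain ⟨y, rfl⟩ := QuotientAddGroup.mk_surjective x
  change ENNReal.ofReal r ≤ ‖circleDeriv h (y : T1)‖ₑ
  rw [circleDeriv_coe hF.continuous hs, Real.enorm_eq_ofReal_abs]
  exact ENNReal.ofReal_le_ofReal (hF.le_abs_deriv y)

lemma isMarkovInterval_image_cyl (hF : ExpLift F d r) (hs : ∀ x : ℝ, h (x : T1) = (F x : T1))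
    (m : ℕ) (k : ℤ) : IsMarkovInterval h ((fun x : ℝ => (x : T1)) '' cyl F m k) := by
  set I := (fun x : ℝ => (x : T1)) '' cyl F m k with hI
  set W : Set T1 := {y | h^[m] y ≠ 0} with hW
  have hker : ∀ x : ℝ, h^[m] (x : T1) = 0 ↔ ∃ j : ℤ, x = endpt F m j := fun x => by
    rw [iterate_coe hs, ← AddCircle.coe_zero, coe_eq_coe_iff]
    simp only [zero_add, hF.iterate_eq_iff]
  have hIW : I ⊆ W := by
    rintro _ ⟨x, hx, rfl⟩ h0
    obtain ⟨j, rfl⟩ := (hker x).1 h0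
    have h1 := hx.1
    have h2 := hx.2
    rw [hF.iterate_endpt] at h1 h2
    have h1' : k < j := by exact_mod_cast h1
    have h2' : j < k + 1 := by exact_mod_cast h2
    omega
  have hcI : ((cen F m k : ℝ) : T1) ∈ I := ⟨_, hF.cen_mem_cyl m k, rfl⟩
  refine ⟨m, ((cen F m k : ℝ) : T1), hIW hcI, ?_⟩
  have hπc : Continuous fun x : ℝ => (x : T1) := AddCircle.continuous_mk' 1
  apply subset_antisymm
  · refine IsPreconnected.subset_connectedComponentIn ?_ hcI hIW
    exact (hF.ordConnected_cyl m k).isPreconnected.image _ hπc.continuousOn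
  · have hKc := isPreconnected_connectedComponentIn (F := W) (x := ((cen F m k : ℝ) : T1))
    have hKW := connectedComponentIn_subset W ((cen F m k : ℝ) : T1)
    set Kc := connectedComponentIn W ((cen F m k : ℝ) : T1)
    set Q := (fun x : ℝ => (x : T1)) '' Icc (cen F m k - rad F m k) (cen F m k + rad F m k) with hQ
    have hQc : IsClosed Q := (isCompact_Icc.image hπc).isClosed
    have hIo := hF.isOpen_image_cyl m k
    -- The ends of the closed arc `Q` are mapped to `0` by the `m`-th iterate, so the component
    -- avoids them and cannot leave the open arc.
    have hKsub : Kc ⊆ I ∪ Qᶜ := by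
      intro y hy
      by_cases hyQ : y ∈ Q
      · left
        obtain ⟨x, hx, rfl⟩ := hyQ
        refine ⟨x, ?_, rfl⟩
        have hne : ∀ j : ℤ, x ≠ endpt F m j := fun j e => hKW hy ((hker x).2 ⟨j, e⟩)
        rw [hF.cyl_eq_Ioo]
        refine ⟨lt_of_le_of_ne hx.1 fun e => ?_, lt_of_le_of_ne hx.2 fun e => ?_⟩
        · rw [cen_sub_rad] at e
          rcases min_choice (endpt F m k) (endpt F m (k + 1)) with e' | e' <;>
            exact hne _ (e.symm.trans e')
        · rw [cen_add_rad] at e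
          rcases max_choice (endpt F m k) (endpt F m (k + 1)) with e' | e' <;>
            exact hne _ (e.trans e')
      · exact Or.inr hyQ
    have hdisj : Kc ∩ (I ∩ Qᶜ) = ∅ := by
      ext y
      simp only [mem_inter_iff, mem_compl_iff, mem_empty_iff_false, iff_false]
      rintro ⟨-, ⟨x, hx, rfl⟩, hyQ⟩
      rw [hF.cyl_eq_Ioo] at hx
      exact hyQ ⟨x, Ioo_subset_Icc_self hx, rfl⟩
    refine hKc.subset_left_of_subset_union hIo hQc.isOpen_compl ?_ hKsub
      ⟨_, mem_connectedComponentIn (hIW hcI), hcI⟩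
    rw [Set.disjoint_left]
    rintro y ⟨x, hx, rfl⟩ hyQ
    rw [hF.cyl_eq_Ioo] at hx
    exact hyQ ⟨x, Ioo_subset_Icc_self hx, rfl⟩

lemma volume_image_cyl (hF : ExpLift F d r) (m : ℕ) (k : ℤ) :
    volume ((fun x : ℝ => (x : T1)) '' cyl F m k) = ENNReal.ofReal (2 * rad F m k) := by
  rw [hF.volume_eq_of_subset_image_cyl (hF.isOpen_image_cyl m k).measurableSet subset_rfl,
    inter_eq_right.2 (subset_preimage_image _ _), hF.volume_cyl]

/-- Upstairs the inverse of `F` is 1-Lipschitz and does not increase one-dimensional Hausdorff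
measure. This is what makes the first return map non-singular. -/
lemma volume_preimage_eq_zero (hF : ExpLift F d r) (hs : ∀ x : ℝ, h (x : T1) = (F x : T1))
    {Z : Set T1} (hZ : MeasurableSet Z) (h0 : volume Z = 0) (n : ℕ) :
    volume (h^[n] ⁻¹' Z) = 0 := by
  have hm : Measurable h := (hF.continuous_circle hs).measurable
  induction n with
  | zero => exact h0
  | succ n ih =>
    have hZn : MeasurableSet (h^[n] ⁻¹' Z) := (hm.iterate n) hZ
    rw [Function.iterate_succ, preimage_comp]
    refine volume_eq_zero_of_coe_preimage (hm hZn) ?_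
    rw [← preimage_comp, show (h ∘ fun x : ℝ => (x : T1)) = (fun x : ℝ => (x : T1)) ∘ F from
      funext hs, preimage_comp]
    have := hF.antilipschitzWith.hausdorffMeasure_preimage_le zero_le_one
      ((fun x : ℝ => (x : T1)) ⁻¹' (h^[n] ⁻¹' Z))
    rw [hausdorffMeasure_real, volume_coe_preimage_eq_zero hZn ih, mul_zero] at this
    exact le_antisymm this bot_le

/-- The first return map to a Markov interval is distorted if its branches have a small derivative
over the middle of the interval. -/
lemma isDistorted (hF : ExpLift F d r) (hs : ∀ x : ℝ, h (x : T1) = (F x : T1))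
    {m : ℕ} {k : ℤ} {θ C : ℝ} (hθ0 : 4 / 10 < θ) (hθ : θ < 1) (hC0 : 0 < C) (hC : C < 1 / 2)
    (hbr : ∀ t, 1 ≤ t → ∀ j : ℤ, (cyl F m k ∩ cyl F (m + t) (k + d ^ m * j)).Nonempty →
      ∀ y ∈ cyl F (m + t) (k + d ^ m * j),
      |F^[t] y - cen F m (k + d ^ m * j)| ≤ θ * rad F m k →
      jac F t y * rad F (m + t) (k + d ^ m * j) ≤ C * rad F m k) :
    IsDistorted ((fun x : ℝ => (x : T1)) '' cyl F m k)
      (returnSet h ((fun x : ℝ => (x : T1)) '' cyl F m k))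
      (firstReturn h ((fun x : ℝ => (x : T1)) '' cyl F m k)) := by
  set I := (fun x : ℝ => (x : T1)) '' cyl F m k with hI
  have hρ := hF.rad_pos m k
  have hm : Measurable h := (hF.continuous_circle hs).measurable
  have hIm : MeasurableSet I := (hF.isOpen_image_cyl m k).measurableSet
  have hDm := measurableSet_returnSet hm hIm
  have hφm := measurable_firstReturn hm hIm
  have hmaps : MapsTo (firstReturn h I) (returnSet h I) I := fun x hx => firstReturn_mem hx
  have happ : ∀ B, MeasurableSet B → pushLebesgue (returnSet h I) (firstReturn h I) B =
      volume (returnSet h I ∩ firstReturn h I ⁻¹' B) := fun B hB => by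
    rw [pushLebesgue, Measure.map_apply hφm hB, Measure.restrict_apply (hφm hB), inter_comm]
  have hac : pushLebesgue (returnSet h I) (firstReturn h I) ≪ (volume : Measure T1).restrict I := by
    refine Measure.AbsolutelyContinuous.mk fun Z hZ h0 => ?_
    rw [Measure.restrict_apply hZ] at h0
    rw [happ Z hZ]
    refine measure_mono_null (t := ⋃ n : ℕ, h^[n] ⁻¹' (Z ∩ I)) ?_
      (measure_iUnion_null fun n => hF.volume_preimage_eq_zero hs (hZ.inter hIm) h0 n)
    rintro x ⟨hx, hxZ⟩
    exact mem_iUnion.2 ⟨_, hxZ, hmaps hx⟩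
  have : IsFiniteMeasure (pushLebesgue (returnSet h I) (firstReturn h I)) := by
    rw [pushLebesgue]; infer_instance
  set A := (fun x : ℝ => (x : T1)) '' Metric.ball (cen F m k) (θ * rad F m k) with hA
  have hball : Metric.ball (cen F m k) (θ * rad F m k) ⊆ cyl F m k := by
    rw [hF.cyl_eq_ball]; exact Metric.ball_subset_ball (by nlinarith)
  have hAI : A ⊆ I := image_mono hball
  have hAm : MeasurableSet A :=
    (QuotientAddGroup.isOpenMap_coe _ Metric.isOpen_ball).measurableSet
  refine ⟨fun x hx => hx.1, hmaps, hac, A, hAI, hAm, ?_,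
    two_lt_rnDeriv hAm hAI hac hC0 hC fun B hBA hB => ?_⟩
  · have hvA : volume A = ENNReal.ofReal (2 * (θ * rad F m k)) := by
      rw [hA, Real.ball_eq_Ioo, volume_eq_volume_preimage_inter
        (a := cen F m k - θ * rad F m k) (c := cen F m k + θ * rad F m k)
        (by nlinarith [hF.rad_le_half m k]) (by rw [← Real.ball_eq_Ioo]; exact hAm) subset_rfl,
        inter_eq_right.2 (subset_preimage_image _ _), Real.volume_Ioo]
      congr 1; ring
    rw [Measure.real, Measure.real, hvA, hF.volume_image_cyl, ENNReal.toReal_ofReal (by positivity),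
      ENNReal.toReal_ofReal (by positivity), lt_div_iff₀ (by positivity)]
    nlinarith
  · rw [happ B hB]
    exact hF.volume_le_volume_firstReturn hs hm hθ hC0.le hbr hB
      (hBA.trans (image_mono Metric.ball_subset_closedBall))

end ExpLift

/-! ### Goodness of the perturbed map and choice of the parameters -/

section

variable {G : ℝ → ℝ} {d : ℤ} {r : ℝ} {p s M : ℕ} {V : Set ℤ} {w : ℝ → ℝ} {K κ L b : ℝ}

lemma FinePert.isGood (h : FinePert G d r p s M V w K κ L b) {c a : ℝ}
    (hc : 2 * L * ((Real.exp (4 * b) ^ p)⁻¹ / (Real.exp (4 * b) - 1)) +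
      2 * (Real.exp (L / (r - 1)) * Real.exp (-(b / 2 * (s + M : ℕ))) * (1 / b)) ≤ c)
    (ha0 : 0 ≤ a) (ha : L * (r ^ p)⁻¹ ≤ a)
    (ht : 42 / 100 + (s + M : ℕ) * a ≤ 97 / 100 * (1 - κ) ^ M)
    (hfin : Real.exp c * (Real.exp a ^ (s + M) * (1 - κ) ^ M) ≤ 48 / 100)
    {δ η : ℝ} (hη0 : 0 ≤ η) (hη : η < δ) (hδ : (Real.exp (4 * b) ^ p)⁻¹ ≤ δ)
    (hcov : volume (Ioo (0 : ℝ) 1 \ {x | ∃ n ≤ s, ∃ k ∈ V, x ∈ cyl G (p + n) k}) ≤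
      ENNReal.ofReal η)
    {f : T1 → T1} (hs : ∀ x : ℝ, f (x : T1) = ((G ∘ shear G w V p s M κ) x : T1)) :
    IsGood δ f := by
  have hH := h.expLift'
  set H := G ∘ shear G w V p s M κ with hHdef
  have hcyl : ∀ n ≤ s, ∀ k, cyl H (p + n) k = cyl G (p + n) k := fun n hn k =>
    h.comp_shear_cyl (Or.inl (by omega))
  have hcr : ∀ n ≤ s, ∀ k, cen H (p + n) k = cen G (p + n) k ∧ rad H (p + n) k = rad G (p + n) k :=
    fun n hn k => hH.cen_rad_eq h.lift (hcyl n hn k)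
  refine ⟨hH.mem_E0lip hs,
    {I | ∃ n ≤ s, ∃ k ∈ V, I = (fun x : ℝ => (x : T1)) '' cyl H (p + n) k}, ?_, ?_, ?_⟩
  · rintro _ ⟨n, hn, k, hk, rfl⟩
    refine ⟨hH.isMarkovInterval_image_cyl hs _ _, ?_⟩
    have hr := hH.rad_pos (p + n) k
    rw [Measure.real, hH.volume_image_cyl, ENNReal.toReal_ofReal (by positivity)]
    have h1 := hH.rad_le (p + n) k
    have h2 : (Real.exp (4 * b) ^ (p + n))⁻¹ ≤ (Real.exp (4 * b) ^ p)⁻¹ :=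
      inv_anti₀ (pow_pos hH.pos _) (pow_le_pow_right₀ hH.one_lt.le (by omega))
    linarith
  · set 𝓘 := {I | ∃ n ≤ s, ∃ k ∈ V, I = (fun x : ℝ => (x : T1)) '' cyl H (p + n) k} with h𝓘
    have hU : MeasurableSet (⋃₀ 𝓘) := by
      refine (isOpen_sUnion ?_).measurableSet
      rintro _ ⟨n, -, k, -, rfl⟩
      exact hH.isOpen_image_cyl _ _
    have hle : volume (⋃₀ 𝓘)ᶜ ≤ ENNReal.ofReal η := by
      have hmp := AddCircle.measurePreserving_mk 1 (0 : ℝ)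
      rw [← hmp.measure_preimage hU.compl.nullMeasurableSet,
        Measure.restrict_apply' measurableSet_Ioc]
      refine (measure_mono (t := (Ioo (0 : ℝ) 1 \ {x | ∃ n ≤ s, ∃ k ∈ V, x ∈ cyl G (p + n) k}) ∪
        {1}) ?_).trans ((measure_union_le _ _).trans ?_)
      · rintro x ⟨hx, hx0, hx1⟩
        rw [zero_add] at hx1
        rcases hx1.eq_or_lt with rfl | hlt
        · exact Or.inr rfl
        · refine Or.inl ⟨⟨hx0, hlt⟩, ?_⟩
          rintro ⟨n, hn, k, hk, hxk⟩
          refine hx ⟨_, ⟨n, hn, k, hk, rfl⟩, x, ?_, rfl⟩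
          rwa [hcyl n hn]
      · rw [Real.volume_singleton, add_zero]
        exact hcov
    have h1 : volume.real (⋃₀ 𝓘)ᶜ ≤ η := ENNReal.toReal_le_of_le_ofReal hη0 hle
    have : IsProbabilityMeasure (volume : Measure T1) := ⟨UnitAddCircle.measure_univ⟩
    rw [probReal_compl_eq_one_sub hU] at h1
    linarith
  · rintro _ ⟨n, hn, k, hk, rfl⟩
    refine hH.isDistorted hs (θ := 42 / 100) (C := 48 / 100) (by norm_num) (by norm_num)
      (by norm_num) (by norm_num) fun t ht1 j hne y hy hyt => ?_
    have hk' : k + d ^ (p + n) * j ∈ V := h.per'.2 hk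
    have hrad : rad H (p + n) k = rad G (p + n) (k + d ^ (p + n) * j) := by
      rw [(hcr n hn k).2, h.lift.rad_add]
    rw [(hcr n hn _).1, hrad] at hyt
    rw [hrad]
    refine h.jac_mul_rad_le_of_return hc ha0 ha ht hfin hn ?_ hk' hy hyt
    -- A return with `n + t < s + M` would put a point in both levels `n` and `n + t` of the tower.
    by_contra! hlt
    obtain ⟨x, hx, hx'⟩ := hne
    rw [hcyl n hn] at hx
    rw [add_assoc, h.comp_shear_cyl (Or.inr ⟨hk', by omega⟩)] at hx'
    exact Set.disjoint_left.1 (h.disj n (n + t) (by omega) (by omega) k hk _ hk') hx hx'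

end

lemma uniformContinuous_of_periodic {g : ℝ → ℝ} (hg : Continuous g)
    (hper : Function.Periodic g 1) : UniformContinuous g := by
  have h1 : Continuous (hper.lift : T1 → ℝ) := hg.quotient_liftOn' _
  have h2 : UniformContinuous fun x : ℝ => (x : T1) :=
    uniformContinuous_addMonoidHom_of_continuous
      (f := QuotientAddGroup.mk' (AddSubgroup.zmultiples (1 : ℝ)))
      (AddCircle.continuous_mk' 1)
  exact (CompactSpace.uniformContinuous_of_continuous h1).comp h2

/-- A small contraction whose `M`-th power is a given factor. -/
lemma exists_one_sub_pow_eq {κ₀ : ℝ} (hκ₀ : 0 < κ₀) :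
    ∃ M : ℕ, 1 ≤ M ∧ ∃ κ : ℝ, 0 ≤ κ ∧ κ ≤ κ₀ ∧ (1 - κ) ^ M = 455 / 1000 := by
  obtain ⟨M, hM⟩ := exists_nat_gt (1 / κ₀)
  have hM0 : (0 : ℝ) < M := (one_div_pos.2 hκ₀).trans hM
  have hlog0 : Real.log (455 / 1000) ≤ 0 := Real.log_nonpos (by norm_num) (by norm_num)
  have hlog1 : -1 ≤ Real.log (455 / 1000) := by
    rw [Real.le_log_iff_exp_le (by norm_num), Real.exp_neg]
    have := Real.exp_one_gt_d9
    rw [inv_le_comm₀ (Real.exp_pos _) (by norm_num)]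
    norm_num at this ⊢
    linarith
  -- As `log 0.455 ≥ -1`, this `κ` is at most `1 / M`, which is below `κ₀`.
  refine ⟨M, by exact_mod_cast hM0, 1 - Real.exp (Real.log (455 / 1000) / M), ?_, ?_, ?_⟩
  · have : Real.exp (Real.log (455 / 1000) / M) ≤ 1 :=
      Real.exp_le_one_iff.2 (div_nonpos_of_nonpos_of_nonneg hlog0 hM0.le)
    linarith
  · have h1 := Real.add_one_le_exp (Real.log (455 / 1000) / M)
    have h2 : -(1 / (M : ℝ)) ≤ Real.log (455 / 1000) / M := by
      rw [← neg_div]; exact div_le_div_of_nonneg_right hlog1 hM0.le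
    have h3 : 1 / (M : ℝ) ≤ κ₀ := by
      rw [div_le_iff₀ hM0]
      rw [div_lt_iff₀ hκ₀] at hM
      linarith
    linarith
  · rw [sub_sub_cancel, ← Real.exp_nat_mul, mul_div_cancel₀ _ hM0.ne', Real.exp_log (by norm_num)]

namespace ExpLift

variable {G : ℝ → ℝ} {d : ℤ} {r : ℝ}

lemma uniformContinuous_deriv (h : ExpLift G d r) : UniformContinuous (deriv G) := by
  have hper : Function.Periodic (deriv G) 1 := fun x => by
    simpa using h.deriv_add_intCast x 1
  exact uniformContinuous_of_periodic (h.contDiff.continuous_deriv (by norm_num)) hper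

lemma exists_isGood (h : ExpLift G d r) {δ ε : ℝ} (hδ : 0 < δ) (hε : 0 < ε) :
    ∃ H r', ExpLift H d r' ∧ (∀ x, |deriv H x - deriv G x| ≤ ε) ∧
      ∀ f : T1 → T1, (∀ x : ℝ, f (x : T1) = (H x : T1)) → IsGood δ f := by
  obtain ⟨L, hL0, hL⟩ := h.exists_abs_log_deriv_sub_le
  obtain ⟨w, K, hw⟩ := exists_isProfile
  obtain ⟨B, hB⟩ := h.exists_abs_deriv_le
  obtain ⟨ρ, hρ, huc⟩ := Metric.uniformContinuous_iff.1 h.uniformContinuous_deriv (ε / 2)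
    (by positivity)
  have hK := hw.one_le
  have hK0 : 0 < K := by linarith
  have hr := h.one_lt
  have hr0 := h.pos
  set E := (1 + r) / 2 with hE
  have hE1 : 1 < E := by rw [hE]; linarith
  have hEr : E < r := by rw [hE]; linarith
  set b := Real.log E / 4 with hb
  have hb0 : 0 < b := div_pos (Real.log_pos hE1) (by norm_num)
  have hEb : Real.exp (4 * b) = E := by
    rw [hb, mul_div_cancel₀ _ (by norm_num), Real.exp_log (by linarith)]
  -- `κ₁` bounds `κ * K`. The last three conditions preserve the expansion rate `E`, use half of the
  -- allowance in `crude`, and use half of the allowed change `ε` of the derivative; the other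
  -- halves are met by taking `p` large.
  obtain ⟨κ₁, hκ₁, hκ₁1, hκ₁2, hκ₁3, hκ₁4⟩ : ∃ κ₁ : ℝ, 0 < κ₁ ∧ κ₁ ≤ 1 / 2 ∧ E ≤ r * (1 - κ₁) ∧
      4 * κ₁ ≤ b / 4 ∧ (B : ℝ) * κ₁ ≤ ε / 2 := by
    refine ⟨min (min (1 / 2) (1 - E / r)) (min (b / 16) (ε / 2 / (B + 1))), ?_, ?_, ?_, ?_, ?_⟩
    · have h1 : 0 < 1 - E / r := by rw [sub_pos, div_lt_one hr0]; exact hEr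
      have h2 : 0 < ε / 2 / ((B : ℝ) + 1) := by positivity
      have h3 : 0 < b / 16 := by positivity
      exact lt_min (lt_min (by norm_num) h1) (lt_min h3 h2)
    · exact (min_le_left _ _).trans (min_le_left _ _)
    · have h1 : min (min (1 / 2) (1 - E / r)) (min (b / 16) (ε / 2 / ((B : ℝ) + 1))) ≤ 1 - E / r :=
        (min_le_left _ _).trans (min_le_right _ _)
      have h2 : r * (E / r) = E := mul_div_cancel₀ _ hr0.ne'
      nlinarith
    · have h1 : min (min (1 / 2) (1 - E / r)) (min (b / 16) (ε / 2 / ((B : ℝ) + 1))) ≤ b / 16 :=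
        (min_le_right _ _).trans (min_le_left _ _)
      linarith
    · have h1 : min (min (1 / 2) (1 - E / r)) (min (b / 16) (ε / 2 / ((B : ℝ) + 1))) ≤
        ε / 2 / ((B : ℝ) + 1) := (min_le_right _ _).trans (min_le_right _ _)
      have hB0 : (0 : ℝ) ≤ B := B.coe_nonneg
      refine (mul_le_mul_of_nonneg_left h1 hB0).trans ?_
      rw [mul_div_assoc', div_le_iff₀ (by positivity)]
      nlinarith
  obtain ⟨M, hM, κ, hκ0, hκ, hκM⟩ := exists_one_sub_pow_eq (div_pos hκ₁ hK0)
  have hκK : κ * K ≤ κ₁ := by rwa [le_div_iff₀ hK0] at hκ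
  obtain ⟨R₀, hR₀⟩ := h.exists_tower (half_pos hδ) hM
  have hlim1 : Tendsto (fun n : ℕ => 2 * (Real.exp (L / (r - 1)) * Real.exp (-(b / 2 * n)) *
      (1 / b))) atTop (𝓝 0) := by
    have h1 : Tendsto (fun n : ℕ => Real.exp (-(b / 2 * n))) atTop (𝓝 0) :=
      Real.tendsto_exp_neg_atTop_nhds_zero.comp
        (tendsto_natCast_atTop_atTop.const_mul_atTop (by positivity))
    simpa using ((h1.const_mul (Real.exp (L / (r - 1)))).mul_const (1 / b)).const_mul 2
  have hlim2 : Tendsto (fun n : ℕ => b * n) atTop atTop :=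
    tendsto_natCast_atTop_atTop.const_mul_atTop hb0
  obtain ⟨N, hN⟩ := eventually_atTop.1 ((hlim1.eventually_le_const
    (show (0 : ℝ) < 1 / 200 by norm_num)).and (hlim2.eventually_ge_atTop (L / (r - 1))))
  -- The 3 makes `s = R * M - M - 1` at least `N + 1`.
  set R := max R₀ (N + 3) with hR
  have hRN : N + 3 ≤ R := le_max_right _ _
  obtain ⟨s, hsR⟩ : ∃ s, s + M + 1 = R * M := by
    refine ⟨R * M - (M + 1), ?_⟩
    have : 3 * M ≤ R * M := Nat.mul_le_mul_right _ (by omega)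
    omega
  have hsN : N + 1 ≤ s := by
    obtain ⟨R', hR'⟩ := Nat.exists_eq_add_of_le' (show 1 ≤ R by omega)
    have h1 : R' * 1 ≤ R' * M := Nat.mul_le_mul_left _ hM
    rw [hR', add_mul] at hsR
    omega
  obtain ⟨P₀, hP₀⟩ := hR₀ R (le_max_left _ _) s hsR
  -- The errors of all `s + M` steps down the tower add up to `1 / 100`.
  set a : ℝ := 1 / (100 * (s + M : ℕ)) with ha
  have hsM0 : (0 : ℝ) < (s + M : ℕ) := by exact_mod_cast (by omega : 0 < s + M)
  have ha0 : 0 < a := by positivity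
  have hsa : ((s + M : ℕ) : ℝ) * a = 1 / 100 := by rw [ha]; field_simp
  have hpow : ∀ x : ℝ, 1 < x → Tendsto (fun p : ℕ => (x ^ p)⁻¹) atTop (𝓝 0) := fun x hx =>
    tendsto_inv_atTop_zero.comp (tendsto_pow_atTop_atTop_of_one_lt hx)
  have hlimr := hpow r hr
  have hlimE := hpow E hE1
  have e1 : ∀ᶠ p : ℕ in atTop, L * (r ^ p)⁻¹ ≤ a := by
    have := hlimr.const_mul L
    rw [mul_zero] at this
    exact this.eventually_le_const ha0
  have e2 : ∀ᶠ p : ℕ in atTop, 2 * L * (E ^ p)⁻¹ ≤ b / 4 := by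
    have := hlimE.const_mul (2 * L)
    rw [mul_zero] at this
    exact this.eventually_le_const (by positivity)
  have e3 : ∀ᶠ p : ℕ in atTop, 2 * L * ((E ^ p)⁻¹ / (E - 1)) ≤ 1 / 200 := by
    have := (hlimE.div_const (E - 1)).const_mul (2 * L)
    rw [zero_div, mul_zero] at this
    exact this.eventually_le_const (by norm_num)
  obtain ⟨p, ⟨hp1, hp2, hp3⟩, hp4, hp5, hp6⟩ := ((e1.and (e2.and e3)).and
    ((hlimE.eventually_le_const hδ).and ((hlimr.eventually_lt_const hρ).and
      (eventually_ge_atTop P₀)))).exists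
  obtain ⟨V, hV1, hV2, hV3⟩ := hP₀ p hp6
  have hP : FinePert G d r p s M V w K κ L b :=
    { lift := h
      per := hV1
      disj := hV2
      prof := hw
      nonneg := hκ0
      mul_le := hκK.trans hκ₁1
      lip_nonneg := hL0
      lip := hL
      b_pos := hb0
      exp_le := by rw [hEb]; nlinarith
      crude := by rw [hEb]; linarith
      s_pos := by omega
      dist_le := (hN s (by omega)).2 }
  refine ⟨_, _, hP.expLift', fun x => ?_, fun f hf => ?_⟩
  · rw [hP.deriv_comp_shear]
    set Θ := shear G w V p s M κ
    have h1 := hP.abs_deriv_shear_sub_one_le x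
    have h2 := hP.abs_shear_sub_self_le x
    have h3 := huc (h2.trans_lt hp5)
    rw [Real.dist_eq] at h3
    have h4 := hB (Θ x)
    calc |deriv G (Θ x) * deriv Θ x - deriv G x|
        = |deriv G (Θ x) * (deriv Θ x - 1) + (deriv G (Θ x) - deriv G x)| := by congr 1; ring
      _ ≤ |deriv G (Θ x)| * |deriv Θ x - 1| + |deriv G (Θ x) - deriv G x| :=
        (abs_add_le _ _).trans_eq (by rw [abs_mul])
      _ ≤ B * κ₁ + ε / 2 := by
        refine add_le_add (mul_le_mul h4 (h1.trans hκK) (abs_nonneg _) B.coe_nonneg) h3.le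
      _ ≤ ε := by linarith
  -- The numerical margins are `0.42 + 0.01 ≤ 0.97 * 0.455` and `exp 0.02 * 0.455 ≤ 0.48`; the
  -- distortion `c` consists of two halves `1 / 200`, one made small by `p` and one by `s`.
  · refine hP.isGood (c := 1 / 100) (a := a) ?_ ha0.le hp1 ?_ ?_ (half_pos hδ).le
      (half_lt_self hδ) ?_ hV3 hf
    · rw [hEb]
      have := (hN (s + M) (by omega)).1
      linarith
    · rw [hsa, hκM]; norm_num
    · rw [hκM, ← Real.exp_nat_mul, hsa, ← mul_assoc, ← Real.exp_add]
      have := Real.exp_bound_div_one_sub_of_interval (x := 1 / 100 + 1 / 100) (by norm_num)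
        (by norm_num)
      norm_num at this ⊢
      linarith
    · rw [hEb]; exact hp4

end ExpLift

/-! ### Reduction from `C¹` to `C²` and conclusion -/

lemma exists_lift {f : T1 → T1} (hf : f ∈ E10) :
    ∃ (F : ℝ → ℝ) (d : ℤ) (r : ℝ), ContDiff ℝ 1 F ∧ (∀ x, F (x + 1) = F x + d) ∧
      1 < r ∧ (∀ x, r ≤ |deriv F x|) ∧ ∀ x : ℝ, f (x : T1) = (F x : T1) := by
  obtain ⟨⟨F, hF, hs⟩, -, r, hr, hexp⟩ := hf
  have hex : ∀ x : ℝ, ∃ j : ℤ, F (x + 1) = F x + j := fun x => by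
    rw [← coe_eq_coe_iff, ← hs, ← hs]
    congr 1
    exact coe_eq_coe_iff.2 ⟨1, by simp⟩
  choose g hg using hex
  have hgc : Continuous g := by
    rw [Int.isClosedEmbedding_coe_real.isInducing.continuous_iff]
    have : ((↑) : ℤ → ℝ) ∘ g = fun x => F (x + 1) - F x := by
      funext x; rw [hg]; simp
    rw [this]
    have := hF.continuous
    fun_prop
  refine ⟨F, g 0, r, hF, fun x => ?_, hr, fun x => ?_, hs⟩
  · rw [hg, PreconnectedSpace.constant inferInstance hgc (x := x) (y := 0)]
  · have := hexp (x : T1) 1 le_rfl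
    rw [Function.iterate_one, circleDeriv_coe hF.continuous hs, pow_one, one_mul] at this
    exact this.le

/-- A `C¹` lift is approximated by its averages over short intervals. -/
lemma exists_expLift_near {F : ℝ → ℝ} {d : ℤ} {r ε : ℝ} (hF : ContDiff ℝ 1 F)
    (hd : ∀ x, F (x + 1) = F x + d) (hr : 1 < r) (hF' : ∀ x, r ≤ |deriv F x|) (hε : 0 < ε) :
    ∃ G, ExpLift G d r ∧ ∀ x, |deriv G x - deriv F x| ≤ ε := by
  have hFc := hF.continuous
  have hper : Function.Periodic (deriv F) 1 := fun x => by
    rw [← deriv_comp_add_const, funext hd, deriv_add_const]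
  obtain ⟨ρ, hρ, huc⟩ := Metric.uniformContinuous_iff.1
    (uniformContinuous_of_periodic (hF.continuous_deriv le_rfl) hper) ε hε
  set a := ρ / 2 with ha
  have ha0 : 0 < a := half_pos hρ
  set A : ℝ → ℝ := fun x => ∫ t in (0 : ℝ)..1, F (x + a * t) with hA
  have hAe : ∀ x, A x = a⁻¹ * ((∫ t in (0 : ℝ)..x + a, F t) - ∫ t in (0 : ℝ)..x, F t) := fun x => by
    rw [hA]
    beta_reduce
    rw [intervalIntegral.integral_comp_add_mul F ha0.ne', smul_eq_mul, mul_zero, add_zero, mul_one,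
      intervalIntegral.integral_interval_sub_left (hFc.intervalIntegrable _ _)
        (hFc.intervalIntegrable _ _)]
  have hAd : ∀ x, HasDerivAt A (a⁻¹ * (F (x + a) - F x)) x := fun x => by
    rw [funext hAe]
    exact (((hFc.integral_hasStrictDerivAt 0 (x + a)).hasDerivAt.comp_add_const x a).sub
      (hFc.integral_hasStrictDerivAt 0 x).hasDerivAt).const_mul _
  -- The derivative of the average is a difference quotient, hence a value of `F'` at a nearby
  -- point. This gives at once the closeness and the unchanged lower bound `r`.
  have hmean : ∀ x, ∃ ξ, |ξ - x| ≤ a ∧ a⁻¹ * (F (x + a) - F x) = deriv F ξ := fun x => by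
    obtain ⟨ξ, hξ, e⟩ := exists_deriv_eq_slope F (show x < x + a by linarith) hFc.continuousOn
      (hF.differentiable one_ne_zero).differentiableOn
    refine ⟨ξ, ?_, ?_⟩
    · rw [abs_of_nonneg (by linarith [hξ.1])]
      linarith [hξ.2]
    · rw [e, add_sub_cancel_left, div_eq_inv_mul]
  have hGd : ∀ x, deriv (fun x => A x - A 0) x = a⁻¹ * (F (x + a) - F x) := fun x =>
    ((hAd x).sub_const _).deriv
  refine ⟨fun x => A x - A 0, ⟨?_, sub_self _, fun x => ?_, hr, fun x => ?_⟩, fun x => ?_⟩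
  · rw [show (2 : WithTop ℕ∞) = 1 + 1 by norm_num, contDiff_succ_iff_deriv]
    refine ⟨fun x => ((hAd x).sub_const _).differentiableAt, by simp, ?_⟩
    rw [funext hGd]
    exact contDiff_const.mul ((hF.comp (contDiff_id.add contDiff_const)).sub hF)
  · have : A (x + 1) = A x + d := by
      simp only [hA]
      rw [show (∫ t in (0 : ℝ)..1, F (x + a * t)) + (d : ℝ) =
        (∫ t in (0 : ℝ)..1, F (x + a * t)) + ∫ _t in (0 : ℝ)..1, (d : ℝ) by simp,
        ← intervalIntegral.integral_add (Continuous.intervalIntegrable (by fun_prop) _ _)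
          (Continuous.intervalIntegrable (by fun_prop) _ _)]
      refine intervalIntegral.integral_congr fun t _ => ?_
      rw [add_right_comm, hd]
    rw [this]; ring
  · obtain ⟨ξ, -, e⟩ := hmean x
    rw [hGd, e]
    exact hF' ξ
  · obtain ⟨ξ, hξ, e⟩ := hmean x
    rw [hGd, e]
    exact (huc (show dist ξ x < ρ by rw [Real.dist_eq]; linarith)).le

end GoodMaps

theorem mainTheorem4 (δ : ℝ) (hδ : 0 < δ) (f : GoodMaps.T1 → GoodMaps.T1)
    (hf : f ∈ GoodMaps.E10) (ε : ℝ) (hε : 0 < ε) :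
    ∃ h : GoodMaps.T1 → GoodMaps.T1,
      h ∈ GoodMaps.E10 ∧ GoodMaps.IsGood δ h ∧ GoodMaps.dLip h f < ENNReal.ofReal ε := by
  obtain ⟨F, d, r, hF, hd, hr, hF', hfF⟩ := GoodMaps.exists_lift hf
  obtain ⟨G, hG, hGF⟩ := GoodMaps.exists_expLift_near hF hd hr hF'
    (show 0 < ε / 4 by positivity)
  obtain ⟨H, r', hH, hHG, hgood⟩ := hG.exists_isGood hδ (show 0 < ε / 4 by positivity)
  have hper : Function.Periodic (fun x : ℝ => (H x : GoodMaps.T1)) 1 := fun x =>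
    GoodMaps.coe_eq_coe_iff.2 ⟨d, hH.map_add_one x⟩
  have hs : ∀ x : ℝ, hper.lift (x : GoodMaps.T1) = (H x : GoodMaps.T1) := fun x => hper.lift_coe x
  refine ⟨hper.lift, hH.mem_E10 hs, hgood _ hs, ?_⟩
  -- A pointwise bound passes to the essential supremum only as `≤`, so the two approximations use
  -- `ε / 4` each.
  refine lt_of_le_of_lt (b := ENNReal.ofReal (ε / 2)) ?_
    ((ENNReal.ofReal_lt_ofReal_iff hε).2 (half_lt_self hε))
  refine essSup_le_of_ae_le _ (Eventually.of_forall fun x => ?_)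
  obtain ⟨y, rfl⟩ := QuotientAddGroup.mk_surjective x
  change ‖GoodMaps.circleDeriv hper.lift (y : GoodMaps.T1) -
    GoodMaps.circleDeriv f (y : GoodMaps.T1)‖ₑ ≤ ENNReal.ofReal (ε / 2)
  rw [GoodMaps.circleDeriv_coe hH.continuous hs, GoodMaps.circleDeriv_coe hF.continuous hfF,
    Real.enorm_eq_ofReal_abs]
  refine ENNReal.ofReal_le_ofReal ?_
  have := abs_sub_le (deriv H y) (deriv G y) (deriv F y)
  linarith [hHG y, hGF y]
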